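/- Let $n\in\{2,3\}$ and let $\Omega\subset\mathbb R^n$ be a bounded domain (open and connected) with boundary of class $C^{1,1}$, where right-angled edges and corners are also allowed. That is, near each $x_0\in\partial\Omega$ the set $\Omega$ coincides with $\{g_1>0,\dots,g_m>0\}$ for some functions $g_j$ of class $C^{1,1}$ such that $\nabla g_1(x_0),\dots,\nabla g_m(x_0)$ are orthonormal; $m=1$ everywhere is the usual $C^{1,1}$ boundary, and rectangles and boxes are included. Let $(\cdot,\cdot)$ be the $L^2(\Omega)$ inner product, let $\boldsymbol H^1_\sigma(\Omega)=\{\boldsymbol\sigma\in H^1(\Omega)^n:\ \boldsymbol\sigma\cdot\mathbf n=0\text{ on }\partial\Omega\}$, and for $\boldsymbol\sigma,\bar{\boldsymbol\sigma}\in\boldsymbol H^1_\sigma(\Omega)$ let $$\langle B\boldsymbol\sigma,\bar{\boldsymbol\sigma}\rangle=(\boldsymbol\sigma,\bar{\boldsymbol\sigma})+(\nabla\cdot\boldsymbol\sigma,\nabla\cdot\bar{\boldsymbol\sigma})+(\operatorname{rot}\boldsymbol\sigma,\operatorname{rot}\bar{\boldsymbol\sigma}),$$ where $\operatorname{rot}$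 is the curl if $n=3$ and the scalar $\partial_1\sigma_2-\partial_2\sigma_1$ if $n=2$. **Theorem (unconditional unique solvability).** For every time step $k>0$ and every given $(u_{n-1},\boldsymbol\sigma_{n-1})\in H^1(\Omega)\times\boldsymbol H^1_\sigma(\Omega)$ there exists a unique $(u_n,\boldsymbol\sigma_n)\in H^1(\Omega)\times\boldsymbol H^1_\sigma(\Omega)$ that solves the time step of the linear coupled scheme LC: $$\Big(\frac{u_n-u_{n-1}}k,\bar u\Big)+(\nabla u_n,\nabla\bar u)=-(u_{n-1}\boldsymbol\sigma_n,\nabla\bar u)\qquad\forall\,\bar u\in H^1(\Omega),$$ $$\Big(\frac{\boldsymbol\sigma_n-\boldsymbol\sigma_{n-1}}k,\bar{\boldsymbol\sigma}\Big)+\langle B\boldsymbol\sigma_n,\bar{\boldsymbol\sigma}\rangle=2(u_{n-1}\nabla u_n,\bar{\boldsymbol\sigma})\qquad\forall\,\bar{\boldsymbol\sigma}\in\boldsymbol H^1_\sigma(\Omega).$$ (In $u_{n-1},u_n$ the subscript is the index of the time step, not the dimension.) -/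

import Mathlib

open MeasureTheory
open scoped NNReal ContDiff

noncomputable section

namespace ChemoLC

/-- The Euclidean space `ℝⁿ`. -/
abbrev E (n : ℕ) : Type := EuclideanSpace ℝ (Fin n)

/-- The Lebesgue space `L²(Ω)` of classes of real functions. -/
abbrev L2 {n : ℕ} (Ω : Set (E n)) : Type := Lp ℝ 2 (volume.restrict Ω)

/-- The classical partial derivative `∂φ/∂xᵢ` of a test function. -/
def pderiv {n : ℕ} (i : Fin n) (φ : E n → ℝ) (x : E n) : ℝ :=
  fderiv ℝ φ x (EuclideanSpace.single i 1)

/-- `∂Ω` is locally described by `C^{1,1}` functions: near every boundary point `x₀` the set `Ω` is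
`{g₁ > 0, …, gₘ > 0}` with `gⱼ` of class `C^{1,1}` and `∇g₁(x₀), …, ∇gₘ(x₀)` orthonormal.
If `m = 1` at each boundary point this says that `Ω` has a boundary of class `C^{1,1}` (and lies
locally on one side of it); `m ≥ 2` allows for right angles, as in a rectangle or a box. -/
def HasC11Boundary {n : ℕ} (Ω : Set (E n)) : Prop :=
  ∀ x₀ ∈ frontier Ω, ∃ (U : Set (E n)) (m : ℕ) (g : Fin m → E n → ℝ),
    IsOpen U ∧ x₀ ∈ U ∧
    (∀ j, ContDiff ℝ 1 (g j) ∧ ∃ K : ℝ≥0, LipschitzWith K (fderiv ℝ (g j))) ∧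
    Orthonormal ℝ (fun j => gradient (g j) x₀) ∧
    Ω ∩ U = {x ∈ U | ∀ j, 0 < g j x}

/-- `w` is the weak partial derivative `∂u/∂xᵢ` in `Ω`. -/
def IsWeakPartial {n : ℕ} (Ω : Set (E n)) (i : Fin n) (u w : E n → ℝ) : Prop :=
  ∀ φ : E n → ℝ, ContDiff ℝ ∞ φ → HasCompactSupport φ → tsupport φ ⊆ Ω →
    ∫ x in Ω, u x * pderiv i φ x = - ∫ x in Ω, w x * φ x

/-- The Sobolev space `H¹(Ω)`: the functions `u ∈ L²(Ω)` with a weak gradient in `L²(Ω)ⁿ`.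
The gradient is stored with the function; for open `Ω` it is determined by `u` (see `H1.ext_val`). -/
structure H1 {n : ℕ} (Ω : Set (E n)) where
  val : L2 Ω
  grad : Fin n → L2 Ω
  isWeakPartial : ∀ i, IsWeakPartial Ω i val (grad i)

theorem H1.ext_val {n : ℕ} {Ω : Set (E n)} (hΩ : IsOpen Ω) {u v : H1 Ω} (h : u.val = v.val) :
    u = v := by
  obtain ⟨u, gu, hu⟩ := u
  obtain ⟨v, gv, hv⟩ := v
  obtain rfl : u = v := h
  congr 1
  funext i
  have loc : ∀ w : L2 Ω, LocallyIntegrableOn (w : E n → ℝ) Ω volume := fun w =>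
    locallyIntegrableOn_of_locallyIntegrable_restrict ((Lp.memLp w).locallyIntegrable (by norm_num))
  have intg : ∀ (w : L2 Ω) (φ : E n → ℝ), ContDiff ℝ ∞ φ → HasCompactSupport φ →
      Integrable (fun x => w x * φ x) (volume.restrict Ω) := fun w φ h1 h2 =>
    (((Lp.memLp w).locallyIntegrable (by norm_num)).integrable_smul_right_of_hasCompactSupport
      h1.continuous h2)
  have key := hΩ.ae_eq_zero_of_integral_contDiff_smul_eq_zero ((loc (gu i)).sub (loc (gv i)))
    (fun φ h1 h2 h3 => by
      have e1 := hu i φ h1 h2 h3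
      have e2 := hv i φ h1 h2 h3
      have e3 : ∫ x in Ω, gu i x * φ x - gv i x * φ x = 0 := by
        rw [integral_sub (intg _ φ h1 h2) (intg _ φ h1 h2)]
        linarith
      rw [← setIntegral_eq_integral_of_forall_compl_eq_zero (s := Ω), ← e3]
      · congr 1
        funext x
        simp only [Pi.sub_apply, smul_eq_mul]
        ring
      · intro x hx
        have : φ x = 0 := by
          by_contra hne
          exact hx (h3 (subset_tsupport φ hne))
        simp [this])
  apply Lp.ext
  rw [Filter.EventuallyEq, ae_restrict_iff' hΩ.measurableSet]
  filter_upwards [key] with x hx hxΩ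
  have := hx hxΩ
  simp only [Pi.sub_apply] at this
  linarith

/-- The divergence `∇ · σ`. -/
def div {n : ℕ} {Ω : Set (E n)} (σ : Fin n → H1 Ω) (x : E n) : ℝ :=
  ∑ i, (σ i).grad i x

/-- The components `∂ᵢσⱼ - ∂ⱼσᵢ` of `rot σ`. -/
def rot {n : ℕ} {Ω : Set (E n)} (σ : Fin n → H1 Ω) (i j : Fin n) (x : E n) : ℝ :=
  (σ j).grad i x - (σ i).grad j x

/-- The pointwise product `rot σ · rot τ`, each component being counted once (`i < j`). -/
def rotDot {n : ℕ} {Ω : Set (E n)} (σ τ : Fin n → H1 Ω) (x : E n) : ℝ :=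
  ∑ i, ∑ j ∈ Finset.Ioi i, rot σ i j x * rot τ i j x

/-- In the plane `rot σ` is the scalar `∂₁σ₂ - ∂₂σ₁`. -/
theorem rotDot_two {Ω : Set (E 2)} (σ τ : Fin 2 → H1 Ω) (x : E 2) :
    rotDot σ τ x =
      ((σ 1).grad 0 x - (σ 0).grad 1 x) * ((τ 1).grad 0 x - (τ 0).grad 1 x) := by
  have h0 : Finset.Ioi (0 : Fin 2) = {1} := by decide
  have h1 : Finset.Ioi (1 : Fin 2) = ∅ := by decide
  simp [rotDot, rot, Fin.sum_univ_two, h0, h1]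

/-- In space `rot σ` is the curl `(∂₂σ₃ - ∂₃σ₂, ∂₃σ₁ - ∂₁σ₃, ∂₁σ₂ - ∂₂σ₁)`. -/
theorem rotDot_three {Ω : Set (E 3)} (σ τ : Fin 3 → H1 Ω) (x : E 3) :
    rotDot σ τ x =
      ((σ 2).grad 1 x - (σ 1).grad 2 x) * ((τ 2).grad 1 x - (τ 1).grad 2 x) +
      ((σ 0).grad 2 x - (σ 2).grad 0 x) * ((τ 0).grad 2 x - (τ 2).grad 0 x) +
      ((σ 1).grad 0 x - (σ 0).grad 1 x) * ((τ 1).grad 0 x - (τ 0).grad 1 x) := by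
  have h0 : Finset.Ioi (0 : Fin 3) = {1, 2} := by decide
  have h1 : Finset.Ioi (1 : Fin 3) = {2} := by decide
  have h2 : Finset.Ioi (2 : Fin 3) = ∅ := by decide
  simp only [rotDot, rot, Fin.sum_univ_three, h0, h1, h2, Finset.sum_singleton, Finset.sum_empty]
  rw [Finset.sum_pair (by decide)]
  ring

/-- `σ · 𝐧 = 0` on `∂Ω`: the normal trace of `σ`, defined by Green's formula
`⟨σ · 𝐧, φ⟩ = ∫_Ω σ · ∇φ + ∫_Ω (∇ · σ) φ` for `φ` smooth up to the boundary, vanishes. -/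
def HasZeroNormalTrace {n : ℕ} (Ω : Set (E n)) (σ : Fin n → H1 Ω) : Prop :=
  ∀ φ : E n → ℝ, ContDiff ℝ ∞ φ → HasCompactSupport φ →
    (∫ x in Ω, ∑ i, (σ i).val x * pderiv i φ x) + ∫ x in Ω, div σ x * φ x = 0

/-- The space `𝐇¹_σ(Ω) = {σ ∈ H¹(Ω)ⁿ : σ · 𝐧 = 0 on ∂Ω}`. -/
structure H1Sigma {n : ℕ} (Ω : Set (E n)) where
  comp : Fin n → H1 Ω
  normal_eq_zero : HasZeroNormalTrace Ω comp

/-- `⟨Bσ, τ⟩ = (σ, τ) + (∇ · σ, ∇ · τ) + (rot σ, rot τ)`. -/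
def B {n : ℕ} {Ω : Set (E n)} (σ τ : H1Sigma Ω) : ℝ :=
  (∫ x in Ω, ∑ i, (σ.comp i).val x * (τ.comp i).val x) +
  (∫ x in Ω, div σ.comp x * div τ.comp x) +
  ∫ x in Ω, rotDot σ.comp τ.comp x

/-- `(u, σ)` solves one time step, of length `k`, of the linear coupled scheme with previous
iterate `(u', σ')`. -/
structure IsLCStep {n : ℕ} {Ω : Set (E n)} (k : ℝ) (u' : H1 Ω) (σ' : H1Sigma Ω)
    (u : H1 Ω) (σ : H1Sigma Ω) : Prop where
  eq_u : ∀ w : H1 Ω,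
    (∫ x in Ω, (u.val x - u'.val x) / k * w.val x) + (∫ x in Ω, ∑ i, u.grad i x * w.grad i x) =
      - ∫ x in Ω, ∑ i, u'.val x * (σ.comp i).val x * w.grad i x
  eq_σ : ∀ τ : H1Sigma Ω,
    (∫ x in Ω, ∑ i, ((σ.comp i).val x - (σ'.comp i).val x) / k * (τ.comp i).val x) + B σ τ =
      2 * ∫ x in Ω, ∑ i, u'.val x * u.grad i x * (τ.comp i).val x

end ChemoLC

end

/-! Add twice the first equation to the second. This gives one equation for a bilinear form on
`H¹(Ω) × 𝐇¹_σ(Ω)`, whose coupling terms `2(u'σ, ∇ū) - 2(u'∇u, σ̄)` cancel when the test pair is the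
solution pair itself. On the diagonal there remains `(2/k)‖u‖² + 2‖∇u‖² + (1/k)‖σ‖² + ⟨Bσ, σ⟩`,
whatever `k > 0` and `u'` are. Existence and uniqueness then follow from Lax–Milgram, given two
facts about `Ω`.

Boundedness of the coupling needs `u'σ ∈ L²`, which Hölder's inequality derives from the Sobolev
embedding `H¹ ⊂ L⁴` (`exists_eLpNorm_four_le`, for dimensions 2 to 4). Coercivity needs Gaffney's
inequality `‖∇σ‖² ≤ K ⟨Bσ, σ⟩` for fields with zero normal trace (`exists_gaffney`). Both are proved
in a chart `{g₁ > 0, …, gₙ > 0}` with nearly orthonormal `∇gₖ` and globalised by cutoffs and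
compactness of the closure of `Ω`. No extension operator or flattening of the boundary is used.

For Gaffney, let `M` be the gradient matrix of the field `τ`. Since `|M|² = |rot τ|² + tr M²`, it
suffices to control the integral of `(tr M)² - tr M²`. Let `b_α` be the columns of the adjugate of
the matrix with rows `∇gₖ`; then `b_α` is tangent to every face `{gₖ = 0}` with `k ≠ α`. Up to terms
of lower order in `τ`, `det²` times this quadratic form is a sum over `α, β` of `∇v_α · C ∇v_β`,
where `v_α = τ · ∇g_α` and `C = b_α ∧ b_β` is antisymmetric (`adjugate_frame_identity`). Each
summand, completed by a term with the derivatives of `C`, is a divergence. Its boundary term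
vanishes on every face (`IsChart.nullLagrangian`), because the normal trace condition makes `v_α`
vanish on face `α` (`hasWeakGrad_normalComp`). The `C^{1,1}` bounds on `g` control the lower order
terms, which Young's inequality absorbs.

For Sobolev, `n` linearly independent directions point so strictly into `Ω` that rays along them do
not leave it within the chart. Integrating the derivative of `p³` along these rays and applying the
grid-lines lemma gives the Gagliardo–Nirenberg argument directly on `Ω`.

Both arguments use mollification with a kernel shifted off the origin: an inward shift approximates
up to the boundary, and an outward shift across one face yields functions vanishing near it
(`IsChart.exists_approx`). -/

noncomputable section

namespace ChemoLC

open Filter Metric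
open scoped Topology ENNReal Convolution

/-! ### Mollification in `L²` -/

/-- A smooth, compactly supported probability density. -/
structure IsKernel {n : ℕ} (κ : E n → ℝ) : Prop where
  contDiff : ContDiff ℝ ∞ κ
  hasCompactSupport : HasCompactSupport κ
  nonneg : ∀ x, 0 ≤ κ x
  integral_eq_one : ∫ x, κ x = 1

/-- The average of the translates `f (· + z)` of `f` with weights `κ z`. -/
def mollify {n : ℕ} (κ f : E n → ℝ) (x : E n) : ℝ :=
  ∫ y, f y * κ (y - x)

variable {n : ℕ}

theorem exists_kernel (c : E n) {r : ℝ} (hr : 0 < r) :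
    ∃ κ : E n → ℝ, IsKernel κ ∧ tsupport κ ⊆ closedBall c r := by
  let b : ContDiffBump c := ⟨r / 2, r, by positivity, by linarith⟩
  refine ⟨b.normed volume, ⟨b.contDiff_normed, b.hasCompactSupport_normed, b.nonneg_normed,
    b.integral_normed⟩, ?_⟩
  rw [b.tsupport_normed_eq]

theorem IsKernel.integrable {κ : E n → ℝ} (h : IsKernel κ) : Integrable κ :=
  h.contDiff.continuous.integrable_of_hasCompactSupport h.hasCompactSupport

theorem mollify_eq_integral_add (κ f : E n → ℝ) (x : E n) :
    mollify κ f x = ∫ z, f (x + z) * κ z := by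
  rw [mollify, ← integral_add_left_eq_self _ x]
  simp

theorem mollify_eq_zero {κ f : E n → ℝ} {x : E n} (h : ∀ z, κ z ≠ 0 → f (x + z) = 0) :
    mollify κ f x = 0 := by
  rw [mollify_eq_integral_add]
  refine integral_eq_zero_of_ae (.of_forall fun z => ?_)
  by_cases hz : κ z = 0 <;> simp [hz, h z]

theorem mollify_congr_ae {κ f g : E n → ℝ} (h : f =ᵐ[volume] g) : mollify κ f = mollify κ g := by
  funext x
  refine integral_congr_ae ?_
  filter_upwards [h] with y hy
  rw [hy]

theorem mollify_eq_convolution (κ f : E n → ℝ) :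
    mollify κ f = f ⋆[ContinuousLinearMap.mul ℝ ℝ] (fun w => κ (-w)) := by
  funext x
  simp [mollify, convolution]

theorem IsKernel.contDiff_mollify {κ f : E n → ℝ} (h : IsKernel κ) (hf : LocallyIntegrable f) :
    ContDiff ℝ ∞ (mollify κ f) := by
  rw [mollify_eq_convolution]
  refine HasCompactSupport.contDiff_convolution_right _ ?_ hf (h.contDiff.comp contDiff_neg)
  exact h.hasCompactSupport.comp_homeomorph (Homeomorph.neg _)

theorem pderiv_comp_sub (i : Fin n) (κ : E n → ℝ) (x y : E n) :
    pderiv i (fun y => κ (y - x)) y = pderiv i κ (y - x) := by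
  simp only [pderiv]
  rw [fderiv_comp_sub]

theorem IsKernel.pderiv_mollify {κ f : E n → ℝ} (h : IsKernel κ) (hf : LocallyIntegrable f)
    (i : Fin n) (x : E n) :
    pderiv i (mollify κ f) x = - ∫ y, f y * pderiv i κ (y - x) := by
  rw [mollify_eq_convolution, pderiv]
  have hc : HasCompactSupport fun w => κ (-w) :=
    h.hasCompactSupport.comp_homeomorph (Homeomorph.neg _)
  have hd : ContDiff ℝ 1 fun w => κ (-w) := (h.contDiff.of_le (by norm_cast)).comp contDiff_neg
  rw [(hc.hasFDerivAt_convolution_right (ContinuousLinearMap.mul ℝ ℝ) hf hd x).fderiv,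
    convolution_precompR_apply _ hf (hc.fderiv ℝ) (hd.continuous_fderiv one_ne_zero),
    convolution, ← integral_neg]
  congr 1
  funext y
  have : HasFDerivAt (fun w => κ (-w)) ((fderiv ℝ κ (-(x - y))).comp
      (-(ContinuousLinearMap.id ℝ (E n)))) (x - y) :=
    ((h.contDiff.differentiable (by simp)) _).hasFDerivAt.comp (x - y) (hasFDerivAt_id _).neg
  rw [this.fderiv]
  simp [pderiv]

theorem IsKernel.hasCompactSupport_mollify {κ f : E n → ℝ} (h : IsKernel κ)
    (hf : HasCompactSupport f) : HasCompactSupport (mollify κ f) := by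
  rw [mollify_eq_convolution]
  exact HasCompactSupport.convolution _ hf
    (h.hasCompactSupport.comp_homeomorph (Homeomorph.neg _))

/-- Translation is continuous on `L²`. -/
theorem tendsto_eLpNorm_translate_sub {f : E n → ℝ} (hf : MemLp f 2) :
    Tendsto (fun z => eLpNorm (fun x => f (x + z) - f x) 2 volume) (𝓝 0) (𝓝 0) := by
  let T : C(E n, C(E n, E n)) := (ContinuousMap.mk (fun a : E n × E n => a.2 + a.1)
    (by fun_prop)).curry
  have hT : ∀ z, MeasurePreserving (T z) volume volume := fun z =>
    measurePreserving_add_right volume z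
  have hc : Continuous fun z => Lp.compMeasurePreserving (T z) (hT z) (hf.toLp f) :=
    continuous_const.compMeasurePreservingLp T.continuous hT (by norm_num)
  have h0 := (hc.tendsto 0)
  rw [tendsto_iff_edist_tendsto_0] at h0
  refine h0.congr fun z => ?_
  rw [Lp.edist_def]
  refine eLpNorm_congr_ae ?_
  have e1 : ∀ z, Lp.compMeasurePreserving (T z) (hT z) (hf.toLp f) =ᵐ[volume]
      fun x => f (x + z) := fun z => by
    refine (Lp.coeFn_compMeasurePreserving _ _).trans ?_
    exact (hT z).quasiMeasurePreserving.ae_eq_comp hf.coeFn_toLp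
  filter_upwards [e1 z, e1 0] with x h1 h2
  rw [Pi.sub_apply, h1, h2, add_zero]

/-- With `κ` as a probability density, `mollify κ f - f` is an average of the differences `f (· + z)
- f`. Jensen's inequality and Tonelli's theorem bound its `L²` norm by the worst translate seen by
`κ`. -/
theorem IsKernel.eLpNorm_mollify_sub_le {κ f : E n → ℝ} (h : IsKernel κ) (hf : MemLp f 2)
    {ε : ℝ≥0∞} (hε : ∀ z, κ z ≠ 0 → eLpNorm (fun x => f (x + z) - f x) 2 volume ≤ ε) :
    eLpNorm (mollify κ f - f) 2 volume ≤ ε := by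
  -- Tonelli needs `f (x + z)` to be jointly measurable in `(x, z)`, so `f` is replaced by a
  -- strongly measurable representative.
  wlog hm : StronglyMeasurable f generalizing f
  · obtain ⟨g, hg, hfg⟩ := hf.1
    have := this (f := g) ((memLp_congr_ae hfg).1 hf) (fun z hz => ?_) hg
    · rw [mollify_congr_ae hfg]
      refine (eLpNorm_congr_ae ?_).trans_le this
      filter_upwards [hfg] with x hx
      simp [hx]
    · refine (eLpNorm_congr_ae ?_).trans_le (hε z hz)
      have := (measurePreserving_add_right volume z).quasiMeasurePreserving.ae_eq_comp hfg
      filter_upwards [hfg, this] with x h1 h2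
      simp only [Function.comp_apply] at h2
      rw [h1, h2]
  let ν : Measure (E n) := volume.withDensity fun z => ENNReal.ofReal (κ z)
  have hκm : Measurable fun z => ENNReal.ofReal (κ z) :=
    h.contDiff.continuous.measurable.ennreal_ofReal
  have hν : IsProbabilityMeasure ν := ⟨by
    rw [withDensity_apply _ MeasurableSet.univ, Measure.restrict_univ,
      ← ofReal_integral_eq_lintegral_ofReal h.integrable (.of_forall h.nonneg),
      h.integral_eq_one, ENNReal.ofReal_one]⟩
  have hint : ∀ g : E n → ℝ, ∫ z, g z ∂ν = ∫ z, g z * κ z := fun g => by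
    rw [integral_withDensity_eq_integral_toReal_smul hκm (by simp)]
    congr 1; funext z
    simp [ENNReal.toReal_ofReal (h.nonneg z), mul_comm]
  have hloc : ∀ x, Integrable (fun z => f (x + z)) ν := fun x => by
    rw [integrable_withDensity_iff hκm (by simp)]
    simp only [ENNReal.toReal_ofReal (h.nonneg _)]
    have := (hf.locallyIntegrable (by norm_num)).integrable_smul_right_of_hasCompactSupport
      (g := fun y => κ (y - x)) (h.contDiff.continuous.comp (continuous_id.sub continuous_const))
      (h.hasCompactSupport.comp_homeomorph (Homeomorph.subRight x))
    simpa using this.comp_add_left x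
  have hpt : ∀ x, ‖(mollify κ f - f) x‖ₑ ^ (2:ℝ) ≤
      ∫⁻ z, ‖f (x + z) - f x‖ₑ ^ (2:ℝ) ∂ν := fun x => by
    have e : (mollify κ f - f) x = ∫ z, (f (x + z) - f x) ∂ν := by
      rw [integral_sub (hloc x) (integrable_const _), hint, Pi.sub_apply,
        mollify_eq_integral_add]
      simp
    have h1 : ‖(mollify κ f - f) x‖ₑ ≤ eLpNorm (fun z => f (x + z) - f x) 1 ν := by
      rw [e, eLpNorm_one_eq_lintegral_enorm]
      exact enorm_integral_le_lintegral_enorm _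
    have h2 := h1.trans (eLpNorm_le_eLpNorm_of_exponent_le (p := 1) (q := 2) (by norm_num)
      ((hloc x).1.sub aestronglyMeasurable_const))
    rw [eLpNorm_eq_lintegral_rpow_enorm_toReal (by norm_num) (by norm_num)] at h2
    have h3 := ENNReal.rpow_le_rpow h2 (z := 2) (by norm_num)
    rwa [← ENNReal.rpow_mul, ENNReal.toReal_ofNat, one_div, inv_mul_cancel₀ (by norm_num),
      ENNReal.rpow_one] at h3
  have h4 : ∫⁻ x, ‖(mollify κ f - f) x‖ₑ ^ (2:ℝ) ≤ ε ^ (2:ℝ) := by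
    calc _ ≤ ∫⁻ x, ∫⁻ z, ‖f (x + z) - f x‖ₑ ^ (2:ℝ) ∂ν := lintegral_mono hpt
      _ = ∫⁻ z, ∫⁻ x, ‖f (x + z) - f x‖ₑ ^ (2:ℝ) ∂volume ∂ν := by
        refine lintegral_lintegral_swap ?_
        have : StronglyMeasurable fun p : E n × E n => f (p.1 + p.2) - f p.1 :=
          (hm.comp_measurable (measurable_fst.add measurable_snd)).sub
            (hm.comp_measurable measurable_fst)
        exact (this.enorm.pow_const _).aemeasurable
      _ ≤ ∫⁻ z, ε ^ (2:ℝ) ∂ν := by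
        refine lintegral_mono_ae ?_
        refine (ae_withDensity_iff hκm).2 (.of_forall fun z hz => ?_)
        have hz' : κ z ≠ 0 := fun h0 => hz (by simp [h0])
        have := hε z hz'
        rw [eLpNorm_eq_lintegral_rpow_enorm_toReal (by norm_num) (by norm_num)] at this
        have h3 := ENNReal.rpow_le_rpow this (z := 2) (by norm_num)
        rwa [← ENNReal.rpow_mul, ENNReal.toReal_ofNat, one_div, inv_mul_cancel₀ (by norm_num),
          ENNReal.rpow_one] at h3
      _ = ε ^ (2:ℝ) := by simp
  rw [eLpNorm_eq_lintegral_rpow_enorm_toReal (by norm_num) (by norm_num), ENNReal.toReal_ofNat]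
  have h5 := ENNReal.rpow_le_rpow h4 (z := 1 / 2) (by norm_num)
  rwa [← ENNReal.rpow_mul, mul_one_div_cancel (by norm_num), ENNReal.rpow_one] at h5

/-- A sequence of kernels concentrating at the origin. -/
structure IsApproxId (κ : ℕ → E n → ℝ) : Prop where
  isKernel : ∀ m, IsKernel (κ m)
  eventually_norm_le : ∀ δ > 0, ∀ᶠ m in atTop, ∀ z, κ m z ≠ 0 → ‖z‖ ≤ δ

theorem IsApproxId.tendsto_mollify {κ : ℕ → E n → ℝ} (h : IsApproxId κ) {f : E n → ℝ}
    (hf : MemLp f 2) :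
    Tendsto (fun m => eLpNorm (mollify (κ m) f - f) 2 volume) atTop (𝓝 0) := by
  rw [ENNReal.tendsto_nhds_zero]
  intro ε hε
  have h0 := ENNReal.tendsto_nhds_zero.1 (tendsto_eLpNorm_translate_sub hf) ε hε
  obtain ⟨δ, hδ, hδε⟩ := Metric.eventually_nhds_iff_ball.1 h0
  filter_upwards [h.eventually_norm_le (δ / 2) (by positivity)] with m hm
  refine (h.isKernel m).eLpNorm_mollify_sub_le hf fun z hz => hδε z ?_
  rw [mem_ball_zero_iff]
  linarith [hm z hz]

/-- Kernels concentrating at the origin, and supported in an open cone about `e`. -/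
theorem exists_approxId (e : E n) {δ : ℝ} (hδ : 0 < δ) :
    ∃ κ : ℕ → E n → ℝ, IsApproxId κ ∧
      ∀ m, tsupport (κ m) ⊆ closedBall ((1 / (m + 1 : ℝ)) • e) (δ * (1 / (m + 1 : ℝ))) := by
  have := fun m : ℕ => exists_kernel ((1 / (m + 1 : ℝ)) • e) (r := δ * (1 / (m + 1 : ℝ)))
    (by positivity)
  choose κ hκ hs using this
  refine ⟨κ, ⟨hκ, fun ε hε => ?_⟩, hs⟩
  have ht : Tendsto (fun m : ℕ => (‖e‖ + δ) * (1 / (m + 1 : ℝ))) atTop (𝓝 0) := by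
    simpa using tendsto_one_div_add_atTop_nhds_zero_nat.const_mul (‖e‖ + δ)
  filter_upwards [ht.eventually (ge_mem_nhds hε)] with m hm z hz
  have := hs m (subset_tsupport _ hz)
  rw [mem_closedBall, dist_eq_norm] at this
  have h2 : ‖(1 / (m + 1 : ℝ)) • e‖ = (1 / (m + 1 : ℝ)) * ‖e‖ := by
    rw [norm_smul, Real.norm_of_nonneg (by positivity)]
  have h3 := norm_le_norm_add_norm_sub' z ((1 / (m + 1 : ℝ)) • e)
  linarith

/-- Translates have the norm of `f`, so `2‖f‖` is an admissible `ε` in the previous estimate for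
every kernel. -/
theorem MemLp.mollify {κ f : E n → ℝ} (h : IsKernel κ) (hf : MemLp f 2) :
    MemLp (mollify κ f) 2 := by
  have h1 : MemLp (ChemoLC.mollify κ f - f) 2 := by
    refine ⟨((h.contDiff_mollify (hf.locallyIntegrable (by norm_num))).continuous.aestronglyMeasurable).sub
      hf.1, (h.eLpNorm_mollify_sub_le hf (ε := 2 * eLpNorm f 2 volume) fun z _ => ?_).trans_lt
        (ENNReal.mul_lt_top (by norm_num) hf.2)⟩
    have hp := measurePreserving_add_right (volume : Measure (E n)) z
    refine (eLpNorm_sub_le (hf.1.comp_measurePreserving hp) hf.1 (by norm_num)).trans ?_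
    have := eLpNorm_comp_measurePreserving (p := 2) hf.1 hp
    rw [two_mul]
    exact add_le_add_left this.le _
  simpa using h1.add hf

/-! ### Locally Lipschitz functions and integration by parts -/

theorem LocallyLipschitz.mul {f g : E n → ℝ} (hf : LocallyLipschitz f) (hg : LocallyLipschitz g) :
    LocallyLipschitz fun x => f x * g x :=
  (contDiff_mul (𝕜 := ℝ) (𝔸 := ℝ) (n := 1)).locallyLipschitz.comp (hf.prodMk hg)

theorem LocallyLipschitz.finsetSum {ι : Type*} (s : Finset ι) {f : ι → E n → ℝ}
    (hf : ∀ i ∈ s, LocallyLipschitz (f i)) : LocallyLipschitz fun x => ∑ i ∈ s, f i x := by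
  classical
  induction s using Finset.induction_on with
  | empty => simpa using LocallyLipschitz.const (0 : ℝ)
  | insert a s ha ih =>
    simp only [Finset.sum_insert ha]
    exact (hf a (by simp)).add (ih fun i hi => hf i (by simp [hi]))

/-- With the support in the ball of radius `R`, pairs inside radius `R + 1` use the Lipschitz
constant on that compact ball. A pair with one point in the inner ball and the other outside the
larger one is at distance at least `1`, so the sup bound `M` serves as a Lipschitz constant. -/
theorem LocallyLipschitz.exists_lipschitzWith {f : E n → ℝ} (hf : LocallyLipschitz f)
    (hc : HasCompactSupport f) : ∃ K, LipschitzWith K f := by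
  obtain ⟨R, hR⟩ := hc.isCompact.isBounded.subset_closedBall 0
  obtain ⟨C, hC⟩ := LocallyLipschitzOn.exists_lipschitzOnWith_of_compact
    (isCompact_closedBall (0 : E n) (R + 1)) (LocallyLipschitz.locallyLipschitzOn hf)
  obtain ⟨M, hM⟩ := hc.exists_bound_of_continuous hf.continuous
  have hM0 : 0 ≤ M := (norm_nonneg _).trans (hM 0)
  have h0 : ∀ x, x ∉ closedBall (0 : E n) R → f x = 0 := fun x hx => by
    by_contra h
    exact hx (hR (subset_tsupport _ h))
  have key : ∀ x ∈ closedBall (0 : E n) R, ∀ y, dist (f x) (f y) ≤ (C + M) * dist x y := by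
    intro x hx y
    by_cases hy : y ∈ closedBall (0 : E n) (R + 1)
    · refine (hC.dist_le_mul x (closedBall_subset_closedBall (by linarith) hx) y hy).trans ?_
      gcongr
      linarith
    · have hy' : y ∉ closedBall (0 : E n) R := fun h =>
        hy (closedBall_subset_closedBall (by linarith) h)
      rw [h0 y hy', dist_zero_right]
      rw [mem_closedBall] at hx hy
      have : 1 ≤ dist x y := by
        have := dist_triangle y x 0
        rw [dist_comm y x] at this
        linarith
      have h2 := hM x
      nlinarith [C.coe_nonneg]
  refine ⟨C + M.toNNReal, LipschitzWith.of_dist_le_mul fun x y => ?_⟩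
  rw [NNReal.coe_add, Real.coe_toNNReal M hM0]
  by_cases hx : x ∈ closedBall (0 : E n) R
  · exact key x hx y
  · by_cases hy : y ∈ closedBall (0 : E n) R
    · rw [dist_comm, dist_comm x]
      exact key y hy x
    · rw [h0 x hx, h0 y hy, dist_self]
      positivity

/-- Rademacher's theorem on neighbourhoods; a set that is locally null is null. -/
theorem LocallyLipschitz.ae_differentiableAt {f : E n → ℝ} (hf : LocallyLipschitz f) :
    ∀ᵐ x, DifferentiableAt ℝ f x := by
  refine measure_null_of_locally_null _ fun x _ => ?_
  obtain ⟨K, t, ht, hL⟩ := hf x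
  have h := hL.ae_differentiableWithinAt_of_mem (μ := volume)
  refine ⟨_, inter_mem_nhdsWithin _ (interior_mem_nhds.2 ht), ?_⟩
  refine measure_mono_null ?_ h
  rintro y ⟨h1, h2⟩ h3
  exact h1 ((h3 (interior_subset h2)).differentiableAt (mem_interior_iff_mem_nhds.1 h2))

/-- The derivative bound holds at every point and not only almost everywhere, because `fderiv` is
`0` where no derivative exists. The margin in the radius `R + 1` makes the ball a neighbourhood of
each point of `K`. -/
theorem LocallyLipschitz.exists_bound {f : E n → ℝ} (hf : LocallyLipschitz f)
    {K : Set (E n)} (hK : IsCompact K) :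
    ∃ C, 0 ≤ C ∧ ∀ x ∈ K, |f x| ≤ C ∧ ∀ i, |pderiv i f x| ≤ C := by
  obtain ⟨R, hR⟩ := hK.isBounded.subset_closedBall 0
  have hc := isCompact_closedBall (0 : E n) (R + 1)
  obtain ⟨C, hC⟩ := LocallyLipschitzOn.exists_lipschitzOnWith_of_compact hc
    (LocallyLipschitz.locallyLipschitzOn hf)
  obtain ⟨M, hM⟩ := hc.exists_bound_of_continuousOn hf.continuous.continuousOn
  refine ⟨max C M, le_max_of_le_left C.coe_nonneg, fun x hx => ⟨?_, fun i => ?_⟩⟩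
  · exact (hM x (closedBall_subset_closedBall (by linarith) (hR hx))).trans (le_max_right _ _)
  · have hn : closedBall (0 : E n) (R + 1) ∈ 𝓝 x := by
      refine closedBall_mem_nhds_of_mem ?_
      have := hR hx
      rw [mem_closedBall] at this
      rw [mem_ball]
      linarith
    have h1 := norm_fderiv_le_of_lipschitzOn ℝ hn hC
    refine le_trans ?_ (le_max_left _ _)
    have h2 := (fderiv ℝ f x).le_opNorm (EuclideanSpace.single i 1)
    simp only [PiLp.norm_single, norm_one, mul_one] at h2
    exact h2.trans h1

theorem measurable_pderiv (i : Fin n) (f : E n → ℝ) : Measurable (pderiv i f) :=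
  measurable_fderiv_apply_const ℝ f _

theorem pderiv_mul {f g : E n → ℝ} {x : E n} (i : Fin n) (hf : DifferentiableAt ℝ f x)
    (hg : DifferentiableAt ℝ g x) :
    pderiv i (fun x => f x * g x) x = f x * pderiv i g x + pderiv i f x * g x := by
  simp only [pderiv]
  rw [fderiv_fun_mul hf hg]
  simp [mul_comm]

theorem pderiv_sum {ι : Type*} (s : Finset ι) {f : ι → E n → ℝ} {x : E n} (i : Fin n)
    (hf : ∀ j ∈ s, DifferentiableAt ℝ (f j) x) :
    pderiv i (fun x => ∑ j ∈ s, f j x) x = ∑ j ∈ s, pderiv i (f j) x := by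
  simp only [pderiv]
  rw [fderiv_fun_sum hf]
  simp

theorem pderiv_comp {h : ℝ → ℝ} {f : E n → ℝ} {x : E n} (i : Fin n)
    (hh : DifferentiableAt ℝ h (f x)) (hf : DifferentiableAt ℝ f x) :
    pderiv i (fun x => h (f x)) x = deriv h (f x) * pderiv i f x := by
  simp only [pderiv]
  rw [show (fun x => h (f x)) = h ∘ f from rfl, fderiv_comp x hh hf]
  simp [mul_comm]

theorem pderiv_eq_zero_of_notMem {f : E n → ℝ} {x : E n} (i : Fin n) (hx : x ∉ tsupport f) :
    pderiv i f x = 0 := by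
  have : fderiv ℝ f x = 0 := by
    by_contra h
    exact hx (support_fderiv_subset ℝ h)
  simp [pderiv, this]

theorem memLp_of_bound_of_compact {f : E n → ℝ} (hf : AEStronglyMeasurable f) {K : Set (E n)}
    (hK : IsCompact K) {C : ℝ} (hC : ∀ x ∈ K, |f x| ≤ C) (h0 : ∀ x ∉ K, f x = 0) (p : ℝ≥0∞) :
    MemLp f p := by
  refine (memLp_indicator_const p hK.measurableSet C (Or.inr hK.measure_lt_top.ne)).mono hf
    (.of_forall fun x => ?_)
  by_cases hx : x ∈ K
  · simpa [hx] using (hC x hx).trans (le_abs_self C)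
  · simp [hx, h0 x hx]

theorem LocallyLipschitz.memLp {f : E n → ℝ} (hf : LocallyLipschitz f)
    (hc : HasCompactSupport f) (p : ℝ≥0∞) : MemLp f p := by
  obtain ⟨C, _, hC⟩ := LocallyLipschitz.exists_bound hf hc.isCompact
  exact memLp_of_bound_of_compact hf.continuous.aestronglyMeasurable hc.isCompact
    (fun x hx => (hC x hx).1) (fun x hx => image_eq_zero_of_notMem_tsupport hx) p

theorem LocallyLipschitz.memLp_pderiv {f : E n → ℝ} (hf : LocallyLipschitz f)
    (hc : HasCompactSupport f) (i : Fin n) (p : ℝ≥0∞) : MemLp (pderiv i f) p := by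
  obtain ⟨C, _, hC⟩ := LocallyLipschitz.exists_bound hf hc.isCompact
  exact memLp_of_bound_of_compact (measurable_pderiv i f).aestronglyMeasurable hc.isCompact
    (fun x hx => (hC x hx).2 i) (fun x hx => pderiv_eq_zero_of_notMem i hx) p

/-- Multiplication by a function that is bounded where `f ≠ 0` preserves `L²`. -/
theorem MemLp.mul_of_bound {f h : E n → ℝ} (hf : MemLp f 2) (hh : AEStronglyMeasurable h) {C : ℝ}
    (hC : ∀ x, f x ≠ 0 → |h x| ≤ C) : MemLp (fun x => f x * h x) 2 := by
  refine hf.of_le_mul (c := C) (hf.1.mul hh) (.of_forall fun x => ?_)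
  by_cases hx : f x = 0
  · simp [hx]
  · rw [norm_mul, mul_comm]
    exact mul_le_mul_of_nonneg_right (hC x hx) (norm_nonneg _)

theorem integrable_mul_L2 {f g : E n → ℝ} (hf : MemLp f 2) (hg : MemLp g 2) :
    Integrable fun x => f x * g x :=
  hf.integrable_mul hg

/-- Integration by parts for locally Lipschitz functions. -/
theorem integral_mul_pderiv {f g : E n → ℝ} (hf : LocallyLipschitz f) (hfc : HasCompactSupport f)
    (hg : LocallyLipschitz g) (hgc : HasCompactSupport g) (i : Fin n) :
    ∫ x, f x * pderiv i g x = - ∫ x, pderiv i f x * g x := by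
  obtain ⟨C, hC⟩ := LocallyLipschitz.exists_lipschitzWith hf hfc
  obtain ⟨D, hD⟩ := LocallyLipschitz.exists_lipschitzWith hg hgc
  have h := hC.integral_lineDeriv_mul_eq (μ := volume) hD hgc (EuclideanSpace.single i 1)
  have h1 : ∫ x, lineDeriv ℝ f x (EuclideanSpace.single i 1) * g x = ∫ x, pderiv i f x * g x := by
    refine integral_congr_ae ?_
    filter_upwards [LocallyLipschitz.ae_differentiableAt hf] with x hx
    rw [hx.lineDeriv_eq_fderiv, pderiv]
  have h2 : ∫ x, lineDeriv ℝ g x (-EuclideanSpace.single i 1) * f x =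
      ∫ x, - (f x * pderiv i g x) := by
    refine integral_congr_ae ?_
    filter_upwards [LocallyLipschitz.ae_differentiableAt hg] with x hx
    rw [hx.lineDeriv_eq_fderiv, pderiv, map_neg]
    ring
  rw [h1, h2, integral_neg] at h
  linarith

theorem IsKernel.pderiv_mollify_of_lipschitz {κ f : E n → ℝ} (h : IsKernel κ)
    (hf : LocallyLipschitz f) (hfc : HasCompactSupport f) (i : Fin n) :
    pderiv i (mollify κ f) = mollify κ (pderiv i f) := by
  funext x
  rw [h.pderiv_mollify (hf.continuous.locallyIntegrable), mollify]
  have hk : LocallyLipschitz fun y => κ (y - x) := ContDiff.locallyLipschitz (𝕂 := ℝ)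
    ((h.contDiff.of_le (by norm_cast)).comp (contDiff_id.sub contDiff_const))
  have hkc : HasCompactSupport fun y => κ (y - x) :=
    h.hasCompactSupport.comp_homeomorph (Homeomorph.subRight x)
  have := integral_mul_pderiv hf hfc hk hkc i
  simp only [pderiv_comp_sub] at this
  rw [this, neg_neg]

theorem tendsto_integral_mul_L2 {F f : E n → ℝ} {fm : ℕ → E n → ℝ} (hF : MemLp F 2)
    (hf : MemLp f 2) (hfm : ∀ m, MemLp (fm m) 2)
    (h : Tendsto (fun m => eLpNorm (fm m - f) 2 volume) atTop (𝓝 0)) :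
    Tendsto (fun m => ∫ x, F x * fm m x) atTop (𝓝 (∫ x, F x * f x)) := by
  have e : ∀ g : E n → ℝ, ∀ hg : MemLp g 2, ∫ x, F x * g x = inner ℝ (hg.toLp g) (hF.toLp F) := by
    intro g hg
    rw [L2.inner_def]
    refine integral_congr_ae ?_
    filter_upwards [hg.coeFn_toLp, hF.coeFn_toLp] with x h1 h2
    rw [h1, h2]
    simp
  rw [e f hf]
  simp_rw [fun m => e _ (hfm m)]
  refine Tendsto.inner ?_ tendsto_const_nhds
  rwa [Lp.tendsto_Lp_iff_tendsto_eLpNorm'']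

/-! ### Weak derivatives and Lipschitz test functions -/

/-- The vector field `F` has weak divergence `G` when tested with functions supported in `O`. -/
def HasWeakDiv (O : Set (E n)) (F : Fin n → E n → ℝ) (G : E n → ℝ) : Prop :=
  ∀ φ : E n → ℝ, ContDiff ℝ ∞ φ → HasCompactSupport φ → tsupport φ ⊆ O →
    ∫ x, ((∑ i, F i x * pderiv i φ x) + G x * φ x) = 0

theorem integral_sum_add {F H : Fin n → E n → ℝ} {G φ : E n → ℝ} (hF : ∀ i, MemLp (F i) 2)
    (hG : MemLp G 2) (hH : ∀ i, MemLp (H i) 2) (hφ : MemLp φ 2) :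
    ∫ x, ((∑ i, F i x * H i x) + G x * φ x) =
      (∑ i, ∫ x, F i x * H i x) + ∫ x, G x * φ x := by
  rw [integral_add (integrable_finsetSum _ fun i _ => integrable_mul_L2 (hF i) (hH i))
    (integrable_mul_L2 hG hφ), integral_finsetSum _ fun i _ => integrable_mul_L2 (hF i) (hH i)]

/-- Locally Lipschitz functions with compact support may be used as test functions. -/
theorem HasWeakDiv.integral_eq_zero {O : Set (E n)} (hO : IsOpen O) {F : Fin n → E n → ℝ}
    {G : E n → ℝ} (h : HasWeakDiv O F G) (hF : ∀ i, MemLp (F i) 2) (hG : MemLp G 2)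
    {ψ : E n → ℝ} (hψ : LocallyLipschitz ψ) (hc : HasCompactSupport ψ) (hs : tsupport ψ ⊆ O) :
    ∫ x, ((∑ i, F i x * pderiv i ψ x) + G x * ψ x) = 0 := by
  obtain ⟨κ, hκ, -⟩ := exists_approxId (0 : E n) one_pos
  have hψ2 := LocallyLipschitz.memLp hψ hc 2
  have hdψ := fun i => LocallyLipschitz.memLp_pderiv hψ hc i 2
  -- Kernels supported within `δ` of the origin keep the mollified test function supported in `O`.
  obtain ⟨δ, hδ, hδO⟩ := hc.isCompact.exists_cthickening_subset_open hO hs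
  have ht : Tendsto (fun m => (∑ i, ∫ x, F i x * mollify (κ m) (pderiv i ψ) x) +
      ∫ x, G x * mollify (κ m) ψ x) atTop
      (𝓝 ((∑ i, ∫ x, F i x * pderiv i ψ x) + ∫ x, G x * ψ x)) :=
    (tendsto_finsetSum _ fun i _ => tendsto_integral_mul_L2 (hF i) (hdψ i)
      (fun m => MemLp.mollify (hκ.isKernel m) (hdψ i)) (hκ.tendsto_mollify (hdψ i))).add
      (tendsto_integral_mul_L2 hG hψ2 (fun m => MemLp.mollify (hκ.isKernel m) hψ2)
        (hκ.tendsto_mollify hψ2))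
  rw [integral_sum_add hF hG hdψ hψ2]
  refine tendsto_nhds_unique ht (tendsto_const_nhds.congr' ?_)
  filter_upwards [hκ.eventually_norm_le δ hδ] with m hm
  have hk := hκ.isKernel m
  have hcm : HasCompactSupport (mollify (κ m) ψ) := hk.hasCompactSupport_mollify hc
  have hsub : tsupport (mollify (κ m) ψ) ⊆ O := by
    refine subset_trans (closure_minimal ?_ isClosed_cthickening) hδO
    intro x hx
    by_contra hx'
    refine hx (mollify_eq_zero fun z hz => ?_)
    by_contra hne
    refine hx' (mem_cthickening_of_dist_le x (x + z) δ _ (subset_tsupport _ hne) ?_)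
    rw [dist_eq_norm]
    simpa using hm z hz
  have := h _ (hk.contDiff_mollify hψ.continuous.locallyIntegrable) hcm hsub
  simp only [hk.pderiv_mollify_of_lipschitz hψ hc] at this
  rw [integral_sum_add hF hG (fun i => MemLp.mollify hk (hdψ i)) (MemLp.mollify hk hψ2)] at this
  exact this.symm

/-- `w` is the weak gradient of `u` when tested with functions supported in `O`. -/
def HasWeakGrad (O : Set (E n)) (u : E n → ℝ) (w : Fin n → E n → ℝ) : Prop :=
  ∀ i, ∀ φ : E n → ℝ, ContDiff ℝ ∞ φ → HasCompactSupport φ → tsupport φ ⊆ O →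
    ∫ x, (u x * pderiv i φ x + w i x * φ x) = 0

theorem HasWeakGrad.integral_eq_zero {O : Set (E n)} (hO : IsOpen O) {u : E n → ℝ}
    {w : Fin n → E n → ℝ} (h : HasWeakGrad O u w) (hu : MemLp u 2) (hw : ∀ i, MemLp (w i) 2)
    {ψ : E n → ℝ} (hψ : LocallyLipschitz ψ) (hc : HasCompactSupport ψ) (hs : tsupport ψ ⊆ O)
    (i : Fin n) : ∫ x, (u x * pderiv i ψ x + w i x * ψ x) = 0 := by
  -- The `i`-th partial derivative of `u` is the divergence of the field `u eᵢ`.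
  have key : HasWeakDiv O (fun j x => if j = i then u x else 0) (w i) := fun φ h1 h2 h3 => by
    simpa using h i φ h1 h2 h3
  have := key.integral_eq_zero hO (fun j => ?_) (hw i) hψ hc hs
  · simpa using this
  · by_cases hj : j = i <;> simp [hj, hu]

/-! ### Boundary cutoffs and the normal component of a tangential field -/

/-- A smooth cutoff which vanishes for `s ≤ 1 / (m + 1)` and tends to `1` for `s > 0`. -/
def cut (m : ℕ) (s : ℝ) : ℝ :=
  Real.smoothTransition ((m + 1) * s - 1)

theorem contDiff_cut (m : ℕ) : ContDiff ℝ 1 (cut m) :=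
  Real.smoothTransition.contDiff.comp ((contDiff_const.mul contDiff_id).sub contDiff_const)

theorem cut_eq_zero {m : ℕ} {s : ℝ} (h : s ≤ 1 / (m + 1)) : cut m s = 0 := by
  refine Real.smoothTransition.zero_of_nonpos ?_
  have := (le_div_iff₀' (by positivity : (0:ℝ) < m + 1)).1 h
  linarith

theorem cut_eq_one {m : ℕ} {s : ℝ} (h : 2 / (m + 1) ≤ s) : cut m s = 1 := by
  refine Real.smoothTransition.one_of_one_le ?_
  have := (div_le_iff₀' (by positivity : (0:ℝ) < m + 1)).1 h
  linarith

theorem deriv_cut_eq_zero {m : ℕ} {s : ℝ} (h : 2 / (m + 1) < s) : deriv (cut m) s = 0 := by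
  have : cut m =ᶠ[𝓝 s] fun _ => 1 := by
    filter_upwards [lt_mem_nhds h] with t ht using cut_eq_one ht.le
  rw [this.deriv_eq, deriv_const]

theorem tendsto_cut {s : ℝ} (h : 0 < s) : Tendsto (fun m => cut m s) atTop (𝓝 1) := by
  refine tendsto_const_nhds.congr' ?_
  have ht : Tendsto (fun m : ℕ => 2 * (1 / (m + 1 : ℝ))) atTop (𝓝 0) := by
    simpa using tendsto_one_div_add_atTop_nhds_zero_nat.const_mul (2 : ℝ)
  filter_upwards [ht.eventually (ge_mem_nhds h)] with m hm
  rw [cut_eq_one]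
  simpa [div_eq_mul_inv] using hm

/-- Dominated convergence removes the cutoffs again: wherever the integrand is nonzero, every `g k`
is positive and its cutoff is eventually `1`. -/
theorem tendsto_integral_cut {ι : Type*} (S : Finset ι) {g : ι → E n → ℝ}
    (hg : ∀ k ∈ S, Continuous (g k)) {Ψ : E n → ℝ} (hΨ : Integrable Ψ)
    (h0 : ∀ x, Ψ x ≠ 0 → ∀ k ∈ S, 0 < g k x) :
    Tendsto (fun m => ∫ x, (∏ k ∈ S, cut m (g k x)) * Ψ x) atTop (𝓝 (∫ x, Ψ x)) := by
  refine tendsto_integral_of_dominated_convergence (fun x => ‖Ψ x‖) (fun m => ?_) hΨ.norm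
    (fun m => .of_forall fun x => ?_) (.of_forall fun x => ?_)
  · exact (continuous_finsetProd _ fun k hk =>
      (contDiff_cut m).continuous.comp (hg k hk)).aestronglyMeasurable.mul hΨ.1
  · rw [norm_mul]
    refine mul_le_of_le_one_left (norm_nonneg _) ?_
    rw [norm_prod]
    refine Finset.prod_le_one (fun _ _ => norm_nonneg _) fun k _ => ?_
    rw [cut, Real.norm_of_nonneg (Real.smoothTransition.nonneg _)]
    exact Real.smoothTransition.le_one _
  · by_cases hx : Ψ x = 0
    · simp [hx]
    · have : Tendsto (fun m => ∏ k ∈ S, cut m (g k x)) atTop (𝓝 (∏ k ∈ S, (1 : ℝ))) :=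
        tendsto_finsetProd _ fun k hk => tendsto_cut (h0 x hx k hk)
      simpa using this.mul_const (Ψ x)

theorem integrable_test {u v ψ : E n → ℝ} (hu : MemLp u 2) (hv : MemLp v 2)
    (hψ : LocallyLipschitz ψ) (hc : HasCompactSupport ψ) (i : Fin n) :
    Integrable fun x => u x * pderiv i ψ x + v x * ψ x :=
  (integrable_mul_L2 hu (LocallyLipschitz.memLp_pderiv hψ hc i 2)).add
    (integrable_mul_L2 hv (LocallyLipschitz.memLp hψ hc 2))

/-- The component `τ · ∇γ`. -/
def normalComp (γ : E n → ℝ) (τ : Fin n → E n → ℝ) (x : E n) : ℝ :=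
  ∑ j, τ j x * pderiv j γ x

/-- The weak gradient of `τ · ∇γ`, if `M i j = ∂ᵢτⱼ`. -/
def normalGrad (γ : E n → ℝ) (τ : Fin n → E n → ℝ) (M : Fin n → Fin n → E n → ℝ) (i : Fin n)
    (x : E n) : ℝ :=
  ∑ j, (M i j x * pderiv j γ x + τ j x * pderiv i (pderiv j γ) x)

/-- If `τ` has zero normal trace and `Ω` coincides with `{γ > 0}` in `O`, then the extension of
`τ · ∇γ` by zero is weakly differentiable in `O`. -/
theorem hasWeakGrad_normalComp {Ω O : Set (E n)} (hΩ : IsOpen Ω) {γ : E n → ℝ}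
    (hγ : ContDiff ℝ 1 γ) (hγ' : ∀ j, LocallyLipschitz (pderiv j γ))
    {τ : Fin n → E n → ℝ} {M : Fin n → Fin n → E n → ℝ}
    (hτ : ∀ j, MemLp (τ j) 2) (hM : ∀ i j, MemLp (M i j) 2)
    (hτ0 : ∀ j, ∀ x ∉ Ω, τ j x = 0) (hM0 : ∀ i j, ∀ x ∉ Ω, M i j x = 0)
    (hgrad : ∀ j, HasWeakGrad Ω (τ j) fun i => M i j)
    (htrace : HasWeakDiv Set.univ τ fun x => ∑ i, M i i x)
    (hO : ∀ x ∈ O, x ∈ Ω ↔ 0 < γ x) :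
    HasWeakGrad O (normalComp γ τ) (normalGrad γ τ M) := by
  intro i φ hφ hφc hφO
  have hγl : LocallyLipschitz γ := hγ.locallyLipschitz (𝕂 := ℝ)
  have hφ1 : ContDiff ℝ 1 φ := hφ.of_le (by norm_cast)
  have hφl : LocallyLipschitz φ := hφ1.locallyLipschitz (𝕂 := ℝ)
  let A : Fin n → E n → ℝ := fun j x =>
    τ j x * pderiv i (fun x => pderiv j γ x * φ x) x + M i j x * (pderiv j γ x * φ x)
  -- The sum of the `A j` is the integrand of the claim. The sum of the `B j` has integral zero by
  -- the normal trace condition, even for test functions that reach the boundary. Subtracting it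
  -- leaves only derivatives tangential to the level sets of `γ`, which tolerate a cutoff in `γ`.
  let B : Fin n → E n → ℝ := fun j x =>
    τ j x * pderiv j (fun x => pderiv i γ x * φ x) x + M j j x * (pderiv i γ x * φ x)
  have hl : ∀ j, LocallyLipschitz fun x => pderiv j γ x * φ x := fun j =>
    LocallyLipschitz.mul (hγ' j) hφl
  have hlc : ∀ j, HasCompactSupport fun x => pderiv j γ x * φ x := fun j => hφc.mul_left
  have hA : ∀ j, Integrable (A j) := fun j => integrable_test (hτ j) (hM i j) (hl j) (hlc j) i
  have hB : ∀ j, Integrable (B j) := fun j => integrable_test (hτ j) (hM j j) (hl i) (hlc i) j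
  have hBz : ∫ x, ∑ j, B j x = 0 := by
    have := htrace.integral_eq_zero isOpen_univ hτ (memLp_finsetSum _ fun i _ => hM i i)
      (hl i) (hlc i) (Set.subset_univ _)
    rw [← this]
    congr 1; funext x
    simp only [B, Finset.sum_add_distrib, Finset.sum_mul]
  have hΨ : Integrable fun x => ∑ j, (A j x - B j x) :=
    integrable_finsetSum _ fun j _ => (hA j).sub (hB j)
  have hAz : ∀ᵐ x, normalComp γ τ x * pderiv i φ x + normalGrad γ τ M i x * φ x =
      ∑ j, A j x := by
    filter_upwards [ae_all_iff.2 fun j => LocallyLipschitz.ae_differentiableAt (hγ' j)] with x hx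
    simp only [A, normalComp, normalGrad, Finset.sum_mul, ← Finset.sum_add_distrib]
    refine Finset.sum_congr rfl fun j _ => ?_
    rw [pderiv_mul i (hx j) (hφ1.differentiable one_ne_zero x)]
    ring
  have h0 : ∀ x, ∑ j, (A j x - B j x) ≠ 0 → ∀ k ∈ ({0} : Finset ℕ), 0 < γ x := by
    intro x hx _ _
    by_contra hcon
    refine hx (Finset.sum_eq_zero fun j _ => ?_)
    by_cases hxφ : x ∈ tsupport φ
    · have hxΩ : x ∉ Ω := fun h => hcon ((hO x (hφO hxφ)).1 h)
      simp [A, B, hτ0 _ x hxΩ, hM0 _ _ x hxΩ]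
    · have h1 : ∀ k j, pderiv k (fun x => pderiv j γ x * φ x) x = 0 := fun k j =>
        pderiv_eq_zero_of_notMem k fun h => hxφ (tsupport_mul_subset_right h)
      simp [A, B, h1, image_eq_zero_of_notMem_tsupport hxφ]
  have hlim := tendsto_integral_cut {0} (g := fun _ => γ) (fun _ _ => hγ.continuous) hΨ h0
  -- With the cutoff inserted, the test functions are supported inside `Ω`, where the weak gradient
  -- is available.
  have hzero : ∀ m : ℕ, ∫ x, (∏ k ∈ ({0} : Finset ℕ), cut m (γ x)) * ∑ j, (A j x - B j x) = 0 := by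
    intro m
    have hcd : ContDiff ℝ 1 fun x => cut m (γ x) := (contDiff_cut m).comp hγ
    have hθ : ContDiff ℝ 1 fun x => φ x * cut m (γ x) := hφ1.mul hcd
    have hθc : HasCompactSupport fun x => φ x * cut m (γ x) := hφc.mul_right
    have hθs : tsupport (fun x => φ x * cut m (γ x)) ⊆ Ω := by
      intro x hx
      have h1 : x ∈ tsupport φ := tsupport_mul_subset_left hx
      have h2 : x ∈ {x | 1 / (m + 1 : ℝ) ≤ γ x} := by
        refine closure_minimal ?_ (isClosed_le continuous_const hγ.continuous) hx
        intro y hy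
        by_contra h
        simp only [Set.mem_ofPred_eq, not_le] at h
        exact hy (by simp [cut_eq_zero h.le])
      refine (hO x (hφO h1)).2 (lt_of_lt_of_le (by positivity) h2)
    have hθl : ∀ j, LocallyLipschitz fun x => pderiv j γ x * (φ x * cut m (γ x)) := fun j =>
      LocallyLipschitz.mul (hγ' j) (hθ.locallyLipschitz (𝕂 := ℝ))
    have hθlc : ∀ j, HasCompactSupport fun x => pderiv j γ x * (φ x * cut m (γ x)) :=
      fun j => hθc.mul_left
    have hθls : ∀ j, tsupport (fun x => pderiv j γ x * (φ x * cut m (γ x))) ⊆ Ω :=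
      fun j => tsupport_mul_subset_right.trans hθs
    have e1 := fun j => (hgrad j).integral_eq_zero hΩ (hτ j) (fun i => hM i j) (hθl j) (hθlc j)
      (hθls j) i
    have e2 := fun j => (hgrad j).integral_eq_zero hΩ (hτ j) (fun i => hM i j) (hθl i) (hθlc i)
      (hθls i) j
    have i1 := fun j => integrable_test (hτ j) (hM i j) (hθl j) (hθlc j) i
    have i2 := fun j => integrable_test (hτ j) (hM j j) (hθl i) (hθlc i) j
    have : ∫ x, ∑ j, ((τ j x * pderiv i (fun x => pderiv j γ x * (φ x * cut m (γ x))) x +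
        M i j x * (pderiv j γ x * (φ x * cut m (γ x)))) -
        (τ j x * pderiv j (fun x => pderiv i γ x * (φ x * cut m (γ x))) x +
        M j j x * (pderiv i γ x * (φ x * cut m (γ x))))) = 0 := by
      refine (integral_finsetSum _ fun j _ => (i1 j).sub (i2 j)).trans ?_
      refine Finset.sum_eq_zero fun j _ => ?_
      refine (integral_sub (i1 j) (i2 j)).trans ?_
      rw [e1, e2, sub_zero]
    rw [← this]
    refine integral_congr_ae ?_
    filter_upwards [ae_all_iff.2 fun j => LocallyLipschitz.ae_differentiableAt (hγ' j)] with x hx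
    have d1 : DifferentiableAt ℝ φ x := hφ1.differentiable one_ne_zero x
    have d2 : DifferentiableAt ℝ γ x := hγ.differentiable one_ne_zero x
    have d3 : DifferentiableAt ℝ (cut m) (γ x) := (contDiff_cut m).differentiable one_ne_zero _
    have d4 := hcd.differentiable one_ne_zero x
    simp only [Finset.prod_singleton, Finset.mul_sum]
    refine Finset.sum_congr rfl fun j _ => ?_
    simp only [A, B]
    have d5 := d1.fun_mul d4
    -- The terms with the derivative of the cutoff are `τⱼ φ cut'(γ) ∂ⱼγ ∂ᵢγ` in both halves and
    -- cancel.
    rw [pderiv_mul i (hx j) d1, pderiv_mul j (hx i) d1, pderiv_mul i (hx j) d5,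
      pderiv_mul j (hx i) d5, pderiv_mul i d1 d4, pderiv_mul j d1 d4, pderiv_comp i d3 d2,
      pderiv_comp j d3 d2]
    ring
  have hfin : ∫ x, ∑ j, (A j x - B j x) = 0 :=
    tendsto_nhds_unique hlim (tendsto_const_nhds.congr fun m => (hzero m).symm)
  rw [integral_congr_ae hAz]
  simp only [Finset.sum_sub_distrib] at hfin
  rw [integral_sub (integrable_finsetSum _ fun j _ => hA j)
    (integrable_finsetSum _ fun j _ => hB j), hBz, sub_zero] at hfin
  exact hfin

/-! ### Charts with nearly orthonormal gradients -/

/-- The matrix with rows `∇gₖ(x)`. -/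
def gradMatrix (g : Fin n → E n → ℝ) (x : E n) : Matrix (Fin n) (Fin n) ℝ :=
  Matrix.of fun k i => pderiv i (g k) x

/-- Near `x₀` the set `Ω` is `{g₁ > 0, …, gₙ > 0}`, and `∇gⱼ` is close to the vector `aⱼ` of an
orthonormal basis. -/
structure IsChart (Ω : Set (E n)) (x₀ : E n) (g : Fin n → E n → ℝ) (a : Fin n → E n) (R ε : ℝ) :
    Prop where
  R_pos : 0 < R
  contDiff : ∀ j, ContDiff ℝ 1 (g j)
  lipschitz : ∀ j i, LocallyLipschitz (pderiv i (g j))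
  mem_iff : ∀ x ∈ ball x₀ R, x ∈ Ω ↔ ∀ j, 0 < g j x
  orthonormal : Orthonormal ℝ a
  fderiv_close : ∀ x ∈ ball x₀ R, ∀ j, ‖fderiv ℝ (g j) x - innerSL ℝ (a j)‖ ≤ ε
  det_sq : ∀ x ∈ ball x₀ R, 1 / 2 ≤ (gradMatrix g x).det ^ 2

theorem gradMatrix_apply_eq_inner {g : Fin n → E n → ℝ} {a : Fin n → E n} {x : E n}
    (h : ∀ k, fderiv ℝ (g k) x = innerSL ℝ (a k)) (k i : Fin n) : gradMatrix g x k i = a k i := by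
  simp [gradMatrix, pderiv, h k, EuclideanSpace.inner_single_right]

theorem det_sq_of_orthonormal {g : Fin n → E n → ℝ} {a : Fin n → E n} {x : E n}
    (ha : Orthonormal ℝ a) (h : ∀ k, fderiv ℝ (g k) x = innerSL ℝ (a k)) :
    (gradMatrix g x).det ^ 2 = 1 := by
  have h1 : gradMatrix g x * (gradMatrix g x).transpose = 1 := by
    ext k l
    rw [Matrix.mul_apply]
    simp only [Matrix.transpose_apply, gradMatrix_apply_eq_inner h]
    have := orthonormal_iff_ite.1 ha l k
    rw [PiLp.inner_apply] at this
    simp only [RCLike.inner_apply, conj_trivial] at this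
    rw [this, Matrix.one_apply]
    simp [eq_comm]
  have h2 := congrArg Matrix.det h1
  rw [Matrix.det_mul, Matrix.det_transpose, Matrix.det_one] at h2
  rw [sq, h2]

theorem lipschitz_pderiv {f : E n → ℝ} {K : ℝ≥0} (h : LipschitzWith K (fderiv ℝ f)) (i : Fin n) :
    LocallyLipschitz (pderiv i f) :=
  ((ContinuousLinearMap.apply ℝ ℝ (EuclideanSpace.single i (1 : ℝ))).lipschitz.comp
    h).locallyLipschitz

/-- At `x₀` the gradients equal the `a k` and the squared determinant is `1`; continuity of the
first derivatives gives both bounds on a small ball. -/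
theorem isChart_of_orthonormal {Ω U : Set (E n)} {x₀ : E n} {g : Fin n → E n → ℝ}
    {a : Fin n → E n} (hU : IsOpen U) (hx₀ : x₀ ∈ U)
    (hg : ∀ j, ContDiff ℝ 1 (g j) ∧ ∃ K : ℝ≥0, LipschitzWith K (fderiv ℝ (g j)))
    (hΩ : ∀ x ∈ U, x ∈ Ω ↔ ∀ j, 0 < g j x) (ha : Orthonormal ℝ a)
    (hd : ∀ k, fderiv ℝ (g k) x₀ = innerSL ℝ (a k)) {ε : ℝ} (hε : 0 < ε) :
    ∃ R, IsChart Ω x₀ g a R ε := by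
  have h1 : ∀ j, ∀ᶠ x in 𝓝 x₀, ‖fderiv ℝ (g j) x - innerSL ℝ (a j)‖ < ε := fun j => by
    have hc : Continuous fun x => ‖fderiv ℝ (g j) x - innerSL ℝ (a j)‖ :=
      (((hg j).1.continuous_fderiv one_ne_zero).sub continuous_const).norm
    refine (hc.tendsto x₀).eventually (gt_mem_nhds ?_)
    simpa [hd j] using hε
  have h2 : ∀ᶠ x in 𝓝 x₀, 1 / 2 < (gradMatrix g x).det ^ 2 := by
    have hc : Continuous fun x => (gradMatrix g x).det ^ 2 := by
      refine (Continuous.matrix_det ?_).pow 2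
      refine continuous_matrix fun k i => ?_
      exact ((hg k).1.continuous_fderiv one_ne_zero).clm_apply continuous_const
    refine (hc.tendsto x₀).eventually (lt_mem_nhds ?_)
    rw [det_sq_of_orthonormal ha hd]
    norm_num
  obtain ⟨R, hR, hb⟩ := Metric.eventually_nhds_iff_ball.1
    ((eventually_all.2 h1).and (h2.and (hU.mem_nhds hx₀)))
  exact ⟨R, hR, fun j => (hg j).1, fun j i => (hg j).2.elim fun K hK => lipschitz_pderiv hK i,
    fun x hx => hΩ x (hb x hx).2.2, ha, fun x hx j => ((hb x hx).1 j).le,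
    fun x hx => (hb x hx).2.1.le⟩

/-- The defining functions, at most `n` in number, are padded to exactly `n` by affine functions
that are positive near `x₀`. Interior points are charts with padding only, so no separate interior
estimate is needed. -/
theorem exists_isChart {Ω : Set (E n)} (hΩ : IsOpen Ω) (hB : HasC11Boundary Ω) {x₀ : E n}
    (hx₀ : x₀ ∈ closure Ω) {ε : ℝ} (hε : 0 < ε) : ∃ g a R, IsChart Ω x₀ g a R ε := by
  have h : ∃ (U : Set (E n)) (m : ℕ) (g : Fin m → E n → ℝ), IsOpen U ∧ x₀ ∈ U ∧
      (∀ j, ContDiff ℝ 1 (g j) ∧ ∃ K : ℝ≥0, LipschitzWith K (fderiv ℝ (g j))) ∧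
      Orthonormal ℝ (fun j => gradient (g j) x₀) ∧ Ω ∩ U = {x ∈ U | ∀ j, 0 < g j x} := by
    by_cases hx : x₀ ∈ Ω
    · refine ⟨Ω, 0, fun j => j.elim0, hΩ, hx, fun j => j.elim0, ⟨fun j => j.elim0,
        fun j => j.elim0⟩, ?_⟩
      ext x
      simp
    · exact hB x₀ ⟨hx₀, by rwa [hΩ.interior_eq]⟩
  obtain ⟨U, m, g, hU, hxU, hg, ho, hΩU⟩ := h
  let v : Fin n → E n := fun i => if h : i.1 < m then gradient (g ⟨i, h⟩) x₀ else 0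
  have hv : Orthonormal ℝ (Set.domRestrict {i : Fin n | i.1 < m} v) := by
    have : Set.domRestrict {i : Fin n | i.1 < m} v =
        (fun j => gradient (g j) x₀) ∘ fun i : {i : Fin n | i.1 < m} => (⟨i.1.1, i.2⟩ : Fin m) := by
      funext i
      have hi : i.1.1 < m := i.2
      change v i.1 = _
      simp [v, hi]
    rw [this]
    refine ho.comp _ fun i j hij => ?_
    simp only [Fin.mk.injEq] at hij
    exact Subtype.ext (Fin.ext hij)
  obtain ⟨b, hb⟩ := hv.exists_orthonormalBasis_extension_of_card_eq (by simp)
  have hm : m ≤ n := by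
    have := ho.linearIndependent.fintype_card_le_finrank
    simpa using this
  -- The padding `1 + ⟨bᵢ, x - x₀⟩` is positive on the unit ball about `x₀`, so it adds no condition
  -- there, and its gradient is the missing basis vector `bᵢ`.
  let g' : Fin n → E n → ℝ := fun i => if h : i.1 < m then g ⟨i, h⟩ else
    fun x => 1 + inner ℝ (b i) (x - x₀)
  have hfake : ∀ i : Fin n, ∀ x, HasFDerivAt (fun x => 1 + inner ℝ (b i) (x - x₀))
      (innerSL ℝ (b i)) x := fun i x => by
    have := ((innerSL ℝ (b i)).hasFDerivAt (x := x - x₀)).comp x ((hasFDerivAt_id x).sub_const x₀)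
    simpa using! this.const_add 1
  refine ⟨g', b, isChart_of_orthonormal (hU.inter isOpen_ball)
    ⟨hxU, mem_ball_self one_pos⟩ (fun i => ?_) (fun x hx => ?_) b.orthonormal (fun i => ?_) hε⟩
  · by_cases hi : i.1 < m
    · simpa [g', hi] using hg ⟨i, hi⟩
    · simp only [g', hi, dite_false]
      refine ⟨contDiff_const.add (contDiff_const.inner ℝ (contDiff_id.sub contDiff_const)), 0, ?_⟩
      rw [show fderiv ℝ (fun x => 1 + inner ℝ (b i) (x - x₀)) = fun _ => innerSL ℝ (b i) from
        funext fun x => (hfake i x).fderiv]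
      exact LipschitzWith.const _
  · have h1 : x ∈ Ω ↔ ∀ j, 0 < g j x := by
      have := Set.ext_iff.1 hΩU x
      simpa [hx.1] using this
    rw [h1]
    constructor
    · intro h i
      by_cases hi : i.1 < m
      · simpa [g', hi] using h ⟨i, hi⟩
      · simp only [g', hi, dite_false]
        have h3 := abs_real_inner_le_norm (b i) (x - x₀)
        have h4 := hx.2
        rw [mem_ball, dist_eq_norm] at h4
        rw [b.orthonormal.1 i, one_mul] at h3
        linarith [neg_abs_le (inner ℝ (b i) (x - x₀))]
    · intro h j
      simpa [g', j.2] using h (Fin.castLE hm j)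
  · by_cases hi : i.1 < m
    · have h1 : b i = gradient (g ⟨i, hi⟩) x₀ := by
        rw [hb i hi]
        simp [v, hi]
      rw [h1]
      ext z
      simp [g', hi, gradient]
    · simp only [g', hi, dite_false]
      exact (hfake i x₀).fderiv

/-- Mean value inequality on the convex ball: a displacement `z` changes `g k` by `⟨a k, z⟩` up to
`ε ‖z‖`. -/
theorem IsChart.abs_sub_sub_inner_le {Ω : Set (E n)} {x₀ : E n} {g : Fin n → E n → ℝ}
    {a : Fin n → E n} {R ε : ℝ} (h : IsChart Ω x₀ g a R ε) {x z : E n} (hx : x ∈ ball x₀ R)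
    (hz : x + z ∈ ball x₀ R) (k : Fin n) :
    |g k (x + z) - g k x - inner ℝ (a k) z| ≤ ε * ‖z‖ := by
  have := (convex_ball x₀ R).norm_image_sub_le_of_norm_fderiv_le' (𝕜 := ℝ) (f := g k)
    (φ := innerSL ℝ (a k)) (C := ε)
    (fun y _ => (h.contDiff k).differentiable one_ne_zero y)
    (fun y hy => h.fderiv_close y hy k) hx hz
  simpa using this

/-! ### Approximation up to the boundary by shifted mollification -/

/-- The translated kernel is itself a test function for the weak gradient. The condition is
pointwise in `x`, which allows kernels that look only to one side of a face. -/
theorem HasWeakGrad.pderiv_mollify {O : Set (E n)} {u κ : E n → ℝ} {w : Fin n → E n → ℝ}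
    (h : HasWeakGrad O u w) (hκ : IsKernel κ) (hu : MemLp u 2) (hw : ∀ i, MemLp (w i) 2) {x : E n}
    (hx : ∀ z ∈ tsupport κ, x + z ∈ O) (i : Fin n) :
    pderiv i (mollify κ u) x = mollify κ (w i) x := by
  have hloc := hu.locallyIntegrable (by norm_num)
  have hs : ContDiff ℝ ∞ fun y => κ (y - x) := hκ.contDiff.comp (contDiff_id.sub contDiff_const)
  have hc : HasCompactSupport fun y => κ (y - x) :=
    hκ.hasCompactSupport.comp_homeomorph (Homeomorph.subRight x)
  have ht : tsupport (fun y => κ (y - x)) ⊆ O := by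
    intro y hy
    have := hx (y - x) (tsupport_comp_subset_preimage κ (f := fun y => y - x) (by fun_prop) hy)
    simpa using this
  have h1 := h i _ hs hc ht
  have hs' : ContDiff ℝ 1 fun y => κ (y - x) := hs.of_le (by norm_cast)
  have hl := hs'.locallyLipschitz (𝕂 := ℝ)
  rw [integral_add (integrable_mul_L2 hu (LocallyLipschitz.memLp_pderiv hl hc i 2))
    (integrable_mul_L2 (hw i) (LocallyLipschitz.memLp hl hc 2))] at h1
  rw [hκ.pderiv_mollify hloc, mollify]
  simp only [pderiv_comp_sub] at h1
  linarith

/-- Smooth approximation up to the boundary: `u` is weakly differentiable in a neighbourhood of the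
faces `{gₖ = 0}` with `s k = -1`, outside of which it vanishes. -/
theorem IsChart.exists_approx {Ω : Set (E n)} {x₀ : E n} {g : Fin n → E n → ℝ} {a : Fin n → E n}
    {R ε : ℝ} (h : IsChart Ω x₀ g a R ε) (hε : ε * (n + 1) ≤ 1 / 4) {s : Fin n → ℝ}
    (hs : ∀ k, |s k| ≤ 1) {u : E n → ℝ} {w : Fin n → E n → ℝ} (hu : MemLp u 2)
    (hw : ∀ i, MemLp (w i) 2) (hu0 : ∀ x ∉ Ω ∩ closedBall x₀ (R / 4), u x = 0)
    (hw0 : ∀ i, ∀ x ∉ Ω ∩ closedBall x₀ (R / 4), w i x = 0)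
    (hgrad : HasWeakGrad {y | y ∈ ball x₀ R ∧ ∀ k, s k = 1 → 0 < g k y} u w) :
    ∃ (p : ℕ → E n → ℝ) (q : ℕ → Fin n → E n → ℝ), (∀ m, ContDiff ℝ ∞ (p m)) ∧
      (∀ m, tsupport (p m) ⊆ closedBall x₀ (R / 2)) ∧
      (∀ m, ∀ x ∈ Ω, ∀ i, pderiv i (p m) x = q m i x) ∧
      (∀ m, ∃ c > 0, ∀ k, s k = -1 → ∀ x, g k x < c → p m x = 0) ∧
      (∀ m, MemLp (p m) 2) ∧ (∀ m i, MemLp (q m i) 2) ∧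
      Tendsto (fun m => eLpNorm (p m - u) 2 volume) atTop (𝓝 0) ∧
      ∀ i, Tendsto (fun m => eLpNorm (q m i - w i) 2 volume) atTop (𝓝 0) := by
  have hR := h.R_pos
  -- The shift has component `s k / (m + 1)` along each `a k`, so values are read deeper inside face
  -- `k` if `s k = 1` and further outside if `s k = -1`.
  obtain ⟨κ, hκ, hκs⟩ := exists_approxId (∑ k, s k • a k) (δ := 1 / 4) (by norm_num)
  have ht : Tendsto (fun m : ℕ => (n + 1 : ℝ) * (1 / (m + 1 : ℝ))) atTop (𝓝 0) := by
    simpa using tendsto_one_div_add_atTop_nhds_zero_nat.const_mul (n + 1 : ℝ)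
  obtain ⟨N, hN⟩ := eventually_atTop.1 (ht.eventually (gt_mem_nhds (by positivity : 0 < R / 4)))
  have hnorm : ‖∑ k, s k • a k‖ ≤ n := by
    refine (norm_sum_le _ _).trans ?_
    calc _ ≤ ∑ _k : Fin n, (1 : ℝ) := Finset.sum_le_sum fun k _ => by
          rw [norm_smul, h.orthonormal.1 k, mul_one]
          exact hs k
      _ = n := by simp
  have hz1 : ∀ m, ∀ z ∈ tsupport (κ m), ‖z‖ ≤ (n + 1) * (1 / (m + 1 : ℝ)) := fun m z hz => by
    have h1 := hκs m hz
    rw [mem_closedBall, dist_eq_norm] at h1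
    have h2 : ‖(1 / (m + 1 : ℝ)) • ∑ k, s k • a k‖ ≤ (1 / (m + 1 : ℝ)) * n := by
      rw [norm_smul, Real.norm_of_nonneg (by positivity)]
      gcongr
    have h3 := norm_le_norm_add_norm_sub' z ((1 / (m + 1 : ℝ)) • ∑ k, s k • a k)
    have h4 : 0 < (1 / (m + 1 : ℝ)) := by positivity
    nlinarith
  have hz2 : ∀ m, ∀ z ∈ tsupport (κ m), ∀ k,
      |inner ℝ (a k) z - (1 / (m + 1 : ℝ)) * s k| ≤ 1 / 4 * (1 / (m + 1 : ℝ)) := by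
    intro m z hz k
    have h1 := hκs m hz
    rw [mem_closedBall, dist_eq_norm] at h1
    have h2 := abs_real_inner_le_norm (a k) (z - (1 / (m + 1 : ℝ)) • ∑ k, s k • a k)
    rw [inner_sub_right, inner_smul_right, h.orthonormal.inner_right_fintype,
      h.orthonormal.1 k, one_mul] at h2
    exact h2.trans h1
  -- Half of the tolerance comes from the radius `1/4` of the kernel, the other half from the
  -- deviation `ε ‖z‖` of `g k` from its linear part.
  have hg : ∀ m, ∀ z ∈ tsupport (κ m), ∀ x ∈ ball x₀ R, x + z ∈ ball x₀ R → ∀ k,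
      |g k (x + z) - g k x - (1 / (m + 1 : ℝ)) * s k| ≤ 1 / 2 * (1 / (m + 1 : ℝ)) := by
    intro m z hz x hx hxz k
    have h1 := h.abs_sub_sub_inner_le hx hxz k
    have h2 := hz2 m z hz k
    have h3 := hz1 m z hz
    have h4 : 0 < (1 / (m + 1 : ℝ)) := by positivity
    have hε0 : 0 ≤ ε := (norm_nonneg _).trans (h.fderiv_close x hx k)
    have h5 : ε * ‖z‖ ≤ 1 / 4 * (1 / (m + 1 : ℝ)) := by
      calc ε * ‖z‖ ≤ ε * ((n + 1) * (1 / (m + 1 : ℝ))) := by gcongr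
        _ = ε * (n + 1) * (1 / (m + 1 : ℝ)) := by ring
        _ ≤ _ := by gcongr
    rw [abs_le] at *
    constructor <;> linarith [h1.1, h1.2, h2.1, h2.2]
  -- Shifts shorter than `R / 4` move supports from radius `R / 4` to at most `R / 2`, and points of
  -- the latter ball stay in the chart.
  have hsmall : ∀ m, ∀ z ∈ tsupport (κ (m + N)), ‖z‖ < R / 4 := fun m z hz =>
    (hz1 _ z hz).trans_lt (hN (m + N) (by omega))
  have hfar : ∀ m, ∀ f : E n → ℝ, (∀ x ∉ Ω ∩ closedBall x₀ (R / 4), f x = 0) →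
      ∀ x ∉ closedBall x₀ (R / 2), mollify (κ (m + N)) f x = 0 := by
    intro m f hf x hx
    refine mollify_eq_zero fun z hz => hf _ fun hmem => hx ?_
    have h1 := hsmall m z (subset_tsupport _ hz)
    have h2 := hmem.2
    rw [mem_closedBall] at h2 ⊢
    have h3 := dist_triangle x (x + z) x₀
    have h4 : dist x (x + z) = ‖z‖ := by simp
    linarith
  have hnear : ∀ m, ∀ z ∈ tsupport (κ (m + N)), ∀ x ∈ closedBall x₀ (R / 2), x + z ∈ ball x₀ R := by
    intro m z hz x hx
    have h1 := hsmall m z hz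
    rw [mem_closedBall] at hx
    rw [mem_ball]
    have h3 := dist_triangle (x + z) x x₀
    have h4 : dist (x + z) x = ‖z‖ := by simp
    linarith
  have hin : ∀ x ∈ closedBall x₀ (R / 2), x ∈ ball x₀ R := fun x hx =>
    closedBall_subset_ball (by linarith) hx
  have hsupp : ∀ m, tsupport (mollify (κ (m + N)) u) ⊆ closedBall x₀ (R / 2) := fun m =>
    closure_minimal (fun x hx => by
      by_contra hx'
      exact hx (hfar m u hu0 x hx')) isClosed_closedBall
  refine ⟨fun m => mollify (κ (m + N)) u, fun m i => mollify (κ (m + N)) (w i),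
    fun m => (hκ.isKernel _).contDiff_mollify (hu.locallyIntegrable (by norm_num)), hsupp,
    fun m x hx i => ?_, fun m => ⟨1 / 2 * (1 / ((m + N : ℕ) + 1 : ℝ)), by positivity,
      fun k hk x hx => ?_⟩,
    fun m => MemLp.mollify (hκ.isKernel _) hu, fun m i => MemLp.mollify (hκ.isKernel _) (hw i),
    (hκ.tendsto_mollify hu).comp (tendsto_add_atTop_nat N),
    fun i => (hκ.tendsto_mollify (hw i)).comp (tendsto_add_atTop_nat N)⟩
  -- From a point of `Ω` the kernel sees only points with `g k > 0` for each `k` with `s k = 1`,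
  -- which is the region where `u` has a weak gradient.
  · by_cases hxb : x ∈ closedBall x₀ (R / 2)
    · refine hgrad.pderiv_mollify (hκ.isKernel _) hu hw (fun z hz => ⟨hnear m z hz x hxb,
        fun k hk => ?_⟩) i
      have h1 := hg _ z hz x (hin x hxb) (hnear m z hz x hxb) k
      have h2 := (h.mem_iff x (hin x hxb)).1 hx k
      have h4 : 0 < (1 / ((m + N : ℕ) + 1 : ℝ)) := by positivity
      rw [abs_le, hk] at h1
      linarith [h1.1]
    · simp only [hfar m (w i) (hw0 i) x hxb]
      exact pderiv_eq_zero_of_notMem i fun hx' => hxb (hsupp m hx')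
  -- Below the threshold `c` the kernel sees only points with `g k < 0`, where `u` vanishes.
  · by_cases hxb : x ∈ closedBall x₀ (R / 2)
    · refine mollify_eq_zero fun z hz => hu0 _ fun hmem => ?_
      have hz' := subset_tsupport _ hz
      have h1 := hg _ z hz' x (hin x hxb) (hnear m z hz' x hxb) k
      have h2 := (h.mem_iff _ (hnear m z hz' x hxb)).1 hmem.1 k
      rw [abs_le, hk] at h1
      linarith [h1.2]
    · exact hfar m u hu0 x hxb

/-! ### The null Lagrangian -/

theorem pderiv_prod {ι : Type*} [DecidableEq ι] (S : Finset ι) {f : ι → E n → ℝ} {x : E n}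
    (i : Fin n) (hf : ∀ k ∈ S, DifferentiableAt ℝ (f k) x) :
    pderiv i (fun x => ∏ k ∈ S, f k x) x = ∑ k ∈ S, (∏ l ∈ S.erase k, f l x) * pderiv i (f k) x := by
  have := (HasFDerivAt.finsetProd fun k hk => (hf k hk).hasFDerivAt).fderiv
  simp only [pderiv, this]
  simp

theorem contDiff_pderiv {f : E n → ℝ} (hf : ContDiff ℝ ∞ f) (i : Fin n) :
    ContDiff ℝ ∞ (pderiv i f) :=
  (hf.fderiv_right (m := ∞) (by norm_cast)).clm_apply contDiff_const

theorem pderiv_comm {f : E n → ℝ} (hf : ContDiff ℝ ∞ f) (i j : Fin n) (x : E n) :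
    pderiv i (pderiv j f) x = pderiv j (pderiv i f) x := by
  have hd : DifferentiableAt ℝ (fderiv ℝ f) x :=
    ((hf.fderiv_right (m := 1) (by norm_cast)).differentiable one_ne_zero) x
  have hsymm : IsSymmSndFDerivAt ℝ f x := hf.contDiffAt.isSymmSndFDerivAt (by
    rw [minSmoothness_of_isRCLikeNormedField]
    exact WithTop.coe_le_coe.2 le_top)
  have e : ∀ i j, pderiv i (pderiv j f) x =
      fderiv ℝ (fderiv ℝ f) x (EuclideanSpace.single i 1) (EuclideanSpace.single j 1) := by
    intro i j
    have : HasFDerivAt (pderiv j f) ((ContinuousLinearMap.apply ℝ ℝ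
        (EuclideanSpace.single j (1 : ℝ))).comp (fderiv ℝ (fderiv ℝ f) x)) x :=
      ((ContinuousLinearMap.apply ℝ ℝ
        (EuclideanSpace.single j (1 : ℝ))).hasFDerivAt).comp x hd.hasFDerivAt
    rw [pderiv, this.fderiv]
    simp
  rw [e, e]
  exact hsymm _ _

theorem memLp_mul_of_locallyBounded {f h : E n → ℝ} (hf : MemLp f 2) (hh : AEStronglyMeasurable h)
    {K : Set (E n)} (hf0 : ∀ x ∉ K, f x = 0) {C : ℝ} (hC : ∀ x ∈ K, |h x| ≤ C) :
    MemLp (fun x => f x * h x) 2 :=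
  MemLp.mul_of_bound hf hh (C := C) fun x hx => hC x (by
    by_contra hxK
    exact hx (hf0 x hxK))

/-- The divergence of `C ∇p`, where `C` is antisymmetric, has no second derivatives of `p`. -/
theorem sum_pderiv_antisymm {C : Fin n → Fin n → E n → ℝ} {p : E n → ℝ} (hp : ContDiff ℝ ∞ p)
    (hanti : ∀ i j x, C i j x = -C j i x) {x : E n}
    (hC : ∀ i j, DifferentiableAt ℝ (C i j) x) :
    ∑ i, pderiv i (fun x => ∑ j, C i j x * pderiv j p x) x =
      ∑ j, (∑ i, pderiv i (C i j) x) * pderiv j p x := by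
  have hd : ∀ j, DifferentiableAt ℝ (pderiv j p) x := fun j =>
    (contDiff_pderiv hp j).differentiable (by simp) x
  have h1 : ∀ i, pderiv i (fun x => ∑ j, C i j x * pderiv j p x) x =
      ∑ j, (C i j x * pderiv i (pderiv j p) x + pderiv i (C i j) x * pderiv j p x) := fun i => by
    rw [pderiv_sum _ i fun j _ => (hC i j).fun_mul (hd j)]
    exact Finset.sum_congr rfl fun j _ => pderiv_mul i (hC i j) (hd j)
  -- An antisymmetric matrix contracted with a symmetric Hessian gives zero.
  have h2 : ∑ i, ∑ j, C i j x * pderiv i (pderiv j p) x = 0 := by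
    have h3 : ∑ i, ∑ j, C i j x * pderiv i (pderiv j p) x =
        - ∑ i, ∑ j, C i j x * pderiv i (pderiv j p) x := by
      conv_lhs => rw [Finset.sum_comm]
      simp only [← Finset.sum_neg_distrib]
      refine Finset.sum_congr rfl fun i _ => Finset.sum_congr rfl fun j _ => ?_
      rw [hanti j i, pderiv_comm hp j i]
      ring
    linarith
  simp only [h1, Finset.sum_add_distrib]
  rw [h2, zero_add, Finset.sum_comm]
  simp only [Finset.sum_mul]

/-- Formally the integrand is the divergence of `v C ∇v'`, so only the fluxes `v ∇gₖ · C ∇v'`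
through the faces could contribute. On face `α` the function `v` vanishes, on the faces other than
`α` and `β` the coefficients are tangential by `htan`, and on face `β` the function `v'` is
approximated by functions that vanish near it. -/
theorem IsChart.nullLagrangian {Ω : Set (E n)} {x₀ : E n} {g : Fin n → E n → ℝ} {a : Fin n → E n}
    {R ε : ℝ} (h : IsChart Ω x₀ g a R ε) (hε : ε * (n + 1) ≤ 1 / 4) {α β : Fin n}
    {v v' : E n → ℝ} {w w' : Fin n → E n → ℝ} (hv : MemLp v 2) (hw : ∀ i, MemLp (w i) 2)
    (hv' : MemLp v' 2) (hw' : ∀ i, MemLp (w' i) 2)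
    (hv0 : ∀ x ∉ Ω ∩ closedBall x₀ (R / 4), v x = 0)
    (hw0 : ∀ i, ∀ x ∉ Ω ∩ closedBall x₀ (R / 4), w i x = 0)
    (hv0' : ∀ x ∉ Ω ∩ closedBall x₀ (R / 4), v' x = 0)
    (hw0' : ∀ i, ∀ x ∉ Ω ∩ closedBall x₀ (R / 4), w' i x = 0)
    (hgrad : HasWeakGrad {y | y ∈ ball x₀ R ∧ ∀ k, k ≠ α → 0 < g k y} v w)
    (hgrad' : HasWeakGrad {y | y ∈ ball x₀ R ∧ ∀ k, k ≠ β → 0 < g k y} v' w')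
    {C : Fin n → Fin n → E n → ℝ} (hC : ∀ i j, LocallyLipschitz (C i j))
    (hanti : ∀ i j x, C i j x = -C j i x)
    (htan : ∀ k, k ≠ α → k ≠ β → ∀ j x, ∑ i, C i j x * pderiv i (g k) x = 0) :
    ∫ x, ∑ j, (v x * (∑ i, pderiv i (C i j) x) + ∑ i, w i x * C i j x) * w' j x = 0 := by
  have hR := h.R_pos
  have hgc : ∀ k, Continuous (g k) := fun k => (h.contDiff k).continuous
  let O : Set (E n) := {y | y ∈ ball x₀ R ∧ ∀ k, k ≠ α → 0 < g k y}
  have hO : IsOpen O := by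
    have : O = ball x₀ R ∩ ⋂ k, {y | k ≠ α → 0 < g k y} := by
      ext y
      simp [O]
    rw [this]
    refine isOpen_ball.inter (isOpen_iInter_of_finite fun k => ?_)
    by_cases hk : k = α
    · simp [hk]
    · simpa [hk] using isOpen_lt continuous_const (hgc k)
  have hvK : ∀ x ∉ closedBall x₀ (R / 4), v x = 0 := fun x hx => hv0 x fun hx' => hx hx'.2
  have hwK : ∀ i, ∀ x ∉ closedBall x₀ (R / 4), w i x = 0 := fun i x hx =>
    hw0 i x fun hx' => hx hx'.2
  have hF : ∀ j, MemLp (fun x => v x * (∑ i, pderiv i (C i j) x) + ∑ i, w i x * C i j x) 2 := by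
    intro j
    have hK := isCompact_closedBall x₀ (R / 4)
    choose B hB0 hB using fun i => LocallyLipschitz.exists_bound (hC i j) hK
    refine MemLp.add ?_ (memLp_finsetSum _ fun i _ => ?_)
    · refine memLp_mul_of_locallyBounded hv (Finset.measurable_fun_sum _ fun i _ =>
        measurable_pderiv i _).aestronglyMeasurable hvK (C := ∑ i, B i) fun x hx => ?_
      exact (Finset.abs_sum_le_sum_abs _ _).trans
        (Finset.sum_le_sum fun i _ => (hB i x hx).2 i)
    · exact memLp_mul_of_locallyBounded (hw i) (hC i j).continuous.aestronglyMeasurable (hwK i)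
        fun x hx => (hB i x hx).1
  obtain ⟨p, q, hp, hps, hpq, hpz, hp2, hq2, -, hqt⟩ := h.exists_approx hε
    (s := fun k => if k = β then -1 else 1) (fun k => by split_ifs <;> simp) hv' hw' hv0' hw0' (by
      have : {y | y ∈ ball x₀ R ∧ ∀ k, (if k = β then (-1 : ℝ) else 1) = 1 → 0 < g k y} =
          {y | y ∈ ball x₀ R ∧ ∀ k, k ≠ β → 0 < g k y} := by
        ext y
        simp only [Set.mem_ofPred_eq, and_congr_right_iff]
        refine fun _ => forall_congr' fun k => ?_
        by_cases hk : k = β <;> simp [hk]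
        intro h
        norm_num at h
      rw [this]
      exact hgrad')
  suffices hm : ∀ m, ∫ x, ∑ j, (v x * (∑ i, pderiv i (C i j) x) + ∑ i, w i x * C i j x) *
      pderiv j (p m) x = 0 by
    have hm' : ∀ m, ∑ j, ∫ x, (v x * (∑ i, pderiv i (C i j) x) + ∑ i, w i x * C i j x) *
        q m j x = 0 := fun m => by
      rw [← integral_finsetSum _ fun j _ => integrable_mul_L2 (hF j) (hq2 m j), ← hm m]
      congr 1; funext x
      refine Finset.sum_congr rfl fun j _ => ?_
      -- Off `Ω` the other factor vanishes, so it does not matter that `q` equals the gradient of `p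
      -- m` only inside `Ω`.
      by_cases hx : x ∈ Ω
      · rw [hpq m x hx]
      · have hx' : x ∉ Ω ∩ closedBall x₀ (R / 4) := fun h => hx h.1
        simp [hv0 x hx', hw0 _ x hx']
    have ht := tendsto_finsetSum Finset.univ fun j _ =>
      tendsto_integral_mul_L2 (hF j) (hw' j) (fun m => hq2 m j) (hqt j)
    rw [integral_finsetSum _ fun j _ => integrable_mul_L2 (hF j) (hw' j)]
    exact tendsto_nhds_unique ht (tendsto_const_nhds.congr fun m => (hm' m).symm)
  intro m
  obtain ⟨c, hc, hcz⟩ := hpz m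
  have hcz' : ∀ x, g β x < c → ∀ j, pderiv j (p m) x = 0 := fun x hx j => by
    refine pderiv_eq_zero_of_notMem j ?_
    rw [notMem_tsupport_iff_eventuallyEq]
    filter_upwards [((hgc β).tendsto x).eventually (gt_mem_nhds hx)] with y hy
    exact hcz β (by simp) y hy
  have hpc : HasCompactSupport (p m) :=
    HasCompactSupport.of_support_subset_isCompact (isCompact_closedBall x₀ (R / 2))
      ((subset_tsupport _).trans (hps m))
  let T : Fin n → E n → ℝ := fun i x => ∑ j, C i j x * pderiv j (p m) x
  have hT : ∀ i, LocallyLipschitz (T i) := fun i =>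
    LocallyLipschitz.finsetSum _ fun j _ => LocallyLipschitz.mul (hC i j)
      (((contDiff_pderiv (hp m) j).of_le (by norm_cast)).locallyLipschitz (𝕂 := ℝ))
  have hTs : ∀ i, tsupport (T i) ⊆ tsupport (p m) := fun i =>
    closure_minimal (fun x hx => by
      by_contra hx'
      refine hx (Finset.sum_eq_zero fun j _ => ?_)
      rw [pderiv_eq_zero_of_notMem j hx', mul_zero]) isClosed_closure
  have hTc : ∀ i, HasCompactSupport (T i) := fun i => hpc.mono' ((subset_tsupport _).trans (hTs i))
  -- Face `α` needs no cutoff, since `hgrad` holds across it.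
  let S : Finset (Fin n) := Finset.univ.erase α
  have hΨi : ∀ i, Integrable fun x => v x * pderiv i (T i) x + w i x * T i x := fun i =>
    integrable_test hv (hw i) (hT i) (hTc i) i
  have hΨ := integrable_finsetSum Finset.univ fun i _ => hΨi i
  have hlim := tendsto_integral_cut S (fun k _ => hgc k) hΨ fun x hx k _ => by
    have hx' : x ∈ Ω ∩ closedBall x₀ (R / 4) := by
      by_contra hcon
      exact hx (by simp [hv0 x hcon, hw0 _ x hcon])
    exact (h.mem_iff x (closedBall_subset_ball (by linarith) hx'.2)).1 hx'.1 k
  have hev : ∀ᶠ l : ℕ in atTop, 2 * (1 / (l + 1 : ℝ)) < c := by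
    have ht : Tendsto (fun l : ℕ => 2 * (1 / (l + 1 : ℝ))) atTop (𝓝 0) := by
      simpa using tendsto_one_div_add_atTop_nhds_zero_nat.const_mul (2 : ℝ)
    exact ht.eventually (gt_mem_nhds hc)
  have hzero : ∀ᶠ l in atTop, ∫ x, (∏ k ∈ S, cut l (g k x)) *
      ∑ i, (v x * pderiv i (T i) x + w i x * T i x) = 0 := by
    filter_upwards [hev] with l hl
    have hcut : ∀ k, ContDiff ℝ 1 fun x => cut l (g k x) := fun k =>
      (contDiff_cut l).comp (h.contDiff k)
    have hH : ContDiff ℝ 1 fun x => ∏ k ∈ S, cut l (g k x) := contDiff_prod fun k _ => hcut k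
    have hψ : ∀ i, LocallyLipschitz fun x => T i x * ∏ k ∈ S, cut l (g k x) := fun i =>
      LocallyLipschitz.mul (hT i) (hH.locallyLipschitz (𝕂 := ℝ))
    have hψc : ∀ i, HasCompactSupport fun x => T i x * ∏ k ∈ S, cut l (g k x) := fun i =>
      (hTc i).mul_right
    have hψs : ∀ i, tsupport (fun x => T i x * ∏ k ∈ S, cut l (g k x)) ⊆ O := by
      intro i x hx
      have h1 := hps m (hTs i (tsupport_mul_subset_left hx))
      refine ⟨closedBall_subset_ball (by linarith) h1, fun k hk => ?_⟩
      have h2 : x ∈ {x | 1 / (l + 1 : ℝ) ≤ g k x} := by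
        refine closure_minimal ?_ (isClosed_le continuous_const (hgc k)) hx
        intro y hy
        by_contra hcon
        simp only [Set.mem_ofPred_eq, not_le] at hcon
        refine hy (mul_eq_zero_of_right _ ?_)
        exact Finset.prod_eq_zero (Finset.mem_erase.2 ⟨hk, Finset.mem_univ k⟩)
          (cut_eq_zero hcon.le)
      exact lt_of_lt_of_le (by positivity) h2
    have e := fun i => hgrad.integral_eq_zero hO hv hw (hψ i) (hψc i) (hψs i) i
    have e' := Finset.sum_congr (rfl : Finset.univ = Finset.univ) fun i _ => e i
    rw [← integral_finsetSum _ fun i _ => integrable_test hv (hw i) (hψ i) (hψc i) i,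
      Finset.sum_const_zero] at e'
    rw [← e']
    refine integral_congr_ae ?_
    filter_upwards [ae_all_iff.2 fun i => LocallyLipschitz.ae_differentiableAt (hT i)] with x hx
    have hHd := hH.differentiable one_ne_zero x
    -- All derivatives of the cutoffs disappear: for `k = β` either `g β < c`, where the gradient of
    -- `p m` is zero, or the cutoff is locally constant because `2 / (l + 1) < c`; for every other
    -- `k` in `S`, `htan` applies.
    have hdH : ∑ i, T i x * pderiv i (fun x => ∏ k ∈ S, cut l (g k x)) x = 0 := by
      have h1 : ∀ i, pderiv i (fun x => ∏ k ∈ S, cut l (g k x)) x =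
          ∑ k ∈ S, (∏ r ∈ S.erase k, cut l (g r x)) * (deriv (cut l) (g k x) * pderiv i (g k) x) :=
        fun i => by
          rw [pderiv_prod S i fun k _ => (hcut k).differentiable one_ne_zero x]
          refine Finset.sum_congr rfl fun k _ => ?_
          rw [pderiv_comp i ((contDiff_cut l).differentiable one_ne_zero _)
            ((h.contDiff k).differentiable one_ne_zero x)]
      have h2 : ∀ k ∈ S, deriv (cut l) (g k x) * ∑ i, T i x * pderiv i (g k) x = 0 := by
        intro k hk
        have hkα : k ≠ α := (Finset.mem_erase.1 hk).1
        have h3 : ∑ i, T i x * pderiv i (g k) x =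
            ∑ j, (∑ i, C i j x * pderiv i (g k) x) * pderiv j (p m) x := by
          simp only [T, Finset.sum_mul]
          rw [Finset.sum_comm]
          refine Finset.sum_congr rfl fun j _ => Finset.sum_congr rfl fun i _ => ?_
          ring
        by_cases hkβ : k = β
        · subst hkβ
          by_cases hgx : g k x < c
          · rw [h3]
            simp [hcz' x hgx]
          · rw [deriv_cut_eq_zero, zero_mul]
            have : (2 : ℝ) / (l + 1) = 2 * (1 / (l + 1 : ℝ)) := by ring
            rw [this]
            linarith
        · rw [h3]
          simp [htan k hkα hkβ]
      simp only [h1, Finset.mul_sum]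
      rw [Finset.sum_comm]
      refine Finset.sum_eq_zero fun k hk => ?_
      have h4 := h2 k hk
      rw [Finset.mul_sum] at h4
      calc _ = (∏ r ∈ S.erase k, cut l (g r x)) *
            ∑ i, deriv (cut l) (g k x) * (T i x * pderiv i (g k) x) := by
            rw [Finset.mul_sum]
            refine Finset.sum_congr rfl fun i _ => ?_
            ring
        _ = 0 := by rw [h4, mul_zero]
    have h5 : ∀ i, v x * pderiv i (fun x => T i x * ∏ k ∈ S, cut l (g k x)) x +
        w i x * (T i x * ∏ k ∈ S, cut l (g k x)) =
        (∏ k ∈ S, cut l (g k x)) * (v x * pderiv i (T i) x + w i x * T i x) +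
        v x * (T i x * pderiv i (fun x => ∏ k ∈ S, cut l (g k x)) x) := fun i => by
      rw [pderiv_mul i (hx i) hHd]
      ring
    simp only [h5, Finset.sum_add_distrib, ← Finset.mul_sum, hdH, mul_zero, add_zero]
  have hfin := tendsto_nhds_unique_of_eventuallyEq hlim tendsto_const_nhds hzero
  rw [← hfin]
  refine integral_congr_ae ?_
  filter_upwards [ae_all_iff.2 fun i => ae_all_iff.2 fun j =>
    LocallyLipschitz.ae_differentiableAt (hC i j)] with x hx
  have h6 := sum_pderiv_antisymm (hp m) hanti hx
  have h7 : ∑ i, (v x * pderiv i (T i) x + w i x * T i x) =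
      v x * (∑ i, pderiv i (T i) x) + ∑ i, w i x * T i x := by
    rw [Finset.sum_add_distrib, Finset.mul_sum]
  rw [h7, h6]
  simp only [add_mul, Finset.sum_add_distrib, Finset.mul_sum, T, Finset.sum_mul]
  congr 1
  · refine Finset.sum_congr rfl fun j _ => Finset.sum_congr rfl fun i _ => by ring
  · rw [Finset.sum_comm]
    refine Finset.sum_congr rfl fun j _ => Finset.sum_congr rfl fun i _ => by ring

/-! ### The adjugate frame and the algebra of `(tr M)² - tr M²` -/

theorem LocallyLipschitz.finsetProd {ι : Type*} (s : Finset ι) {f : ι → E n → ℝ}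
    (hf : ∀ i ∈ s, LocallyLipschitz (f i)) : LocallyLipschitz fun x => ∏ i ∈ s, f i x := by
  classical
  induction s using Finset.induction_on with
  | empty => simpa using LocallyLipschitz.const (1 : ℝ)
  | insert a s ha ih =>
    simp only [Finset.prod_insert ha]
    exact LocallyLipschitz.mul (hf a (by simp)) (ih fun i hi => hf i (by simp [hi]))

theorem LocallyLipschitz.det {A : E n → Matrix (Fin n) (Fin n) ℝ}
    (hA : ∀ i j, LocallyLipschitz fun x => A x i j) : LocallyLipschitz fun x => (A x).det := by
  simp only [Matrix.det_apply, Units.smul_def, zsmul_eq_mul]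
  exact LocallyLipschitz.finsetSum _ fun σ _ => LocallyLipschitz.mul (LocallyLipschitz.const _)
    (LocallyLipschitz.finsetProd _ fun i _ => hA _ _)

theorem LocallyLipschitz.adjugate {A : E n → Matrix (Fin n) (Fin n) ℝ}
    (hA : ∀ i j, LocallyLipschitz fun x => A x i j) (i j : Fin n) :
    LocallyLipschitz fun x => (A x).adjugate i j := by
  simp only [Matrix.adjugate_apply]
  refine LocallyLipschitz.det fun k l => ?_
  by_cases hk : k = j
  · subst hk
    simpa using LocallyLipschitz.const _
  · simpa [Matrix.updateRow_ne hk] using hA k l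

/-- The quadratic form `(tr M)² - tr M²` in the frame given by the adjugate of `G`. -/
theorem adjugate_frame_identity (G M : Matrix (Fin n) (Fin n) ℝ) :
    ∑ α, ∑ β, ∑ j, (∑ i, (M * G.transpose) i α * (G.adjugate i α * G.adjugate j β -
      G.adjugate j α * G.adjugate i β)) * (M * G.transpose) j β =
      G.det ^ 2 * (M.trace ^ 2 - (M * M).trace) := by
  set W := M * G.transpose with hW
  set X := G.adjugate.transpose * W with hX
  -- By this relation and cyclicity of the trace, `X` and `X * X` have the traces of `G.det • M` and
  -- its square. The adjugate is used instead of the inverse so that the frame is polynomial in the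
  -- entries of `G`.
  have hA : G.transpose * G.adjugate.transpose = G.det • (1 : Matrix (Fin n) (Fin n) ℝ) := by
    rw [← Matrix.transpose_mul, Matrix.adjugate_mul, Matrix.transpose_smul, Matrix.transpose_one]
  have h1 : X.trace = G.det * M.trace := by
    rw [hX, Matrix.trace_mul_comm, hW, Matrix.mul_assoc, hA]
    simp
  have h2 : (X * X).trace = G.det ^ 2 * (M * M).trace := by
    have : X * X = G.det • (G.adjugate.transpose * (M * M * G.transpose)) := by
      calc X * X = G.adjugate.transpose * (M * (G.transpose * G.adjugate.transpose) *
            (M * G.transpose)) := by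
            rw [hX, hW]
            simp only [Matrix.mul_assoc]
        _ = _ := by
            rw [hA]
            simp [Matrix.mul_assoc]
    rw [this, Matrix.trace_smul, Matrix.trace_mul_comm, Matrix.mul_assoc, hA]
    simp
    ring
  rw [mul_sub, ← h2, ← mul_pow, ← h1, sq]
  have h3 : X.trace * X.trace = ∑ α, ∑ β, ∑ j, ∑ i,
      (W i α * (G.adjugate i α * G.adjugate j β)) * W j β := by
    simp only [Matrix.trace, Matrix.diag_apply, hX, Matrix.mul_apply, Matrix.transpose_apply]
    rw [Finset.sum_mul_sum]
    refine Finset.sum_congr rfl fun α _ => Finset.sum_congr rfl fun β _ => ?_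
    rw [mul_comm, Finset.sum_mul_sum]
    refine Finset.sum_congr rfl fun j _ => Finset.sum_congr rfl fun i _ => ?_
    ring
  have h4 : (X * X).trace = ∑ α, ∑ β, ∑ j, ∑ i,
      (W i α * (G.adjugate j α * G.adjugate i β)) * W j β := by
    simp only [Matrix.trace, Matrix.diag_apply, hX, Matrix.mul_apply, Matrix.transpose_apply]
    refine Finset.sum_congr rfl fun α _ => Finset.sum_congr rfl fun β _ => ?_
    rw [Finset.sum_mul_sum]
    refine Finset.sum_congr rfl fun j _ => Finset.sum_congr rfl fun i _ => ?_
    ring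
  rw [h3, h4]
  simp only [← Finset.sum_sub_distrib]
  refine Finset.sum_congr rfl fun α _ => Finset.sum_congr rfl fun β _ =>
    Finset.sum_congr rfl fun j _ => ?_
  rw [Finset.sum_mul]
  refine Finset.sum_congr rfl fun i _ => ?_
  ring

/-- Diagonal terms cancel, and each pair of off-diagonal ones gives `a² + b² - 2ab`. -/
theorem sum_sq_sub_trace_sq (M : Matrix (Fin n) (Fin n) ℝ) :
    (∑ i, ∑ j, M i j ^ 2) - (M * M).trace = ∑ i, ∑ j ∈ Finset.Ioi i, (M i j - M j i) ^ 2 := by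
  have h := Finset.sum_sum_Ioi_add_eq_sum_sum_off_diag fun j i => M i j ^ 2 - M i j * M j i
  have h1 : ∀ i, ∑ j ∈ ({i}ᶜ : Finset (Fin n)), (M i j ^ 2 - M i j * M j i) =
      ∑ j, (M i j ^ 2 - M i j * M j i) := fun i => by
    refine Finset.sum_subset (Finset.subset_univ _) fun j _ hj => ?_
    simp only [Finset.mem_compl, Finset.mem_singleton, not_not] at hj
    subst hj
    ring
  simp only [h1] at h
  simp only [Matrix.trace, Matrix.diag_apply, Matrix.mul_apply, ← Finset.sum_sub_distrib]
  rw [← h]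
  refine Finset.sum_congr rfl fun i _ => Finset.sum_congr rfl fun j _ => ?_
  ring

/-- The fields of class `H¹` supported in `Ω ∩ K` whose normal trace vanishes; `M i j = ∂ᵢτⱼ`. -/
structure IsTangentialField (Ω K : Set (E n)) (τ : Fin n → E n → ℝ)
    (M : Fin n → Fin n → E n → ℝ) : Prop where
  memLp : ∀ j, MemLp (τ j) 2
  memLp_grad : ∀ i j, MemLp (M i j) 2
  eq_zero : ∀ j, ∀ x ∉ Ω ∩ K, τ j x = 0
  grad_eq_zero : ∀ i j, ∀ x ∉ Ω ∩ K, M i j x = 0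
  weakGrad : ∀ j, HasWeakGrad Ω (τ j) fun i => M i j
  weakDiv : HasWeakDiv Set.univ τ fun x => ∑ i, M i i x

/-- The antisymmetric coefficients `bₐ ∧ b_b` built from the adjugate frame. -/
def frameCoeff (g : Fin n → E n → ℝ) (α β i j : Fin n) (x : E n) : ℝ :=
  (gradMatrix g x).adjugate i α * (gradMatrix g x).adjugate j β -
    (gradMatrix g x).adjugate j α * (gradMatrix g x).adjugate i β

/-- The identity `G * adj G = det G • 1` makes column `γ` of the adjugate orthogonal to every
gradient `∇gₖ` with `k ≠ γ`. -/
theorem sum_frameCoeff_mul {g : Fin n → E n → ℝ} {α β k : Fin n} (hα : k ≠ α) (hβ : k ≠ β)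
    (j : Fin n) (x : E n) : ∑ i, frameCoeff g α β i j x * pderiv i (g k) x = 0 := by
  have h : ∀ γ, k ≠ γ → ∑ i, pderiv i (g k) x * (gradMatrix g x).adjugate i γ = 0 := by
    intro γ hγ
    have := congrFun (congrFun (Matrix.mul_adjugate (gradMatrix g x)) k) γ
    rw [Matrix.mul_apply] at this
    simpa [hγ, gradMatrix] using this
  have : ∀ i, frameCoeff g α β i j x * pderiv i (g k) x =
      (pderiv i (g k) x * (gradMatrix g x).adjugate i α) * (gradMatrix g x).adjugate j β -
      (pderiv i (g k) x * (gradMatrix g x).adjugate i β) * (gradMatrix g x).adjugate j α :=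
    fun i => by
      rw [frameCoeff]
      ring
  simp only [this, Finset.sum_sub_distrib, ← Finset.sum_mul, h α hα, h β hβ]
  simp

theorem IsChart.lipschitz_adjugate {Ω : Set (E n)} {x₀ : E n} {g : Fin n → E n → ℝ}
    {a : Fin n → E n} {R ε : ℝ} (h : IsChart Ω x₀ g a R ε) (i α : Fin n) :
    LocallyLipschitz fun x => (gradMatrix g x).adjugate i α :=
  LocallyLipschitz.adjugate (fun k l => by simpa [gradMatrix] using h.lipschitz k l) i α

theorem IsChart.lipschitz_frameCoeff {Ω : Set (E n)} {x₀ : E n} {g : Fin n → E n → ℝ}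
    {a : Fin n → E n} {R ε : ℝ} (h : IsChart Ω x₀ g a R ε) (α β i j : Fin n) :
    LocallyLipschitz (frameCoeff g α β i j) := by
  have h1 := LocallyLipschitz.mul (h.lipschitz_adjugate i α) (h.lipschitz_adjugate j β)
  have h2 := LocallyLipschitz.mul (h.lipschitz_adjugate j α) (h.lipschitz_adjugate i β)
  have h3 := h1.add (LocallyLipschitz.mul (LocallyLipschitz.const (-1)) h2)
  have e : frameCoeff g α β i j = fun x => (gradMatrix g x).adjugate i α *
      (gradMatrix g x).adjugate j β + -1 * ((gradMatrix g x).adjugate j α *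
      (gradMatrix g x).adjugate i β) := by
    funext x
    rw [frameCoeff]
    ring
  rw [e]
  exact h3

/-- The integrand of the null Lagrangian attached to the normal components of `τ`. -/
def frameForm (g : Fin n → E n → ℝ) (τ : Fin n → E n → ℝ) (M : Fin n → Fin n → E n → ℝ)
    (α β : Fin n) (x : E n) : ℝ :=
  ∑ j, (normalComp (g α) τ x * (∑ i, pderiv i (frameCoeff g α β i j) x) +
    ∑ i, normalGrad (g α) τ M i x * frameCoeff g α β i j x) * normalGrad (g β) τ M j x

theorem IsChart.memLp_normalComp {Ω : Set (E n)} {x₀ : E n} {g : Fin n → E n → ℝ}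
    {a : Fin n → E n} {R ε : ℝ} (h : IsChart Ω x₀ g a R ε) {τ : Fin n → E n → ℝ}
    {M : Fin n → Fin n → E n → ℝ} (hτ : IsTangentialField Ω (closedBall x₀ (R / 4)) τ M)
    (α : Fin n) : MemLp (normalComp (g α) τ) 2 := by
  have hK := isCompact_closedBall x₀ (R / 4)
  choose B hB0 hB using fun j => LocallyLipschitz.exists_bound (h.lipschitz α j) hK
  refine memLp_finsetSum _ fun j _ => memLp_mul_of_locallyBounded (hτ.memLp j)
    (measurable_pderiv j _).aestronglyMeasurable (K := closedBall x₀ (R / 4))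
    (fun x hx => hτ.eq_zero j x fun hx' => hx hx'.2) fun x hx => (hB j x hx).1

theorem IsChart.memLp_normalGrad {Ω : Set (E n)} {x₀ : E n} {g : Fin n → E n → ℝ}
    {a : Fin n → E n} {R ε : ℝ} (h : IsChart Ω x₀ g a R ε) {τ : Fin n → E n → ℝ}
    {M : Fin n → Fin n → E n → ℝ} (hτ : IsTangentialField Ω (closedBall x₀ (R / 4)) τ M)
    (α i : Fin n) : MemLp (normalGrad (g α) τ M i) 2 := by
  have hK := isCompact_closedBall x₀ (R / 4)
  choose B hB0 hB using fun j => LocallyLipschitz.exists_bound (h.lipschitz α j) hK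
  refine memLp_finsetSum _ fun j _ => MemLp.add ?_ ?_
  · exact memLp_mul_of_locallyBounded (hτ.memLp_grad i j)
      (measurable_pderiv j _).aestronglyMeasurable (K := closedBall x₀ (R / 4))
      (fun x hx => hτ.grad_eq_zero i j x fun hx' => hx hx'.2) fun x hx => (hB j x hx).1
  · exact memLp_mul_of_locallyBounded (hτ.memLp j)
      (measurable_pderiv i _).aestronglyMeasurable (K := closedBall x₀ (R / 4))
      (fun x hx => hτ.eq_zero j x fun hx' => hx hx'.2) fun x hx => (hB j x hx).2 i

/-- Where all `g k` with `k ≠ α` are positive, `Ω` is just `{g α > 0}`, so the component along `∇g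
α` extends by zero across its own face. The null Lagrangian lemma then applies to the components `α`
and `β`. -/
theorem IsChart.integral_frameForm {Ω : Set (E n)} {x₀ : E n} {g : Fin n → E n → ℝ}
    {a : Fin n → E n} {R ε : ℝ} (hΩ : IsOpen Ω) (h : IsChart Ω x₀ g a R ε)
    (hε : ε * (n + 1) ≤ 1 / 4) {τ : Fin n → E n → ℝ} {M : Fin n → Fin n → E n → ℝ}
    (hτ : IsTangentialField Ω (closedBall x₀ (R / 4)) τ M) (α β : Fin n) :
    ∫ x, frameForm g τ M α β x = 0 := by
  have h0 : ∀ α, ∀ x ∉ Ω ∩ closedBall x₀ (R / 4), normalComp (g α) τ x = 0 := fun α x hx => by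
    simp [normalComp, hτ.eq_zero _ x hx]
  have h1 : ∀ α i, ∀ x ∉ Ω ∩ closedBall x₀ (R / 4), normalGrad (g α) τ M i x = 0 :=
    fun α i x hx => by simp [normalGrad, hτ.eq_zero _ x hx, hτ.grad_eq_zero _ _ x hx]
  have h2 : ∀ α, HasWeakGrad {y | y ∈ ball x₀ R ∧ ∀ k, k ≠ α → 0 < g k y}
      (normalComp (g α) τ) (normalGrad (g α) τ M) := fun α =>
    hasWeakGrad_normalComp hΩ (h.contDiff α) (h.lipschitz α) hτ.memLp hτ.memLp_grad
      (fun j x hx => hτ.eq_zero j x fun hx' => hx hx'.1)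
      (fun i j x hx => hτ.grad_eq_zero i j x fun hx' => hx hx'.1) hτ.weakGrad hτ.weakDiv
      (fun x hx => by
        rw [h.mem_iff x hx.1]
        refine ⟨fun hj => hj α, fun hα j => ?_⟩
        by_cases hj : j = α
        · rwa [hj]
        · exact hx.2 j hj)
  exact h.nullLagrangian hε (h.memLp_normalComp hτ α) (h.memLp_normalGrad hτ α)
    (h.memLp_normalComp hτ β) (h.memLp_normalGrad hτ β) (h0 α) (h1 α) (h0 β) (h1 β) (h2 α) (h2 β)
    (h.lipschitz_frameCoeff α β) (fun i j x => by simp only [frameCoeff]; ring)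
    (fun k hα hβ j x => sum_frameCoeff_mul hα hβ j x)

/-! ### Gaffney's inequality in a chart -/

theorem exists_bound_family {ι : Type*} [Fintype ι] {f : ι → E n → ℝ}
    (hf : ∀ k, LocallyLipschitz (f k)) {K : Set (E n)} (hK : IsCompact K) :
    ∃ C, 0 ≤ C ∧ ∀ k, ∀ x ∈ K, |f k x| ≤ C ∧ ∀ i, |pderiv i (f k) x| ≤ C := by
  choose B hB0 hB using fun k => LocallyLipschitz.exists_bound (hf k) hK
  have hle : ∀ k, B k ≤ ∑ k, B k := fun k =>
    Finset.single_le_sum (fun k _ => hB0 k) (Finset.mem_univ k)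
  exact ⟨∑ k, B k, Finset.sum_nonneg fun k _ => hB0 k, fun k x hx =>
    ⟨(hB k x hx).1.trans (hle k), fun i => ((hB k x hx).2 i).trans (hle k)⟩⟩

theorem abs_sum_mul_le {ι : Type*} (s : Finset ι) (f h : ι → ℝ) {B : ℝ} (hB : ∀ i ∈ s, |h i| ≤ B) :
    |∑ i ∈ s, f i * h i| ≤ B * ∑ i ∈ s, |f i| := by
  refine (Finset.abs_sum_le_sum_abs _ _).trans ?_
  rw [Finset.mul_sum]
  refine Finset.sum_le_sum fun i hi => ?_
  rw [abs_mul, mul_comm]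
  exact mul_le_mul_of_nonneg_right (hB i hi) (abs_nonneg _)

theorem abs_mul_le_mul_of_abs_le {x y a b : ℝ} (hx : |x| ≤ a) (hy : |y| ≤ b) : |x * y| ≤ a * b := by
  rw [abs_mul]
  exact mul_le_mul hx hy (abs_nonneg _) ((abs_nonneg _).trans hx)

/-- The error made when the derivatives of the coefficients are neglected. -/
theorem abs_form_sub_le {v : ℝ} {D : Fin n → ℝ} {C : Fin n → Fin n → ℝ} {W e W' e' : Fin n → ℝ}
    {B s t : ℝ} (hv : |v| ≤ B * t) (hD : ∀ j, |D j| ≤ n * B) (hC : ∀ i j, |C i j| ≤ B)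
    (hW : ∀ i, |W i| ≤ B * s) (he : ∀ i, |e i| ≤ B * t) (hW' : ∀ i, |W' i| ≤ B * s)
    (he' : ∀ i, |e' i| ≤ B * t) (hB : 0 ≤ B) :
    |∑ j, (v * D j + ∑ i, (W i + e i) * C i j) * (W' j + e' j) -
      ∑ j, (∑ i, W i * C i j) * W' j| ≤ n * (3 * n * B ^ 3 * (t * (s + t))) := by
  have hsum : ∀ {x : Fin n → ℝ} {c : ℝ}, (∀ i, |x i| ≤ c) → |∑ i, x i| ≤ n * c := fun {x c} h =>
    (Finset.abs_sum_le_sum_abs _ _).trans ((Finset.sum_le_sum fun i _ => h i).trans (by simp))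
  have key : ∀ j, |v * D j * (W' j + e' j) + (∑ i, e i * C i j) * (W' j + e' j) +
      (∑ i, W i * C i j) * e' j| ≤ 3 * n * B ^ 3 * (t * (s + t)) := by
    intro j
    have h1 : |W' j + e' j| ≤ B * (s + t) :=
      (abs_add_le _ _).trans (by linarith [hW' j, he' j])
    have h2 := abs_mul_le_mul_of_abs_le (abs_mul_le_mul_of_abs_le hv (hD j)) h1
    have h3 := abs_mul_le_mul_of_abs_le
      (hsum fun i => abs_mul_le_mul_of_abs_le (he i) (hC i j)) h1
    have h4 := abs_mul_le_mul_of_abs_le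
      (hsum fun i => abs_mul_le_mul_of_abs_le (hW i) (hC i j)) (he' j)
    have h5 : (0 : ℝ) ≤ n * B ^ 3 * t ^ 2 := by positivity
    refine (abs_add_three _ _ _).trans ?_
    calc _ ≤ _ := add_le_add (add_le_add h2 h3) h4
      _ = 3 * n * B ^ 3 * (t * (s + t)) - n * B ^ 3 * t ^ 2 := by ring
      _ ≤ _ := by linarith
  rw [← Finset.sum_sub_distrib]
  refine hsum fun j => ?_
  have e1 : (v * D j + ∑ i, (W i + e i) * C i j) * (W' j + e' j) - (∑ i, W i * C i j) * W' j =
      v * D j * (W' j + e' j) + (∑ i, e i * C i j) * (W' j + e' j) +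
      (∑ i, W i * C i j) * e' j := by
    simp only [add_mul, Finset.sum_add_distrib]
    ring
  rw [e1]
  exact key j

/-- Here `m, d, r, T` stand for `|M|², (div τ)², |rot τ|², |τ|²`, `δ` for `det²`, and `P, Q` for the
exact quadratic form and the form of integral zero. From `δ m = δ (d + r) - P` and `δ ≥ 1/2`, half
of `m` is bounded; a quarter of it is spent to absorb the error, which explains the factors `4`. -/
theorem sum_sq_le_of_error {m s t T d r Q P B K₁ δ : ℝ} (hδ : 1 / 2 ≤ δ) (hδB : δ ≤ B)
    (hm : 0 ≤ m) (hd : 0 ≤ d) (hr : 0 ≤ r) (hs : s ^ 2 ≤ n ^ 2 * m) (ht : t ^ 2 ≤ n * T)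
    (hT : 0 ≤ T) (hK : 0 ≤ K₁) (hP : P = δ * (d - (m - r))) (hQ : |Q - P| ≤ K₁ * (t * (s + t))) :
    m ≤ (4 * B + 4 * (K₁ ^ 2 * (n ^ 2 + 1) * n + K₁ * n)) * (d + r + T) - 4 * Q := by
  -- Young's inequality weighted with `n² + 1`, so that `s² ≤ n² m` costs at most `m / 4`; the `+ 1`
  -- keeps the divisor positive for every `n`.
  have h1 : K₁ * (t * s) ≤ m / 4 + K₁ ^ 2 * (n ^ 2 + 1) * n * T := by
    have h2 : 0 < (n : ℝ) ^ 2 + 1 := by positivity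
    have h3 : K₁ * (t * s) ≤ s ^ 2 / (4 * (n ^ 2 + 1)) + K₁ ^ 2 * (n ^ 2 + 1) * t ^ 2 := by
      have := sq_nonneg (s / (2 * (n ^ 2 + 1)) - K₁ * t)
      have e : s ^ 2 / (4 * (n ^ 2 + 1)) + K₁ ^ 2 * (n ^ 2 + 1) * t ^ 2 - K₁ * (t * s) =
          (n ^ 2 + 1) * (s / (2 * (n ^ 2 + 1)) - K₁ * t) ^ 2 := by
        field_simp
        ring
      nlinarith
    have h4 : s ^ 2 / (4 * (n ^ 2 + 1)) ≤ m / 4 := by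
      rw [div_le_div_iff₀ (by positivity) (by norm_num)]
      nlinarith
    have h5 : K₁ ^ 2 * (n ^ 2 + 1) * t ^ 2 ≤ K₁ ^ 2 * (n ^ 2 + 1) * n * T := by
      rw [mul_assoc _ (n : ℝ) T]
      gcongr
    linarith
  have h6 : K₁ * t ^ 2 ≤ K₁ * n * T := by
    rw [mul_assoc]
    gcongr
  have h7 : δ * m = δ * (d + r) - P := by
    rw [hP]
    ring
  have h8 : m / 2 ≤ δ * m := by nlinarith
  have h9 : δ * (d + r) ≤ B * (d + r) := by gcongr
  have h10 := (abs_le.1 hQ).2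
  have h10' := (abs_le.1 hQ).1
  have h11 : 0 ≤ B := by linarith
  have h12 : 0 ≤ (K₁ ^ 2 * (n ^ 2 + 1) * n + K₁ * n) * (d + r) := by positivity
  have h13 : 0 ≤ B * T := by positivity
  nlinarith

/-- The sum of the `frameForm`s equals `det² ((tr M)² - tr M²)` up to terms that are products of
`|τ|` with `|M| + |τ|`, because the second derivatives of `g` are bounded. Their absorption leaves a
pointwise inequality whose last term integrates to zero. -/
theorem IsChart.exists_pointwise_bound {Ω : Set (E n)} {x₀ : E n} {g : Fin n → E n → ℝ}
    {a : Fin n → E n} {R ε : ℝ} (h : IsChart Ω x₀ g a R ε) :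
    ∃ K, 0 ≤ K ∧ ∀ (τ : Fin n → E n → ℝ) (M : Fin n → Fin n → E n → ℝ),
      ∀ x ∈ closedBall x₀ (R / 4), ∑ i, ∑ j, M i j x ^ 2 ≤
        K * ((∑ i, M i i x) ^ 2 + (∑ i, ∑ j ∈ Finset.Ioi i, (M i j x - M j i x) ^ 2) +
          ∑ j, τ j x ^ 2) - 4 * ∑ α, ∑ β, frameForm g τ M α β x := by
  have hR := h.R_pos
  have hK := isCompact_closedBall x₀ (R / 4)
  obtain ⟨B₁, hB₁0, hB₁⟩ := exists_bound_family (f := fun k : Fin n × Fin n => pderiv k.2 (g k.1))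
    (fun k => h.lipschitz _ _) hK
  obtain ⟨B₂, hB₂0, hB₂⟩ := exists_bound_family
    (f := fun k : (Fin n × Fin n) × Fin n × Fin n => frameCoeff g k.1.1 k.1.2 k.2.1 k.2.2)
    (fun k => h.lipschitz_frameCoeff _ _ _ _) hK
  have hdet : LocallyLipschitz fun x => (gradMatrix g x).det :=
    LocallyLipschitz.det fun k l => by simpa [gradMatrix] using h.lipschitz k l
  obtain ⟨B₃, hB₃0, hB₃⟩ := LocallyLipschitz.exists_bound
    (f := fun x => (gradMatrix g x).det * (gradMatrix g x).det)
    (LocallyLipschitz.mul hdet hdet) hK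
  let B := B₁ + B₂ + B₃
  have hB0 : 0 ≤ B := by positivity
  -- Three factors `n` count the sums over `α`, `β` and `j`.
  let K₁ : ℝ := n * (n * (n * (3 * n * B ^ 3)))
  have hK₁ : 0 ≤ K₁ := by positivity
  refine ⟨4 * B + 4 * (K₁ ^ 2 * (n ^ 2 + 1) * n + K₁ * n), by positivity, fun τ M x hx => ?_⟩
  let G := gradMatrix g x
  let N : Matrix (Fin n) (Fin n) ℝ := Matrix.of fun i j => M i j x
  let t := ∑ j, |τ j x|
  let s := ∑ i, ∑ j, |M i j x|
  have ht0 : 0 ≤ t := Finset.sum_nonneg fun _ _ => abs_nonneg _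
  have hs0 : 0 ≤ s := Finset.sum_nonneg fun _ _ => Finset.sum_nonneg fun _ _ => abs_nonneg _
  have b1 : ∀ α j, |pderiv j (g α) x| ≤ B := fun α j =>
    ((hB₁ (α, j) x hx).1).trans (by simp only [B]; linarith)
  have b2 : ∀ α j i, |pderiv i (pderiv j (g α)) x| ≤ B := fun α j i =>
    ((hB₁ (α, j) x hx).2 i).trans (by simp only [B]; linarith)
  have b3 : ∀ α β i j, |frameCoeff g α β i j x| ≤ B := fun α β i j =>
    ((hB₂ ((α, β), i, j) x hx).1).trans (by simp only [B]; linarith)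
  have b4 : ∀ α β i j k, |pderiv k (frameCoeff g α β i j) x| ≤ B := fun α β i j k =>
    ((hB₂ ((α, β), i, j) x hx).2 k).trans (by simp only [B]; linarith)
  have b5 : G.det ^ 2 ≤ B := by
    rw [sq]
    exact (le_abs_self _).trans ((hB₃ x hx).1.trans (by simp only [B]; linarith))
  have hv : ∀ α, |normalComp (g α) τ x| ≤ B * t := fun α =>
    abs_sum_mul_le _ _ _ fun j _ => b1 α j
  have hW : ∀ α i, |(N * G.transpose) i α| ≤ B * s := fun α i => by
    rw [Matrix.mul_apply]
    refine (abs_sum_mul_le _ _ _ (B := B) fun j _ => b1 α j).trans ?_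
    gcongr
    exact Finset.single_le_sum (f := fun i => ∑ j, |M i j x|)
      (fun _ _ => Finset.sum_nonneg fun _ _ => abs_nonneg _) (Finset.mem_univ i)
  have he : ∀ α i, |∑ j, τ j x * pderiv i (pderiv j (g α)) x| ≤ B * t := fun α i =>
    abs_sum_mul_le _ _ _ fun j _ => b2 α j i
  have hD : ∀ α β j, |∑ i, pderiv i (frameCoeff g α β i j) x| ≤ n * B := fun α β j =>
    (Finset.abs_sum_le_sum_abs _ _).trans
      ((Finset.sum_le_sum fun i _ => b4 α β i j i).trans (by simp))
  have hng : ∀ α i, normalGrad (g α) τ M i x =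
      (N * G.transpose) i α + ∑ j, τ j x * pderiv i (pderiv j (g α)) x := fun α i => by
    rw [normalGrad, Finset.sum_add_distrib, Matrix.mul_apply]
    rfl
  have hQ : |(∑ α, ∑ β, frameForm g τ M α β x) - G.det ^ 2 * (N.trace ^ 2 - (N * N).trace)| ≤
      K₁ * (t * (s + t)) := by
    rw [← adjugate_frame_identity]
    simp only [← Finset.sum_sub_distrib]
    have h1 : ∀ α β, |frameForm g τ M α β x - ∑ j, (∑ i, (N * G.transpose) i α *
        (G.adjugate i α * G.adjugate j β - G.adjugate j α * G.adjugate i β)) *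
        (N * G.transpose) j β| ≤ n * (3 * n * B ^ 3 * (t * (s + t))) := by
      intro α β
      have := abs_form_sub_le (hv α) (hD α β) (b3 α β) (hW α) (he α) (hW β) (he β) hB0
      simp only [frameForm, hng]
      exact this
    have h2 : ∀ (c : ℝ) (f : Fin n → ℝ), (∀ i, |f i| ≤ c) → |∑ i, f i| ≤ n * c := fun c f h =>
      (Finset.abs_sum_le_sum_abs _ _).trans ((Finset.sum_le_sum fun i _ => h i).trans (by simp))
    refine (h2 _ _ fun α => h2 _ _ fun β => h1 α β).trans (le_of_eq ?_)
    simp only [K₁]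
    ring
  have hrot := sum_sq_sub_trace_sq N
  refine sum_sq_le_of_error (δ := G.det ^ 2) (s := s) (t := t)
    (h.det_sq x (closedBall_subset_ball (by linarith) hx)) b5
    (Finset.sum_nonneg fun _ _ => Finset.sum_nonneg fun _ _ => sq_nonneg _) (sq_nonneg _)
    (Finset.sum_nonneg fun _ _ => Finset.sum_nonneg fun _ _ => sq_nonneg _) ?_ ?_
    (Finset.sum_nonneg fun _ _ => sq_nonneg _) hK₁ ?_ hQ
  · have h1 : s ^ 2 ≤ n * ∑ i, (∑ j, |M i j x|) ^ 2 := by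
      have := sq_sum_le_card_mul_sum_sq (s := Finset.univ) (f := fun i => ∑ j, |M i j x|)
      simpa using this
    have h2 : ∀ i, (∑ j, |M i j x|) ^ 2 ≤ n * ∑ j, M i j x ^ 2 := fun i => by
      have := sq_sum_le_card_mul_sum_sq (s := Finset.univ) (f := fun j => |M i j x|)
      simpa using this
    calc s ^ 2 ≤ n * ∑ i, (∑ j, |M i j x|) ^ 2 := h1
      _ ≤ n * ∑ i, (n * ∑ j, M i j x ^ 2) := by
        gcongr with i
        exact h2 i
      _ = _ := by
        rw [← Finset.mul_sum]
        ring
  · have := sq_sum_le_card_mul_sum_sq (s := Finset.univ) (f := fun j => |τ j x|)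
    simpa using this
  · simp only [Matrix.of_apply, N] at hrot
    rw [← hrot]
    simp [Matrix.trace, N]

theorem integrable_sq_L2 {f : E n → ℝ} (hf : MemLp f 2) : Integrable fun x => f x ^ 2 :=
  hf.integrable_sq

/-- Gaffney's inequality for fields supported in a chart. -/
theorem IsChart.gaffney {Ω : Set (E n)} {x₀ : E n} {g : Fin n → E n → ℝ} {a : Fin n → E n}
    {R ε : ℝ} (h : IsChart Ω x₀ g a R ε) (hΩ : IsOpen Ω) (hε : ε * (n + 1) ≤ 1 / 4) :
    ∃ K, 0 ≤ K ∧ ∀ (τ : Fin n → E n → ℝ) (M : Fin n → Fin n → E n → ℝ),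
      IsTangentialField Ω (closedBall x₀ (R / 4)) τ M →
      ∫ x, ∑ i, ∑ j, M i j x ^ 2 ≤
        K * ∫ x, ((∑ i, M i i x) ^ 2 + (∑ i, ∑ j ∈ Finset.Ioi i, (M i j x - M j i x) ^ 2) +
          ∑ j, τ j x ^ 2) := by
  obtain ⟨K, hK0, hK⟩ := h.exists_pointwise_bound
  refine ⟨K, hK0, fun τ M hτ => ?_⟩
  have hpt : ∀ x, ∑ i, ∑ j, M i j x ^ 2 ≤
        K * ((∑ i, M i i x) ^ 2 + (∑ i, ∑ j ∈ Finset.Ioi i, (M i j x - M j i x) ^ 2) +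
          ∑ j, τ j x ^ 2) - 4 * ∑ α, ∑ β, frameForm g τ M α β x := by
    intro x
    by_cases hx : x ∈ closedBall x₀ (R / 4)
    · exact hK τ M x hx
    · have hx' : x ∉ Ω ∩ closedBall x₀ (R / 4) := fun h => hx h.2
      simp [frameForm, normalGrad, normalComp, hτ.eq_zero _ x hx', hτ.grad_eq_zero _ _ x hx']
  have i1 : Integrable fun x => ∑ i, ∑ j, M i j x ^ 2 :=
    integrable_finsetSum _ fun i _ => integrable_finsetSum _ fun j _ =>
      integrable_sq_L2 (hτ.memLp_grad i j)
  have i2 : Integrable fun x => (∑ i, M i i x) ^ 2 +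
      (∑ i, ∑ j ∈ Finset.Ioi i, (M i j x - M j i x) ^ 2) + ∑ j, τ j x ^ 2 := by
    refine ((integrable_sq_L2 (memLp_finsetSum _ fun i _ => hτ.memLp_grad i i)).add
      (integrable_finsetSum _ fun i _ => integrable_finsetSum _ fun j _ =>
      integrable_sq_L2 ((hτ.memLp_grad i j).sub (hτ.memLp_grad j i)))).add
      (integrable_finsetSum _ fun j _ => integrable_sq_L2 (hτ.memLp j))
  have i3 : ∀ α β, Integrable (frameForm g τ M α β) := by
    intro α β
    refine integrable_finsetSum _ fun j _ => integrable_mul_L2 ?_ (h.memLp_normalGrad hτ β j)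
    have hKc := isCompact_closedBall x₀ (R / 4)
    obtain ⟨B, hB0, hB⟩ := exists_bound_family (fun i => h.lipschitz_frameCoeff α β i j) hKc
    refine MemLp.add ?_ (memLp_finsetSum _ fun i _ => ?_)
    · refine memLp_mul_of_locallyBounded (h.memLp_normalComp hτ α) (Finset.measurable_fun_sum _
        fun i _ => measurable_pderiv i _).aestronglyMeasurable (K := closedBall x₀ (R / 4))
        (fun x hx => ?_) (C := ∑ _i : Fin n, B) fun x hx => ?_
      · simp [normalComp, hτ.eq_zero _ x fun h => hx h.2]
      · exact (Finset.abs_sum_le_sum_abs _ _).trans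
          (Finset.sum_le_sum fun i _ => (hB i x hx).2 i)
    · refine memLp_mul_of_locallyBounded (h.memLp_normalGrad hτ α i)
        (h.lipschitz_frameCoeff α β i j).continuous.aestronglyMeasurable
        (K := closedBall x₀ (R / 4)) (fun x hx => ?_) fun x hx => (hB i x hx).1
      simp [normalGrad, hτ.eq_zero _ x fun h => hx h.2, hτ.grad_eq_zero _ _ x fun h => hx h.2]
  have i4 : Integrable fun x => ∑ α, ∑ β, frameForm g τ M α β x :=
    integrable_finsetSum _ fun α _ => integrable_finsetSum _ fun β _ => i3 α β
  have hz : ∫ x, ∑ α, ∑ β, frameForm g τ M α β x = 0 := by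
    rw [integral_finsetSum _ fun α _ => integrable_finsetSum _ fun β _ => i3 α β]
    refine Finset.sum_eq_zero fun α _ => ?_
    rw [integral_finsetSum _ fun β _ => i3 α β]
    exact Finset.sum_eq_zero fun β _ => h.integral_frameForm hΩ hε hτ α β
  have := integral_mono i1 ((i2.const_mul K).sub (i4.const_mul 4)) hpt
  have e : ∫ x, (K * ((∑ i, M i i x) ^ 2 + (∑ i, ∑ j ∈ Finset.Ioi i, (M i j x - M j i x) ^ 2) +
      ∑ j, τ j x ^ 2) - 4 * ∑ α, ∑ β, frameForm g τ M α β x) = K * ∫ x, ((∑ i, M i i x) ^ 2 +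
      (∑ i, ∑ j ∈ Finset.Ioi i, (M i j x - M j i x) ^ 2) + ∑ j, τ j x ^ 2) := by
    rw [integral_sub (i2.const_mul K) (i4.const_mul 4), integral_const_mul, integral_const_mul, hz]
    ring
  exact this.trans e.le

/-! ### The Sobolev inequality in a chart -/

/-- The grid-lines lemma in the linear coordinates given by the vectors `eᵢ`. -/
theorem exists_lintegral_rpow_le_of_rays {r : ℝ} (hr : Real.HolderConjugate n r) {e : Fin n → E n}
    (he : LinearIndependent ℝ e) : ∃ K : ℝ≥0∞, K ≠ ⊤ ∧ ∀ U F : E n → ℝ≥0∞, Measurable U →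
      Measurable F → (∀ i x, U x ≤ ∫⁻ s : ℝ, F (x + s • e i)) →
      ∫⁻ x, U x ^ r ≤ K * (∫⁻ x, F x) ^ r := by
  let L : (Fin n → ℝ) ≃L[ℝ] E n := (LinearMap.linearEquivOfInjective
    (Fintype.linearCombination ℝ e) (linearIndependent_iff_injective_fintypeLinearCombination.1 he)
    (by simp)).toContinuousLinearEquiv
  have hL : ∀ c, L c = ∑ i, c i • e i := fun c => rfl
  -- A linear isomorphism changes Lebesgue measure only by a constant, by uniqueness of Haar
  -- measure.
  have hmap : ∃ c : ℝ≥0, c ≠ 0 ∧ Measure.map L volume = c • (volume : Measure (E n)) := by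
    have : (Measure.map L volume).IsAddHaarMeasure := L.isAddHaarMeasure_map volume
    exact ⟨_, (Measure.addHaarScalarFactor_pos_of_isAddHaarMeasure _ _).ne',
      Measure.isAddLeftInvariant_eq_smul (Measure.map L volume) volume⟩
  obtain ⟨c, hc0, hc⟩ := hmap
  have hint : ∀ F : E n → ℝ≥0∞, Measurable F → ∫⁻ y, F (L y) = c * ∫⁻ x, F x := by
    intro F hF
    have h1 := lintegral_map (μ := volume) hF L.continuous.measurable
    rw [← h1, hc, lintegral_smul_measure]
    rfl
  refine ⟨(c : ℝ≥0∞)⁻¹ * (c : ℝ≥0∞) ^ r, ?_, fun U F hU hF h => ?_⟩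
  · exact ENNReal.mul_ne_top (ENNReal.inv_ne_top.2 (by simpa using hc0))
      (ENNReal.rpow_ne_top_of_nonneg hr.symm.nonneg (by simp))
  have hn : (1 : ℝ) < n := hr.lt
  have key : ∫⁻ y, U (L y) ^ r ≤ (∫⁻ y, F (L y)) ^ r := by
    have hg := lintegral_prod_lintegral_pow_le (fun _ : Fin n => (volume : Measure ℝ)) (p := r)
      (by simpa using hr) (f := fun y => F (L y)) (hF.comp L.continuous.measurable)
    refine le_trans (lintegral_mono fun y => ?_) hg
    -- Since `r = n / (n - 1)`, the power splits into `n` factors with exponent `1 / (n - 1)`, each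
    -- to be bounded by the integral along its own coordinate line.
    have h1 : U (L y) ^ r = ∏ _i : Fin n, U (L y) ^ ((1 : ℝ) / (n - 1)) := by
      rw [Finset.prod_const, Finset.card_univ, Fintype.card_fin, ← ENNReal.rpow_natCast,
        ← ENNReal.rpow_mul, hr.conjugate_eq]
      congr 1
      ring
    rw [h1, Fintype.card_fin]
    refine Finset.prod_le_prod' fun i _ => ?_
    refine ENNReal.rpow_le_rpow ?_ (by
      have : (0 : ℝ) < n - 1 := by linarith
      positivity)
    refine (h i (L y)).trans (le_of_eq ?_)
    rw [← lintegral_sub_right_eq_self _ (y i)]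
    refine lintegral_congr fun t => ?_
    congr 1
    rw [hL, hL, ← Finset.add_sum_erase _ _ (Finset.mem_univ i),
      ← Finset.add_sum_erase (a := i) (f := fun j => Function.update y i t j • e j) _
      (Finset.mem_univ i)]
    have h2 : ∀ j ∈ Finset.univ.erase i, Function.update y i t j • e j = y j • e j := by
      intro j hj
      rw [Function.update_of_ne (Finset.ne_of_mem_erase hj)]
    rw [Finset.sum_congr rfl h2, Function.update_self, sub_smul]
    abel
  rw [hint _ (hU.pow_const r), hint F hF, ENNReal.mul_rpow_of_nonneg _ _ hr.symm.nonneg] at key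
  calc ∫⁻ x, U x ^ r = (c : ℝ≥0∞)⁻¹ * (c * ∫⁻ x, U x ^ r) := by
        rw [← mul_assoc, ENNReal.inv_mul_cancel (by simpa using hc0) (by simp), one_mul]
    _ ≤ _ := by
      rw [mul_assoc]
      gcongr

/-- A pointwise bound by the integral along a ray that stays in `Ω`. -/
theorem enorm_pow_three_le_lintegral_ray {Ω : Set (E n)} {p : E n → ℝ} (hp : ContDiff ℝ ∞ p)
    (hpc : HasCompactSupport p) {e : E n} (he : e ≠ 0)
    (hray : ∀ x ∈ Ω, p x ≠ 0 → ∀ s : ℝ, 0 ≤ s → p (x + s • e) ≠ 0 → x + s • e ∈ Ω) (x : E n) :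
    (Ω.indicator (fun x => ‖p x‖ₑ) x) ^ 3 ≤ ∫⁻ s : ℝ,
      Ω.indicator (fun x => 3 * ‖e‖ₑ * (‖p x‖ₑ ^ 2 * ∑ i, ‖pderiv i p x‖ₑ)) (x + s • e) := by
  by_cases hx : x ∈ Ω
  swap
  · simp [hx]
  by_cases hpx : p x = 0
  · simp [hpx, hx]
  have hline : ∀ s : ℝ, HasDerivAt (fun s : ℝ => x + (-s) • e) (-e) s := fun s => by
    have := ((hasDerivAt_id s).neg.smul_const e).const_add x
    simpa using! this
  -- The ray is run backwards because the one-dimensional bound integrates over `(-∞, 0]`. The cube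
  -- is chosen so that its derivative contains `p²`, which pairs an `L⁴` norm with the `L²` norm of
  -- the gradient.
  let f : ℝ → ℝ := fun s => p (x + (-s) • e) ^ 3
  have hf : ContDiff ℝ 1 f := by
    refine ContDiff.pow ((hp.of_le (by norm_cast)).comp ?_) 3
    exact contDiff_const.add (contDiff_neg.smul contDiff_const)
  have hfc : HasCompactSupport f := by
    obtain ⟨C, hC⟩ := hpc.isCompact.isBounded.subset_closedBall x
    refine HasCompactSupport.intro (isCompact_Icc (a := -(C / ‖e‖)) (b := C / ‖e‖)) fun s hs => ?_
    have h0 : p (x + (-s) • e) = 0 := by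
      by_contra hne
      have h1 := hC (subset_tsupport _ hne)
      rw [mem_closedBall, dist_eq_norm, add_sub_cancel_left, norm_smul, norm_neg,
        Real.norm_eq_abs, ← le_div_iff₀ (norm_pos_iff.2 he), abs_le] at h1
      exact hs h1
    simp only [f, h0]
    norm_num
  have hderiv : ∀ s, deriv f s = 3 * p (x + (-s) • e) ^ 2 * fderiv ℝ p (x + (-s) • e) (-e) := by
    intro s
    have h1 := ((hp.differentiable (by simp) _).hasFDerivAt).comp_hasDerivAt s (hline s)
    have := (h1.pow 3).deriv
    exact this.trans (by simp)
  have hdir : ∀ y, ‖fderiv ℝ p y (-e)‖ₑ ≤ ‖e‖ₑ * ∑ i, ‖pderiv i p y‖ₑ := by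
    intro y
    have h1 : -e = ∑ i, (-e) i • EuclideanSpace.single i (1 : ℝ) := by
      have := (EuclideanSpace.basisFun (Fin n) ℝ).sum_repr (-e)
      simpa using this.symm
    rw [h1, map_sum, Finset.mul_sum]
    refine (enorm_sum_le _ _).trans (Finset.sum_le_sum fun i _ => ?_)
    rw [map_smul, enorm_smul, pderiv]
    gcongr
    rw [← enorm_neg e]
    exact enorm_le_iff_norm_le.2 (PiLp.norm_apply_le (-e) i)
  have h0 := hfc.enorm_le_lintegral_Ici_deriv hf 0
  have e0 : ‖f 0‖ₑ = Ω.indicator (fun x => ‖p x‖ₑ) x ^ 3 := by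
    simp [f, hx, enorm_pow]
  rw [← e0]
  refine h0.trans ?_
  rw [← lintegral_neg_eq_self (fun s : ℝ => Ω.indicator _ (x + s • e)),
    ← lintegral_indicator measurableSet_Iic]
  refine lintegral_mono fun s => ?_
  by_cases hs : s ∈ Set.Iic (0 : ℝ)
  · rw [Set.indicator_of_mem hs, hderiv]
    -- Where `p` vanishes so does the derivative of its cube, hence `hray` is needed only at points
    -- with `p ≠ 0`.
    by_cases hps : p (x + (-s) • e) = 0
    · rw [hps]
      simp
    · have hmem := hray x hx hpx (-s) (by simpa using hs) hps
      rw [Set.indicator_of_mem hmem, enorm_mul, enorm_mul, enorm_pow]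
      have h3 : ‖(3 : ℝ)‖ₑ = 3 := by
        rw [Real.enorm_eq_ofReal (by norm_num)]
        norm_num
      rw [h3]
      calc _ ≤ 3 * ‖p (x + (-s) • e)‖ₑ ^ 2 * (‖e‖ₑ * ∑ i, ‖pderiv i p (x + (-s) • e)‖ₑ) := by
            gcongr
            exact hdir _
        _ = _ := by ring
  · rw [Set.indicator_of_notMem hs]
    exact zero_le

/-- In the orthonormal family the coefficients of a vanishing combination satisfy `(∑ c) + c k = 0`
for each `k`; summing over `k` gives `(n + 1) ∑ c = 0`. -/
theorem linearIndependent_sum_add {a : Fin n → E n} (ha : Orthonormal ℝ a) :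
    LinearIndependent ℝ fun i => (∑ k, a k) + a i := by
  rw [Fintype.linearIndependent_iff]
  intro c hc
  have h1 : ∀ k, (∑ i, c i) + c k = 0 := by
    intro k
    have h2 : inner ℝ (a k) (∑ i, c i • ((∑ k, a k) + a i)) = 0 := by rw [hc, inner_zero_right]
    have h3 : ∑ i, c i • ((∑ k, a k) + a i) = ∑ l, ((∑ i, c i) + c l) • a l := by
      simp only [smul_add, add_smul, Finset.sum_add_distrib, Finset.smul_sum, Finset.sum_smul]
      rw [Finset.sum_comm]
    rwa [h3, ha.inner_right_fintype] at h2
  have h4 : (∑ i, c i) * (n + 1) = 0 := by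
    have : ∑ k : Fin n, ((∑ i, c i) + c k) = 0 := Finset.sum_eq_zero fun k _ => h1 k
    rw [Finset.sum_add_distrib] at this
    simp only [Finset.sum_const, Finset.card_univ, Fintype.card_fin, nsmul_eq_mul] at this
    linarith
  have h5 : ∑ i, c i = 0 := by
    rcases mul_eq_zero.1 h4 with h | h
    · exact h
    · have : (0 : ℝ) < n + 1 := by positivity
      exact absurd h this.ne'
  intro i
  have := h1 i
  rwa [h5, zero_add] at this

theorem norm_sum_add_le {a : Fin n → E n} (ha : Orthonormal ℝ a) (i : Fin n) :
    ‖(∑ k, a k) + a i‖ ≤ n + 1 := by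
  refine (norm_add_le _ _).trans (add_le_add ((norm_sum_le _ _).trans ?_) (ha.1 i).le)
  simp [ha.1]

theorem one_le_inner_sum_add {a : Fin n → E n} (ha : Orthonormal ℝ a) (i k : Fin n) :
    1 ≤ inner ℝ (a k) ((∑ k, a k) + a i) := by
  have h1 : inner ℝ (a k) (∑ k, a k) = (1 : ℝ) := by
    simpa using ha.inner_right_fintype (fun _ => (1 : ℝ)) k
  rw [inner_add_right, h1, orthonormal_iff_ite.1 ha k i]
  split_ifs <;> norm_num

/-- Along `∑ a k + a i` every `g k` increases: its linear part grows at least by `s`, the deviation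
is at most `s / 4`. -/
theorem IsChart.add_smul_mem {Ω : Set (E n)} {x₀ : E n} {g : Fin n → E n → ℝ} {a : Fin n → E n}
    {R ε : ℝ} (h : IsChart Ω x₀ g a R ε) (hε : ε * (n + 1) ≤ 1 / 4) (i : Fin n) {x : E n}
    (hx : x ∈ Ω) (hxR : x ∈ ball x₀ R) {s : ℝ} (hs : 0 ≤ s)
    (hsR : x + s • ((∑ k, a k) + a i) ∈ ball x₀ R) : x + s • ((∑ k, a k) + a i) ∈ Ω := by
  rw [h.mem_iff _ hsR]
  intro k
  have h1 := (h.mem_iff x hxR).1 hx k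
  have h2 := h.abs_sub_sub_inner_le hxR hsR k
  have hε0 : 0 ≤ ε := (norm_nonneg _).trans (h.fderiv_close x hxR k)
  rw [inner_smul_right, norm_smul, Real.norm_of_nonneg hs, abs_le] at h2
  have h3 : ε * (s * ‖(∑ k, a k) + a i‖) ≤ 1 / 4 * s := by
    calc ε * (s * ‖(∑ k, a k) + a i‖) ≤ ε * (s * (n + 1)) := by
          gcongr
          exact norm_sum_add_le h.orthonormal i
      _ = ε * (n + 1) * s := by ring
      _ ≤ _ := by gcongr
  have h4 : s * 1 ≤ s * inner ℝ (a k) ((∑ k, a k) + a i) :=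
    mul_le_mul_of_nonneg_left (one_le_inner_sum_add h.orthonormal i k) hs
  linarith [h2.1]

theorem lintegral_sq_mul_le {f q : E n → ℝ} (hf : AEStronglyMeasurable f)
    (hq : AEStronglyMeasurable q) :
    ∫⁻ x, ‖f x‖ₑ ^ 2 * ‖q x‖ₑ ≤ eLpNorm f 4 volume ^ 2 * eLpNorm q 2 volume := by
  have h := ENNReal.lintegral_mul_le_Lp_mul_Lq volume Real.HolderConjugate.two_two
    (f := fun x => ‖f x‖ₑ ^ 2) (g := fun x => ‖q x‖ₑ) (hf.enorm.pow_const _) hq.enorm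
  refine h.trans (le_of_eq ?_)
  congr 1
  · rw [eLpNorm_eq_lintegral_rpow_enorm_toReal (by norm_num) (by norm_num), ← ENNReal.rpow_natCast,
      ← ENNReal.rpow_mul]
    have : ∀ x, (‖f x‖ₑ ^ 2) ^ (2 : ℝ) = ‖f x‖ₑ ^ (4 : ℝ) := fun x => by
      rw [← ENNReal.rpow_natCast, ← ENNReal.rpow_mul]
      norm_num
    simp only [this, ENNReal.toReal_ofNat]
    norm_num
  · rw [eLpNorm_eq_lintegral_rpow_enorm_toReal (by norm_num) (by norm_num)]
    simp

/-- The Sobolev inequality for functions which are smooth up to the boundary and supported in a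
chart. -/
theorem IsChart.exists_eLpNorm_four_le_of_contDiff {Ω : Set (E n)} {x₀ : E n}
    {g : Fin n → E n → ℝ} {a : Fin n → E n} {R ε : ℝ} (h : IsChart Ω x₀ g a R ε) (hΩ : IsOpen Ω)
    (hε : ε * (n + 1) ≤ 1 / 4) (hn2 : 2 ≤ n) (hn4 : n ≤ 4) :
    ∃ K : ℝ≥0∞, K ≠ ⊤ ∧ ∀ p : E n → ℝ, ContDiff ℝ ∞ p → tsupport p ⊆ closedBall x₀ (R / 2) →
      eLpNorm (Ω.indicator p) 4 volume ≤ K * ∑ i, eLpNorm (Ω.indicator (pderiv i p)) 2 volume := by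
  have hR := h.R_pos
  have hn1 : (1 : ℝ) < n := by exact_mod_cast hn2
  let r : ℝ := Real.conjExponent n
  have hr : Real.HolderConjugate n r := .conjExponent hn1
  have hr0 : 0 < r := hr.symm.pos
  -- The exponent `3n / (n - 1)` supplied by the cube reaches `4` exactly when `n ≤ 4`.
  have hr4 : 4 ≤ 3 * r := by
    have h1 : r = n / (n - 1) := rfl
    have h2 : (0 : ℝ) < n - 1 := by linarith
    have h3 : (n : ℝ) ≤ 4 := by exact_mod_cast hn4
    rw [h1, ← mul_div_assoc, le_div_iff₀ h2]
    linarith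
  obtain ⟨K₀, hK₀, hgrid⟩ := exists_lintegral_rpow_le_of_rays hr
    (linearIndependent_sum_add h.orthonormal)
  let V := closedBall x₀ (R / 2)
  let θ : ℝ := 1 / (4 : ℝ≥0∞).toReal - 1 / (ENNReal.ofReal (3 * r)).toReal
  have hθ : 0 ≤ θ := by
    simp only [θ, ENNReal.toReal_ofNat]
    rw [ENNReal.toReal_ofReal (by positivity), sub_nonneg]
    exact one_div_le_one_div_of_le (by norm_num) hr4
  let v : ℝ≥0∞ := volume V ^ θ
  have hv : v ≠ ⊤ := ENNReal.rpow_ne_top_of_nonneg hθ (measure_closedBall_lt_top).ne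
  -- The `3` comes from differentiating the cube, and `n + 1` bounds the length of the ray
  -- directions.
  let c : ℝ≥0∞ := 3 * (n + 1)
  refine ⟨K₀ ^ (1 / r) * v ^ 3 * c, ?_, fun p hp hps => ?_⟩
  · refine ENNReal.mul_ne_top (ENNReal.mul_ne_top ?_ (ENNReal.pow_ne_top hv)) ?_
    · exact ENNReal.rpow_ne_top_of_nonneg (by positivity) hK₀
    · exact ENNReal.mul_ne_top (by norm_num) (by simp)
  have hpc : HasCompactSupport p := HasCompactSupport.of_support_subset_isCompact
    (isCompact_closedBall x₀ (R / 2)) ((subset_tsupport _).trans hps)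
  set f := Ω.indicator p with hf
  set q := fun i => Ω.indicator (pderiv i p) with hq
  have hfm : Measurable f := hp.continuous.measurable.indicator hΩ.measurableSet
  have hqm : ∀ i, Measurable (q i) := fun i => (measurable_pderiv i p).indicator hΩ.measurableSet
  let F : E n → ℝ≥0∞ := fun x => c * ∑ i, ‖f x‖ₑ ^ 2 * ‖q i x‖ₑ
  have hFm : Measurable F := (Finset.measurable_fun_sum _ fun i _ =>
    (hfm.enorm.pow_const _).mul (hqm i).enorm).const_mul _
  have hF : ∫⁻ x, F x ≤ c * (eLpNorm f 4 volume ^ 2 * ∑ i, eLpNorm (q i) 2 volume) := by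
    have hm : ∀ i, Measurable fun x => ‖f x‖ₑ ^ 2 * ‖q i x‖ₑ := fun i =>
      (hfm.enorm.pow_const _).mul (hqm i).enorm
    change ∫⁻ x, c * ∑ i, ‖f x‖ₑ ^ 2 * ‖q i x‖ₑ ≤ _
    rw [lintegral_const_mul _ (Finset.measurable_fun_sum _ fun i _ => hm i),
      lintegral_finsetSum _ fun i _ => hm i, Finset.mul_sum, Finset.mul_sum, Finset.mul_sum]
    gcongr with i
    exact lintegral_sq_mul_le hfm.aestronglyMeasurable (hqm i).aestronglyMeasurable
  have hU := hgrid (fun x => ‖f x‖ₑ ^ 3) F (hfm.enorm.pow_const _) hFm fun i x => by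
    have hray := enorm_pow_three_le_lintegral_ray (Ω := Ω) hp hpc (e := (∑ k, a k) + a i)
      (fun h0 => by
        have := one_le_inner_sum_add h.orthonormal i i
        rw [h0, inner_zero_right] at this
        linarith)
      (fun x hx hpx s hs hps' => h.add_smul_mem hε i hx
        (closedBall_subset_ball (by linarith) (hps (subset_tsupport _ hpx))) hs
        (closedBall_subset_ball (by linarith) (hps (subset_tsupport _ hps')))) x
    have e1 : Ω.indicator (fun x => ‖p x‖ₑ) x = ‖f x‖ₑ := by
      by_cases hx : x ∈ Ω <;> simp [hf, hx]
    rw [e1] at hray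
    refine hray.trans (lintegral_mono fun s => ?_)
    set y := x + s • ((∑ k, a k) + a i)
    by_cases hy : y ∈ Ω
    · simp only [F, hf, hq, Set.indicator_of_mem hy, Finset.mul_sum, c]
      refine Finset.sum_le_sum fun j _ => ?_
      gcongr
      rw [← ofReal_norm]
      refine (ENNReal.ofReal_le_ofReal (norm_sum_add_le h.orthonormal i)).trans (le_of_eq ?_)
      rw [ENNReal.ofReal_add (by positivity) (by positivity)]
      simp
    · rw [Set.indicator_of_notMem hy]
      exact zero_le
  have hsupp : Function.support f ⊆ V := fun x hx => by
    refine hps (subset_tsupport _ fun h0 => hx ?_)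
    by_cases hxΩ : x ∈ Ω <;> simp [hf, hxΩ, h0]
  set N := eLpNorm f 4 volume with hN
  have hNtop : N ≠ ⊤ := by
    have h1 : MemLp p 4 := hp.continuous.memLp_of_hasCompactSupport hpc
    exact (h1.indicator hΩ.measurableSet).2.ne
  -- The support has finite measure, so the `L⁴` norm is bounded by the stronger `L^{3r}` norm.
  have hNq : N ≤ eLpNorm f (ENNReal.ofReal (3 * r)) volume * v := by
    have h1 := eLpNorm_le_eLpNorm_mul_rpow_measure_univ (p := 4) (q := ENNReal.ofReal (3 * r))
      (μ := volume.restrict V) (f := f) (by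
        rw [← ENNReal.ofReal_ofNat]
        exact ENNReal.ofReal_le_ofReal hr4) hfm.aestronglyMeasurable
    rwa [eLpNorm_restrict_eq_of_support_subset hsupp, eLpNorm_restrict_eq_of_support_subset hsupp,
      Measure.restrict_apply_univ] at h1
  have hq3 : eLpNorm f (ENNReal.ofReal (3 * r)) volume ^ 3 ≤ K₀ ^ (1 / r) * ∫⁻ x, F x := by
    rw [eLpNorm_eq_lintegral_rpow_enorm_toReal (by simpa using by positivity) ENNReal.ofReal_ne_top,
      ENNReal.toReal_ofReal (by positivity), ← ENNReal.rpow_natCast, ← ENNReal.rpow_mul]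
    have e1 : ∀ x, (‖f x‖ₑ ^ 3) ^ r = ‖f x‖ₑ ^ (3 * r) := fun x => by
      rw [← ENNReal.rpow_natCast, ← ENNReal.rpow_mul]
      norm_num
    simp only [e1] at hU
    have e2 : 1 / (3 * r) * ((3 : ℕ) : ℝ) = 1 / r := by
      push_cast
      field_simp
    rw [e2]
    refine (ENNReal.rpow_le_rpow hU (by positivity)).trans (le_of_eq ?_)
    rw [ENNReal.mul_rpow_of_nonneg _ _ (by positivity), ← ENNReal.rpow_mul,
      mul_one_div_cancel hr0.ne', ENNReal.rpow_one]
  -- The gradient bound for `‖f‖³` contains `‖f‖₄²`, which is finite and may be divided out unless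
  -- it is zero.
  have hfin : N ^ 2 * N ≤ N ^ 2 * (K₀ ^ (1 / r) * v ^ 3 * c * ∑ i, eLpNorm (q i) 2 volume) := by
    calc N ^ 2 * N = N ^ 3 := by ring
      _ ≤ (eLpNorm f (ENNReal.ofReal (3 * r)) volume * v) ^ 3 := by gcongr
      _ = eLpNorm f (ENNReal.ofReal (3 * r)) volume ^ 3 * v ^ 3 := by ring
      _ ≤ (K₀ ^ (1 / r) * (c * (N ^ 2 * ∑ i, eLpNorm (q i) 2 volume))) * v ^ 3 := by
        gcongr
        exact hq3.trans (by gcongr)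
      _ = _ := by ring
  by_cases hN0 : N = 0
  · rw [hN0]
    exact zero_le
  · exact (ENNReal.mul_le_mul_iff_right (pow_ne_zero 2 hN0) (ENNReal.pow_ne_top hNtop)).1 hfin

/-- The Sobolev inequality for functions of class `H¹` supported in a chart. -/
theorem IsChart.exists_eLpNorm_four_le {Ω : Set (E n)} {x₀ : E n}
    {g : Fin n → E n → ℝ} {a : Fin n → E n} {R ε : ℝ} (h : IsChart Ω x₀ g a R ε) (hΩ : IsOpen Ω)
    (hε : ε * (n + 1) ≤ 1 / 4) (hn2 : 2 ≤ n) (hn4 : n ≤ 4) :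
    ∃ K : ℝ≥0∞, K ≠ ⊤ ∧ ∀ (u : E n → ℝ) (w : Fin n → E n → ℝ), MemLp u 2 → (∀ i, MemLp (w i) 2) →
      (∀ x ∉ Ω ∩ closedBall x₀ (R / 4), u x = 0) →
      (∀ i, ∀ x ∉ Ω ∩ closedBall x₀ (R / 4), w i x = 0) → HasWeakGrad Ω u w →
      eLpNorm u 4 volume ≤ K * ∑ i, eLpNorm (w i) 2 volume := by
  obtain ⟨K, hK, hb⟩ := h.exists_eLpNorm_four_le_of_contDiff hΩ hε hn2 hn4
  refine ⟨K, hK, fun u w hu hw hu0 hw0 hgrad => ?_⟩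
  -- With all shifts inward, the weak gradient inside `Ω` suffices.
  obtain ⟨p, q, hp, hps, hpq, -, hp2, hq2, hpt, hqt⟩ := h.exists_approx hε (s := fun _ => 1)
    (by simp) hu hw hu0 hw0 (fun i φ h1 h2 h3 => hgrad i φ h1 h2 fun x hx =>
      (h.mem_iff x (h3 hx).1).2 fun k => (h3 hx).2 k rfl)
  have hbound : ∀ m, eLpNorm (Ω.indicator (p m)) 4 volume ≤
      K * ∑ i, eLpNorm (q m i) 2 volume := fun m => by
    refine (hb (p m) (hp m) (hps m)).trans ?_
    gcongr with i
    have : Ω.indicator (pderiv i (p m)) = Ω.indicator (q m i) := by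
      funext x
      by_cases hx : x ∈ Ω <;> simp [hx, hpq m x]
    rw [this]
    exact eLpNorm_indicator_le _
  have hqlim : Tendsto (fun m => K * ∑ i, eLpNorm (q m i) 2 volume) atTop
      (𝓝 (K * ∑ i, eLpNorm (w i) 2 volume)) := by
    refine ENNReal.Tendsto.const_mul (tendsto_finsetSum _ fun i _ => ?_) (Or.inr hK)
    have h1 : Tendsto (fun m => (hq2 m i).toLp (q m i)) atTop (𝓝 ((hw i).toLp (w i))) := by
      rw [Lp.tendsto_Lp_iff_tendsto_eLpNorm'']
      exact hqt i
    have h2 := h1.enorm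
    simpa only [Lp.enorm_toLp] using h2
  have hmeas := tendstoInMeasure_of_tendsto_eLpNorm (p := 2) (by norm_num)
    (fun m => (hp2 m).1) hu.1 hpt
  obtain ⟨ns, hns, hae⟩ := hmeas.exists_seq_tendsto_ae
  have hlim : ∀ᵐ x, Tendsto (fun m => Ω.indicator (p (ns m)) x) atTop (𝓝 (u x)) := by
    filter_upwards [hae] with x hx
    by_cases hxΩ : x ∈ Ω
    · simpa [hxΩ] using hx
    · simp [hxΩ, hu0 x fun h => hxΩ h.1]
  -- Only `L²` convergence is known, so the `L⁴` bound passes to the limit by Fatou's lemma along an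
  -- almost everywhere convergent subsequence.
  have hfatou := Lp.eLpNorm_lim_le_liminf_eLpNorm (p := 4)
    (fun m => ((hp (ns m)).continuous.aestronglyMeasurable (μ := volume)).indicator
      hΩ.measurableSet) u hlim
  refine hfatou.trans ?_
  rw [← (hqlim.comp hns.tendsto_atTop).liminf_eq]
  exact liminf_le_liminf (.of_forall fun m => hbound (ns m))

/-! ### Localisation by cutoffs and the global inequalities -/

/-- The product `χ φ` is again a test function. For `O = univ` this says that multiplication by a
smooth scalar preserves the zero normal trace. -/
theorem HasWeakDiv.cutoff {O : Set (E n)} {F : Fin n → E n → ℝ} {G χ : E n → ℝ}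
    (h : HasWeakDiv O F G) (hχ : ContDiff ℝ ∞ χ) :
    HasWeakDiv O (fun i x => χ x * F i x) fun x => χ x * G x + ∑ i, F i x * pderiv i χ x := by
  intro φ h1 h2 h3
  rw [← h (fun x => χ x * φ x) (hχ.mul h1) h2.mul_left
    ((closure_mono (Function.support_mul_subset_right _ _)).trans h3)]
  congr 1
  funext x
  have e : ∀ i, pderiv i (fun x => χ x * φ x) x = χ x * pderiv i φ x + pderiv i χ x * φ x :=
    fun i => pderiv_mul i (hχ.differentiable (by simp) x) (h1.differentiable (by simp) x)
  simp only [e, add_mul, Finset.sum_mul, mul_add, Finset.sum_add_distrib]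
  rw [add_assoc, add_comm (χ x * G x * φ x)]
  congr 1
  · exact Finset.sum_congr rfl fun i _ => by ring
  · congr 1
    · exact Finset.sum_congr rfl fun i _ => by ring
    · ring

theorem HasWeakGrad.cutoff {O : Set (E n)} {u : E n → ℝ} {w : Fin n → E n → ℝ} {χ : E n → ℝ}
    (h : HasWeakGrad O u w) (hχ : ContDiff ℝ ∞ χ) :
    HasWeakGrad O (fun x => χ x * u x) fun i x => χ x * w i x + u x * pderiv i χ x := by
  intro i φ h1 h2 h3
  rw [← h i (fun x => χ x * φ x) (hχ.mul h1) h2.mul_left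
    ((closure_mono (Function.support_mul_subset_right _ _)).trans h3)]
  congr 1
  funext x
  rw [pderiv_mul i (hχ.differentiable (by simp) x) (h1.differentiable (by simp) x)]
  ring

/-- A smooth cutoff function between concentric balls. -/
theorem exists_cutoff (x₀ : E n) {r : ℝ} (hr : 0 < r) :
    ∃ (χ : E n → ℝ) (C : ℝ), ContDiff ℝ ∞ χ ∧ 0 ≤ C ∧ (∀ x, |χ x| ≤ 1) ∧
      (∀ i x, |pderiv i χ x| ≤ C) ∧ (∀ x ∈ ball x₀ r, χ x = 1 ∧ ∀ i, pderiv i χ x = 0) ∧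
      ∀ x ∉ closedBall x₀ (2 * r), χ x = 0 ∧ ∀ i, pderiv i χ x = 0 := by
  let χ : ContDiffBump x₀ := ⟨r, 2 * r, hr, by linarith⟩
  have hs : tsupport χ = closedBall x₀ (2 * r) := χ.tsupport_eq
  have hcs : HasCompactSupport χ := χ.hasCompactSupport
  have hχ : ContDiff ℝ ∞ χ := χ.contDiff
  have hb : ∀ i, ∃ C, ∀ x, ‖pderiv i χ x‖ ≤ C := fun i =>
    ((contDiff_pderiv hχ i).continuous).bounded_above_of_compact_support
      (hcs.fderiv_apply (𝕜 := ℝ) _)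
  choose C hC using hb
  refine ⟨χ, ∑ i, |C i|, hχ, Finset.sum_nonneg fun i _ => abs_nonneg _, fun x => ?_,
    fun i x => ?_, fun x hx => ⟨χ.one_of_mem_closedBall (ball_subset_closedBall hx), fun i => ?_⟩,
    fun x hx => ⟨?_, fun i => ?_⟩⟩
  · rw [abs_of_nonneg χ.nonneg]
    exact χ.le_one
  · exact ((hC i x).trans (le_abs_self _)).trans
      (Finset.single_le_sum (f := fun i => |C i|) (fun i _ => abs_nonneg _) (Finset.mem_univ i))
  · have : (χ : E n → ℝ) =ᶠ[𝓝 x] fun _ => 1 := by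
      filter_upwards [isOpen_ball.mem_nhds hx] with y hy
      exact χ.one_of_mem_closedBall (ball_subset_closedBall hy)
    simp [pderiv, this.fderiv_eq]
  · exact image_eq_zero_of_notMem_tsupport (hs ▸ hx)
  · exact pderiv_eq_zero_of_notMem i (hs ▸ hx)

theorem memLp_cutoff {u χ : E n → ℝ} (hu : MemLp u 2) (hχ : Measurable χ) {C : ℝ}
    (hC : ∀ x, |χ x| ≤ C) : MemLp (fun x => χ x * u x) 2 := by
  simpa only [mul_comm] using MemLp.mul_of_bound hu hχ.aestronglyMeasurable fun x _ => hC x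

theorem IsTangentialField.cutoff {Ω : Set (E n)} {τ : Fin n → E n → ℝ} {M : Fin n → Fin n → E n → ℝ}
    (h : IsTangentialField Ω Set.univ τ M) {χ : E n → ℝ} (hχ : ContDiff ℝ ∞ χ) {C : ℝ}
    (h1 : ∀ x, |χ x| ≤ 1) (hC : ∀ i x, |pderiv i χ x| ≤ C) {K : Set (E n)}
    (h0 : ∀ x ∉ K, χ x = 0 ∧ ∀ i, pderiv i χ x = 0) :
    IsTangentialField Ω K (fun j x => χ x * τ j x)
      fun i j x => χ x * M i j x + τ j x * pderiv i χ x where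
  memLp j := memLp_cutoff (h.memLp j) hχ.continuous.measurable h1
  memLp_grad i j := (memLp_cutoff (h.memLp_grad i j) hχ.continuous.measurable h1).add
    (MemLp.mul_of_bound (h.memLp j) (measurable_pderiv i χ).aestronglyMeasurable
      fun x _ => hC i x)
  eq_zero j x hx := by
    by_cases hxΩ : x ∈ Ω
    · simp [(h0 x fun hK => hx ⟨hxΩ, hK⟩).1]
    · simp [h.eq_zero j x fun h => hxΩ h.1]
  grad_eq_zero i j x hx := by
    by_cases hxΩ : x ∈ Ω
    · simp [h0 x fun hK => hx ⟨hxΩ, hK⟩]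
    · simp [h.eq_zero j x fun h => hxΩ h.1, h.grad_eq_zero i j x fun h => hxΩ h.1]
  weakGrad j := (h.weakGrad j).cutoff hχ
  weakDiv := by
    simpa only [Finset.mul_sum, Finset.sum_add_distrib] using h.weakDiv.cutoff hχ

theorem add_sq_le_two_mul (a b : ℝ) : (a + b) ^ 2 ≤ 2 * a ^ 2 + 2 * b ^ 2 := by
  linarith [sq_nonneg (a - b), add_sq a b, sub_sq a b]

/-- The integrand `|div τ|² + |rot τ|² + |τ|²`, if `M i j = ∂ᵢτⱼ`. -/
def divRotForm (τ : Fin n → E n → ℝ) (M : Fin n → Fin n → E n → ℝ) (x : E n) : ℝ :=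
  (∑ i, M i i x) ^ 2 + (∑ i, ∑ j ∈ Finset.Ioi i, (M i j x - M j i x) ^ 2) + ∑ j, τ j x ^ 2

theorem integrable_divRotForm {τ : Fin n → E n → ℝ} {M : Fin n → Fin n → E n → ℝ}
    (hτ : ∀ j, MemLp (τ j) 2) (hM : ∀ i j, MemLp (M i j) 2) : Integrable (divRotForm τ M) := by
  refine ((integrable_sq_L2 (memLp_finsetSum _ fun i _ => hM i i)).add
    (integrable_finsetSum _ fun i _ => integrable_finsetSum _ fun j _ =>
      integrable_sq_L2 ((hM i j).sub (hM j i)))).add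
    (integrable_finsetSum _ fun j _ => integrable_sq_L2 (hτ j))

theorem divRotForm_cutoff_le {τ : Fin n → E n → ℝ} {M : Fin n → Fin n → E n → ℝ} {χ : E n → ℝ}
    {C : ℝ} {x : E n} (h1 : |χ x| ≤ 1) (hC : ∀ i, |pderiv i χ x| ≤ C) :
    divRotForm (fun j x => χ x * τ j x) (fun i j x => χ x * M i j x + τ j x * pderiv i χ x) x ≤
      (2 + 2 * n * C ^ 2 + n * n * (8 * C ^ 2)) * divRotForm τ M x := by
  have hχ : χ x ^ 2 ≤ 1 := (sq_le_one_iff_abs_le_one _).2 h1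
  have hp : ∀ i, pderiv i χ x ^ 2 ≤ C ^ 2 := fun i => by
    rw [← sq_abs]
    exact pow_le_pow_left₀ (abs_nonneg _) (hC i) 2
  set S := ∑ j, τ j x ^ 2 with hS
  have hS0 : 0 ≤ S := Finset.sum_nonneg fun j _ => sq_nonneg _
  have hτS : ∀ j, τ j x ^ 2 ≤ S := fun j =>
    Finset.single_le_sum (f := fun j => τ j x ^ 2) (fun _ _ => sq_nonneg _) (Finset.mem_univ j)
  have hτp : ∀ i j, (τ j x * pderiv i χ x) ^ 2 ≤ C ^ 2 * S := fun i j => by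
    rw [mul_pow, mul_comm]
    exact mul_le_mul (hp i) (hτS j) (sq_nonneg _) (sq_nonneg _)
  have hdiv : (∑ i, (χ x * M i i x + τ i x * pderiv i χ x)) ^ 2 ≤
      2 * (∑ i, M i i x) ^ 2 + 2 * n * C ^ 2 * S := by
    rw [Finset.sum_add_distrib, ← Finset.mul_sum]
    refine (add_sq_le_two_mul _ _).trans (add_le_add ?_ ?_)
    · rw [mul_pow]
      have := mul_le_mul_of_nonneg_right hχ (sq_nonneg (∑ i, M i i x))
      linarith
    · have h2 := sq_sum_le_card_mul_sum_sq (s := Finset.univ) (f := fun i => τ i x * pderiv i χ x)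
      have h3 : ∑ i, (τ i x * pderiv i χ x) ^ 2 ≤ C ^ 2 * S := by
        rw [hS, Finset.mul_sum]
        refine Finset.sum_le_sum fun i _ => ?_
        rw [mul_pow, mul_comm]
        exact mul_le_mul_of_nonneg_right (hp i) (sq_nonneg _)
      rw [Finset.card_univ, Fintype.card_fin] at h2
      have h4 := mul_le_mul_of_nonneg_left h3 (Nat.cast_nonneg (α := ℝ) n)
      linarith
  have hrot : ∑ i, ∑ j ∈ Finset.Ioi i, ((χ x * M i j x + τ j x * pderiv i χ x) -
      (χ x * M j i x + τ i x * pderiv j χ x)) ^ 2 ≤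
      2 * (∑ i, ∑ j ∈ Finset.Ioi i, (M i j x - M j i x) ^ 2) + n * n * (8 * C ^ 2) * S := by
    -- Each entry of the rotation has two error terms of square at most `C² S`, and splitting
    -- squares twice gives `2 (2 + 2) = 8`.
    have h2 : ∀ i j, ((χ x * M i j x + τ j x * pderiv i χ x) -
        (χ x * M j i x + τ i x * pderiv j χ x)) ^ 2 ≤
        2 * (M i j x - M j i x) ^ 2 + 8 * C ^ 2 * S := fun i j => by
      have e : (χ x * M i j x + τ j x * pderiv i χ x) - (χ x * M j i x + τ i x * pderiv j χ x) =
        χ x * (M i j x - M j i x) + (τ j x * pderiv i χ x + -(τ i x * pderiv j χ x)) := by ring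
      rw [e]
      refine (add_sq_le_two_mul _ _).trans (add_le_add ?_ ?_)
      · rw [mul_pow]
        have := mul_le_mul_of_nonneg_right hχ (sq_nonneg (M i j x - M j i x))
        linarith
      · have h3 := add_sq_le_two_mul (τ j x * pderiv i χ x) (-(τ i x * pderiv j χ x))
        rw [neg_sq] at h3
        linarith [hτp i j, hτp j i]
    calc _ ≤ ∑ i, ∑ j ∈ Finset.Ioi i, (2 * (M i j x - M j i x) ^ 2 + 8 * C ^ 2 * S) :=
          Finset.sum_le_sum fun i _ => Finset.sum_le_sum fun j _ => h2 i j
      _ = 2 * (∑ i, ∑ j ∈ Finset.Ioi i, (M i j x - M j i x) ^ 2) +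
          ∑ i : Fin n, ∑ j ∈ Finset.Ioi i, 8 * C ^ 2 * S := by
        simp only [Finset.sum_add_distrib, Finset.mul_sum]
      _ ≤ 2 * (∑ i, ∑ j ∈ Finset.Ioi i, (M i j x - M j i x) ^ 2) +
          ∑ i : Fin n, ∑ j : Fin n, 8 * C ^ 2 * S := by
        gcongr with i
        exact Finset.subset_univ _
      _ = _ := by
        simp only [Finset.sum_const, Finset.card_univ, Fintype.card_fin, nsmul_eq_mul]
        ring
  have hτ : ∑ j, (χ x * τ j x) ^ 2 ≤ S := Finset.sum_le_sum fun j _ => by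
    rw [mul_pow]
    have := mul_le_mul_of_nonneg_right hχ (sq_nonneg (τ j x))
    linarith
  have hA : 0 ≤ (2 * n * C ^ 2 + n * n * (8 * C ^ 2)) * ((∑ i, M i i x) ^ 2 +
    (∑ i, ∑ j ∈ Finset.Ioi i, (M i j x - M j i x) ^ 2)) := by positivity
  simp only [divRotForm]
  linarith

/-- The cutoff is `1` on the ball of radius `R / 8` and supported in radius `R / 4`, as the chart
inequality requires. The choice of `ε` makes `ε (n + 1) = 1 / 4`. -/
theorem exists_gaffney_ball {Ω : Set (E n)} (hΩ : IsOpen Ω) (hB : HasC11Boundary Ω) {x₀ : E n}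
    (hx₀ : x₀ ∈ closure Ω) : ∃ r > 0, ∃ K, 0 ≤ K ∧
      ∀ (τ : Fin n → E n → ℝ) (M : Fin n → Fin n → E n → ℝ), IsTangentialField Ω Set.univ τ M →
        ∫ x in ball x₀ r, ∑ i, ∑ j, M i j x ^ 2 ≤ K * ∫ x, divRotForm τ M x := by
  obtain ⟨g, a, R, h⟩ := exists_isChart hΩ hB hx₀ (ε := 1 / (4 * (n + 1))) (by positivity)
  have hR := h.R_pos
  obtain ⟨K, hK, hG⟩ := h.gaffney hΩ (le_of_eq (by field_simp))
  obtain ⟨χ, C, hχ, hC0, hχ1, hC, hin, hout⟩ := exists_cutoff x₀ (r := R / 8) (by positivity)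
  refine ⟨R / 8, by positivity, K * (2 + 2 * n * C ^ 2 + n * n * (8 * C ^ 2)), by positivity,
    fun τ M hτ => ?_⟩
  have hτ' := hτ.cutoff (K := closedBall x₀ (R / 4)) hχ hχ1 hC fun x hx =>
    hout x (by rwa [show 2 * (R / 8) = R / 4 by ring])
  calc ∫ x in ball x₀ (R / 8), ∑ i, ∑ j, M i j x ^ 2
      = ∫ x in ball x₀ (R / 8), ∑ i, ∑ j, (χ x * M i j x + τ j x * pderiv i χ x) ^ 2 := by
        refine setIntegral_congr_fun measurableSet_ball fun x hx => ?_
        simp [hin x hx]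
    _ ≤ ∫ x, ∑ i, ∑ j, (χ x * M i j x + τ j x * pderiv i χ x) ^ 2 :=
        setIntegral_le_integral (integrable_finsetSum _ fun i _ => integrable_finsetSum _ fun j _ =>
          integrable_sq_L2 (hτ'.memLp_grad i j)) (.of_forall fun x =>
            Finset.sum_nonneg fun i _ => Finset.sum_nonneg fun j _ => sq_nonneg _)
    _ ≤ K * ∫ x, divRotForm (fun j x => χ x * τ j x)
          (fun i j x => χ x * M i j x + τ j x * pderiv i χ x) x := hG _ _ hτ'
    _ ≤ K * ∫ x, (2 + 2 * n * C ^ 2 + n * n * (8 * C ^ 2)) * divRotForm τ M x := by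
        refine mul_le_mul_of_nonneg_left (integral_mono
          (integrable_divRotForm hτ'.memLp hτ'.memLp_grad)
          ((integrable_divRotForm hτ.memLp hτ.memLp_grad).const_mul _) fun x =>
            divRotForm_cutoff_le (hχ1 x) fun i => hC i x) hK
    _ = _ := by rw [integral_const_mul, ← mul_assoc]

/-- Gaffney's inequality for the fields of class `H¹` with zero normal trace. -/
theorem exists_gaffney {Ω : Set (E n)} (hΩ : IsOpen Ω) (hb : Bornology.IsBounded Ω)
    (hB : HasC11Boundary Ω) : ∃ K, 0 ≤ K ∧
      ∀ (τ : Fin n → E n → ℝ) (M : Fin n → Fin n → E n → ℝ), IsTangentialField Ω Set.univ τ M →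
        ∫ x, ∑ i, ∑ j, M i j x ^ 2 ≤ K * ∫ x, divRotForm τ M x := by
  choose! r hr K hK hG using fun x₀ (hx₀ : x₀ ∈ closure Ω) => exists_gaffney_ball hΩ hB hx₀
  -- Finitely many balls cover the closure of `Ω`, and the integrand vanishes elsewhere, so the
  -- local estimates may be added.
  obtain ⟨t, ht, hcov⟩ := hb.isCompact_closure.elim_nhds_subcover (fun x => ball x (r x))
    fun x hx => ball_mem_nhds x (hr x hx)
  refine ⟨∑ l ∈ t, K l, Finset.sum_nonneg fun l hl => hK l (ht l hl), fun τ M hτ => ?_⟩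
  set F := fun x => ∑ i, ∑ j, M i j x ^ 2 with hF
  have hF0 : ∀ x, 0 ≤ F x := fun x =>
    Finset.sum_nonneg fun i _ => Finset.sum_nonneg fun j _ => sq_nonneg _
  have hFi : Integrable F := integrable_finsetSum _ fun i _ => integrable_finsetSum _ fun j _ =>
    integrable_sq_L2 (hτ.memLp_grad i j)
  calc ∫ x, F x ≤ ∫ x, ∑ l ∈ t, (ball l (r l)).indicator F x := by
        refine integral_mono hFi (integrable_finsetSum _ fun l _ =>
          hFi.indicator measurableSet_ball) fun x => ?_
        have hnn : ∀ l ∈ t, 0 ≤ (ball l (r l)).indicator F x := fun l _ =>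
          Set.indicator_nonneg (fun y _ => hF0 y) x
        by_cases hx : x ∈ Ω
        · obtain ⟨l, hl, hxl⟩ := Set.mem_iUnion₂.1 (hcov (subset_closure hx))
          refine le_trans (le_of_eq ?_) (Finset.single_le_sum hnn hl)
          rw [Set.indicator_of_mem hxl]
        · refine le_trans (le_of_eq ?_) (Finset.sum_nonneg hnn)
          simp [hF, hτ.grad_eq_zero _ _ x fun h => hx h.1]
    _ = ∑ l ∈ t, ∫ x in ball l (r l), F x := by
        rw [integral_finsetSum _ fun l _ => hFi.indicator measurableSet_ball]
        exact Finset.sum_congr rfl fun l _ => integral_indicator measurableSet_ball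
    _ ≤ ∑ l ∈ t, K l * ∫ x, divRotForm τ M x :=
        Finset.sum_le_sum fun l hl => hG l (ht l hl) τ M hτ
    _ = _ := by rw [Finset.sum_mul]

/-- The chart inequality has only the gradient on the right; the norm of `u` enters through the term
`u ∇χ` created by the cutoff. -/
theorem exists_eLpNorm_four_le_ball {Ω : Set (E n)} (hn2 : 2 ≤ n) (hn4 : n ≤ 4) (hΩ : IsOpen Ω)
    (hB : HasC11Boundary Ω) {x₀ : E n} (hx₀ : x₀ ∈ closure Ω) : ∃ r > 0, ∃ K : ℝ≥0∞, K ≠ ⊤ ∧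
      ∀ (u : E n → ℝ) (w : Fin n → E n → ℝ), MemLp u 2 → (∀ i, MemLp (w i) 2) →
        (∀ x ∉ Ω, u x = 0) → (∀ i, ∀ x ∉ Ω, w i x = 0) → HasWeakGrad Ω u w →
        eLpNorm ((ball x₀ r).indicator u) 4 volume ≤
          K * (eLpNorm u 2 volume + ∑ i, eLpNorm (w i) 2 volume) := by
  obtain ⟨g, a, R, h⟩ := exists_isChart hΩ hB hx₀ (ε := 1 / (4 * (n + 1))) (by positivity)
  have hR := h.R_pos
  obtain ⟨K, hK, hS⟩ := h.exists_eLpNorm_four_le hΩ (le_of_eq (by field_simp)) hn2 hn4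
  obtain ⟨χ, C, hχ, hC0, hχ1, hC, hin, hout⟩ := exists_cutoff x₀ (r := R / 8) (by positivity)
  rw [show 2 * (R / 8) = R / 4 by ring] at hout
  have hn0 : (1 : ℝ≥0∞) ≤ 1 + n * ENNReal.ofReal C := le_self_add
  refine ⟨R / 8, by positivity, K * (1 + n * ENNReal.ofReal C), ENNReal.mul_ne_top hK
    (ENNReal.add_ne_top.2 ⟨by simp, ENNReal.mul_ne_top (by simp) ENNReal.ofReal_ne_top⟩),
    fun u w hu hw hu0 hw0 hgrad => ?_⟩
  have hχw : ∀ i, MemLp (fun x => χ x * w i x) 2 := fun i =>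
    memLp_cutoff (hw i) hχ.continuous.measurable hχ1
  have hχu : ∀ i, MemLp (fun x => u x * pderiv i χ x) 2 := fun i =>
    MemLp.mul_of_bound hu (measurable_pderiv i χ).aestronglyMeasurable fun x _ => hC i x
  calc eLpNorm ((ball x₀ (R / 8)).indicator u) 4 volume
      ≤ eLpNorm (fun x => χ x * u x) 4 volume := by
        refine eLpNorm_mono fun x => ?_
        by_cases hx : x ∈ ball x₀ (R / 8)
        · simp [hx, (hin x hx).1]
        · rw [Set.indicator_of_notMem hx, norm_zero]
          exact norm_nonneg _
    _ ≤ K * ∑ i, eLpNorm (fun x => χ x * w i x + u x * pderiv i χ x) 2 volume := by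
        refine hS _ _ (memLp_cutoff hu hχ.continuous.measurable hχ1)
          (fun i => (hχw i).add (hχu i)) (fun x hx => ?_) (fun i x hx => ?_) (hgrad.cutoff hχ)
        · by_cases hxΩ : x ∈ Ω
          · simp [hout x fun hK => hx ⟨hxΩ, hK⟩]
          · simp [hu0 x hxΩ]
        · by_cases hxΩ : x ∈ Ω
          · simp [hout x fun hK => hx ⟨hxΩ, hK⟩]
          · simp [hu0 x hxΩ, hw0 i x hxΩ]
    _ ≤ K * ∑ i, (eLpNorm (w i) 2 volume + ENNReal.ofReal C * eLpNorm u 2 volume) := by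
        gcongr with i
        refine (eLpNorm_add_le (hχw i).1 (hχu i).1 (by norm_num)).trans (add_le_add ?_ ?_)
        · refine eLpNorm_mono fun x => ?_
          rw [norm_mul]
          exact mul_le_of_le_one_left (norm_nonneg _) (hχ1 x)
        · refine eLpNorm_le_mul_eLpNorm_of_ae_le_mul (.of_forall fun x => ?_) 2
          rw [norm_mul, mul_comm]
          exact mul_le_mul_of_nonneg_right (hC i x) (norm_nonneg _)
    _ ≤ K * ((1 + n * ENNReal.ofReal C) *
          (eLpNorm u 2 volume + ∑ i, eLpNorm (w i) 2 volume)) := by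
        gcongr
        rw [Finset.sum_add_distrib, Finset.sum_const, Finset.card_univ, Fintype.card_fin,
          nsmul_eq_mul, ← mul_assoc, add_comm, mul_add]
        exact add_le_add (mul_le_mul_left le_add_self _) (le_mul_of_one_le_left' hn0)
    _ = _ := by rw [mul_assoc]

/-- The Sobolev inequality `‖u‖_{L⁴(Ω)} ≤ K ‖u‖_{H¹(Ω)}`. -/
theorem exists_eLpNorm_four_le {Ω : Set (E n)} (hn2 : 2 ≤ n) (hn4 : n ≤ 4) (hΩ : IsOpen Ω)
    (hb : Bornology.IsBounded Ω) (hB : HasC11Boundary Ω) : ∃ K : ℝ≥0∞, K ≠ ⊤ ∧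
      ∀ (u : E n → ℝ) (w : Fin n → E n → ℝ), MemLp u 2 → (∀ i, MemLp (w i) 2) →
        (∀ x ∉ Ω, u x = 0) → (∀ i, ∀ x ∉ Ω, w i x = 0) → HasWeakGrad Ω u w →
        eLpNorm u 4 volume ≤ K * (eLpNorm u 2 volume + ∑ i, eLpNorm (w i) 2 volume) := by
  choose! r hr K hK hG using fun x₀ (hx₀ : x₀ ∈ closure Ω) =>
    exists_eLpNorm_four_le_ball hn2 hn4 hΩ hB hx₀
  obtain ⟨t, ht, hcov⟩ := hb.isCompact_closure.elim_nhds_subcover (fun x => ball x (r x))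
    fun x hx => ball_mem_nhds x (hr x hx)
  refine ⟨∑ l ∈ t, K l, ENNReal.sum_ne_top.2 fun l hl => hK l (ht l hl),
    fun u w hu hw hu0 hw0 hgrad => ?_⟩
  calc eLpNorm u 4 volume
      ≤ eLpNorm (∑ l ∈ t, fun x => ‖(ball l (r l)).indicator u x‖) 4 volume := by
        refine eLpNorm_mono fun x => ?_
        rw [Finset.sum_apply, Real.norm_of_nonneg (Finset.sum_nonneg fun l _ => norm_nonneg _)]
        by_cases hx : x ∈ Ω
        · obtain ⟨l, hl, hxl⟩ := Set.mem_iUnion₂.1 (hcov (subset_closure hx))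
          refine le_trans (le_of_eq ?_) (Finset.single_le_sum
            (f := fun l => ‖(ball l (r l)).indicator u x‖) (fun _ _ => norm_nonneg _) hl)
          rw [Set.indicator_of_mem hxl]
        · rw [hu0 x hx, norm_zero]
          exact Finset.sum_nonneg fun l _ => norm_nonneg _
    _ ≤ ∑ l ∈ t, eLpNorm (fun x => ‖(ball l (r l)).indicator u x‖) 4 volume :=
        eLpNorm_sum_le (fun l _ => (hu.1.indicator measurableSet_ball).norm) (by norm_num)
    _ ≤ ∑ l ∈ t, K l * (eLpNorm u 2 volume + ∑ i, eLpNorm (w i) 2 volume) := by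
        refine Finset.sum_le_sum fun l hl => ?_
        rw [eLpNorm_norm]
        exact hG l (ht l hl) u w hu hw hu0 hw0 hgrad
    _ = _ := by rw [Finset.sum_mul]

/-! ### Passage from `L²(Ω)` classes to functions extended by zero -/

variable {Ω : Set (E n)}

theorem memLp_indicator (hΩ : IsOpen Ω) (u : L2 Ω) : MemLp (Ω.indicator u) 2 :=
  (memLp_indicator_iff_restrict hΩ.measurableSet).2 (Lp.memLp u)

theorem memLp_test {φ : E n → ℝ} (h1 : Continuous φ) (h2 : HasCompactSupport φ) :
    MemLp φ 2 (volume.restrict Ω) :=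
  (h1.memLp_of_hasCompactSupport h2).restrict Ω

theorem integrable_mul_restrict {u v : E n → ℝ} (hu : MemLp u 2 (volume.restrict Ω))
    (hv : MemLp v 2 (volume.restrict Ω)) :
    Integrable (fun x => u x * v x) (volume.restrict Ω) :=
  hu.integrable_mul hv

theorem memLp_test_pderiv {φ : E n → ℝ} (h1 : ContDiff ℝ ∞ φ) (h2 : HasCompactSupport φ)
    (i : Fin n) : MemLp (pderiv i φ) 2 (volume.restrict Ω) :=
  memLp_test (contDiff_pderiv h1 i).continuous (h2.fderiv_apply (𝕜 := ℝ) _)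

theorem H1.hasWeakGrad (hΩ : IsOpen Ω) (u : H1 Ω) :
    HasWeakGrad Ω (Ω.indicator u.val) fun i => Ω.indicator (u.grad i) := by
  intro i φ h1 h2 h3
  have e : (fun x => Ω.indicator u.val x * pderiv i φ x + Ω.indicator (u.grad i) x * φ x) =
      Ω.indicator fun x => u.val x * pderiv i φ x + u.grad i x * φ x := by
    funext x
    by_cases hx : x ∈ Ω <;> simp [hx]
  rw [e, integral_indicator hΩ.measurableSet, integral_add
    (integrable_mul_restrict (Lp.memLp _) (memLp_test_pderiv h1 h2 i))
    (integrable_mul_restrict (Lp.memLp _) (memLp_test h1.continuous h2)),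
    u.isWeakPartial i φ h1 h2 h3, neg_add_cancel]

theorem memLp_div (σ : H1Sigma Ω) : MemLp (div σ.comp) 2 (volume.restrict Ω) :=
  memLp_finsetSum _ fun _ _ => Lp.memLp _

/-- The zero normal trace says precisely that extension by zero creates no divergence concentrated
on the boundary. -/
theorem H1Sigma.hasWeakDiv (hΩ : IsOpen Ω) (σ : H1Sigma Ω) :
    HasWeakDiv Set.univ (fun j => Ω.indicator (σ.comp j).val)
      fun x => ∑ i, Ω.indicator ((σ.comp i).grad i) x := by
  intro φ h1 h2 _
  have e : (fun x => (∑ i, Ω.indicator (σ.comp i).val x * pderiv i φ x) +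
      (∑ i, Ω.indicator ((σ.comp i).grad i) x) * φ x) =
      Ω.indicator fun x => (∑ i, (σ.comp i).val x * pderiv i φ x) + div σ.comp x * φ x := by
    funext x
    by_cases hx : x ∈ Ω <;> simp [hx, div]
  rw [e, integral_indicator hΩ.measurableSet, integral_add
    (integrable_finsetSum _ fun i _ =>
      integrable_mul_restrict (Lp.memLp _) (memLp_test_pderiv h1 h2 i))
    (integrable_mul_restrict (memLp_div σ) (memLp_test h1.continuous h2)), σ.normal_eq_zero φ h1 h2]

theorem H1Sigma.isTangentialField (hΩ : IsOpen Ω) (σ : H1Sigma Ω) :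
    IsTangentialField Ω Set.univ (fun j => Ω.indicator (σ.comp j).val)
      fun i j => Ω.indicator ((σ.comp j).grad i) where
  memLp _ := memLp_indicator hΩ _
  memLp_grad _ _ := memLp_indicator hΩ _
  eq_zero _ _ hx := Set.indicator_of_notMem (fun h => hx ⟨h, trivial⟩) _
  grad_eq_zero _ _ _ hx := Set.indicator_of_notMem (fun h => hx ⟨h, trivial⟩) _
  weakGrad j := (σ.comp j).hasWeakGrad hΩ
  weakDiv := σ.hasWeakDiv hΩ

theorem integral_mul_eq_inner (u v : L2 Ω) : ∫ x in Ω, u x * v x = inner ℝ u v := by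
  simp [L2.inner_def, mul_comm]

theorem integral_sq_eq_norm (u : L2 Ω) : ∫ x in Ω, u x ^ 2 = ‖u‖ ^ 2 := by
  rw [← real_inner_self_eq_norm_sq, ← integral_mul_eq_inner]
  simp only [sq]

/-- The divergence as an element of `L²(Ω)`. -/
def divL2 (σ : H1Sigma Ω) : L2 Ω :=
  ∑ i, (σ.comp i).grad i

/-- The components of `rot σ` as elements of `L²(Ω)`. -/
def rotL2 (σ : H1Sigma Ω) (i j : Fin n) : L2 Ω :=
  (σ.comp j).grad i - (σ.comp i).grad j

theorem coeFn_divL2 (σ : H1Sigma Ω) : divL2 σ =ᵐ[volume.restrict Ω] div σ.comp := by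
  filter_upwards [Lp.coeFn_finsetSum Finset.univ fun i => (σ.comp i).grad i] with x hx
  rw [divL2, hx, Finset.sum_apply, div]

theorem coeFn_rotL2 (σ : H1Sigma Ω) (i j : Fin n) :
    rotL2 σ i j =ᵐ[volume.restrict Ω] rot σ.comp i j :=
  Lp.coeFn_sub _ _

theorem B_eq (σ τ : H1Sigma Ω) : B σ τ = (∑ i, inner ℝ (σ.comp i).val (τ.comp i).val) +
    inner ℝ (divL2 σ) (divL2 τ) + ∑ i, ∑ j ∈ Finset.Ioi i, inner ℝ (rotL2 σ i j) (rotL2 τ i j) := by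
  have e1 : ∀ i j, (fun x => rot σ.comp i j x * rot τ.comp i j x) =ᵐ[volume.restrict Ω]
      fun x => rotL2 σ i j x * rotL2 τ i j x := fun i j => by
    filter_upwards [coeFn_rotL2 σ i j, coeFn_rotL2 τ i j] with x h1 h2
    rw [h1, h2]
  have e2 : (fun x => div σ.comp x * div τ.comp x) =ᵐ[volume.restrict Ω]
      fun x => divL2 σ x * divL2 τ x := by
    filter_upwards [coeFn_divL2 σ, coeFn_divL2 τ] with x h1 h2
    rw [h1, h2]
  have hi : ∀ i j, Integrable (fun x => rot σ.comp i j x * rot τ.comp i j x)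
      (volume.restrict Ω) := fun i j =>
    (integrable_mul_restrict (Lp.memLp (rotL2 σ i j)) (Lp.memLp _)).congr (e1 i j).symm
  simp only [B, rotDot]
  rw [integral_finsetSum _ fun i _ => integrable_mul_restrict (Lp.memLp _) (Lp.memLp _),
    integral_congr_ae e2, integral_finsetSum _ fun i _ => integrable_finsetSum _ fun j _ => hi i j]
  simp only [integral_mul_eq_inner]
  congr 1
  refine Finset.sum_congr rfl fun i _ => ?_
  rw [integral_finsetSum _ fun j _ => hi i j]
  refine Finset.sum_congr rfl fun j _ => ?_
  rw [integral_congr_ae (e1 i j), integral_mul_eq_inner]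

theorem integral_divRotForm (hΩ : IsOpen Ω) (σ : H1Sigma Ω) :
    ∫ x, divRotForm (fun j => Ω.indicator (σ.comp j).val)
      (fun i j => Ω.indicator ((σ.comp j).grad i)) x = B σ σ := by
  have e : divRotForm (fun j => Ω.indicator (σ.comp j).val)
      (fun i j => Ω.indicator ((σ.comp j).grad i)) =
      Ω.indicator fun x => (∑ i, (σ.comp i).val x * (σ.comp i).val x) +
        div σ.comp x * div σ.comp x + rotDot σ.comp σ.comp x := by
    funext x
    by_cases hx : x ∈ Ω
    · simp only [divRotForm, Set.indicator_of_mem hx, div, rotDot, rot, sq]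
      ring
    · simp [divRotForm, hx]
  have hm : ∀ i j, MemLp (rot σ.comp i j) 2 (volume.restrict Ω) := fun i j =>
    (Lp.memLp ((σ.comp j).grad i)).sub (Lp.memLp ((σ.comp i).grad j))
  have h1 : Integrable (fun x => ∑ i, (σ.comp i).val x * (σ.comp i).val x) (volume.restrict Ω) :=
    integrable_finsetSum _ fun i _ => integrable_mul_restrict (Lp.memLp _) (Lp.memLp _)
  have h2 := integrable_mul_restrict (memLp_div σ) (memLp_div σ)
  have h3 : Integrable (rotDot σ.comp σ.comp) (volume.restrict Ω) :=
    integrable_finsetSum _ fun i _ => integrable_finsetSum _ fun j _ =>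
      integrable_mul_restrict (hm i j) (hm i j)
  rw [e, integral_indicator hΩ.measurableSet]
  exact (integral_add (h1.add h2) h3).trans (congrArg (· + _) (integral_add h1 h2))

theorem exists_gaffney_B (hΩ : IsOpen Ω) (hb : Bornology.IsBounded Ω) (hB : HasC11Boundary Ω) :
    ∃ K, 0 ≤ K ∧ ∀ σ : H1Sigma Ω, ∑ j, ∑ i, ‖(σ.comp j).grad i‖ ^ 2 ≤ K * B σ σ := by
  obtain ⟨K, hK, h⟩ := exists_gaffney hΩ hb hB
  refine ⟨K, hK, fun σ => ?_⟩
  have h1 := h _ _ (σ.isTangentialField hΩ)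
  rw [integral_divRotForm hΩ, integral_finsetSum _ fun i _ => integrable_finsetSum _ fun j _ =>
      integrable_sq_L2 (memLp_indicator hΩ _)] at h1
  refine le_trans (le_of_eq ?_) h1
  rw [Finset.sum_comm]
  refine Finset.sum_congr rfl fun i _ => ?_
  rw [integral_finsetSum _ fun j _ => integrable_sq_L2 (memLp_indicator hΩ _)]
  refine Finset.sum_congr rfl fun j _ => ?_
  rw [← integral_sq_eq_norm, ← integral_indicator hΩ.measurableSet]
  congr 1
  funext x
  by_cases hx : x ∈ Ω <;> simp [hx]

theorem exists_sobolev (hn2 : 2 ≤ n) (hn4 : n ≤ 4) (hΩ : IsOpen Ω) (hb : Bornology.IsBounded Ω)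
    (hB : HasC11Boundary Ω) : ∃ K : ℝ≥0∞, K ≠ ⊤ ∧ ∀ u : H1 Ω,
      eLpNorm u.val 4 (volume.restrict Ω) ≤ K * (‖u.val‖ₑ + ∑ i, ‖u.grad i‖ₑ) := by
  obtain ⟨K, hK, h⟩ := exists_eLpNorm_four_le hn2 hn4 hΩ hb hB
  refine ⟨K, hK, fun u => ?_⟩
  have h1 := h _ _ (memLp_indicator hΩ u.val) (fun i => memLp_indicator hΩ (u.grad i))
    (fun x hx => Set.indicator_of_notMem hx _) (fun i x hx => Set.indicator_of_notMem hx _)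
    (u.hasWeakGrad hΩ)
  simpa only [eLpNorm_indicator_eq_eLpNorm_restrict hΩ.measurableSet, ← Lp.enorm_def] using h1

/-! ### The energy space as a Hilbert space -/

/-- Families of functions in `L²(Ω)`, indexed by a component (`none` for `u`, `some j` for `σⱼ`) and
a derivative (`none` for the function, `some i` for `∂ᵢ`). -/
abbrev Components (Ω : Set (E n)) : Type :=
  PiLp 2 fun _ : Option (Fin n) × Option (Fin n) => L2 Ω

/-- A continuous function with compact support as an element of `L²(Ω)`. -/
def testL2 (Ω : Set (E n)) {φ : E n → ℝ} (h1 : Continuous φ) (h2 : HasCompactSupport φ) : L2 Ω :=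
  (memLp_test h1 h2).toLp φ

/-- The derivative of a smooth function with compact support as an element of `L²(Ω)`. -/
def testGradL2 (Ω : Set (E n)) {φ : E n → ℝ} (h1 : ContDiff ℝ ∞ φ) (h2 : HasCompactSupport φ)
    (i : Fin n) : L2 Ω :=
  (memLp_test_pderiv h1 h2 i).toLp (pderiv i φ)

theorem integral_mul_toLp (u : L2 Ω) {φ : E n → ℝ} (h : MemLp φ 2 (volume.restrict Ω)) :
    ∫ x in Ω, u x * φ x = inner ℝ u (h.toLp φ) := by
  rw [← integral_mul_eq_inner]
  refine integral_congr_ae ?_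
  filter_upwards [h.coeFn_toLp] with x hx
  rw [hx]

theorem isWeakPartial_iff {i : Fin n} {u w : L2 Ω} : IsWeakPartial Ω i u w ↔
    ∀ (φ : E n → ℝ) (h1 : ContDiff ℝ ∞ φ) (h2 : HasCompactSupport φ), tsupport φ ⊆ Ω →
      inner ℝ u (testGradL2 Ω h1 h2 i) + inner ℝ w (testL2 Ω h1.continuous h2) = 0 := by
  refine forall_congr' fun φ => forall_congr' fun h1 => forall_congr' fun h2 =>
    forall_congr' fun h3 => ?_
  rw [integral_mul_toLp u (memLp_test_pderiv h1 h2 i),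
    integral_mul_toLp w (memLp_test h1.continuous h2), eq_neg_iff_add_eq_zero]
  rfl

theorem hasZeroNormalTrace_iff {σ : Fin n → H1 Ω} : HasZeroNormalTrace Ω σ ↔
    ∀ (φ : E n → ℝ) (h1 : ContDiff ℝ ∞ φ) (h2 : HasCompactSupport φ),
      ∑ i, (inner ℝ (σ i).val (testGradL2 Ω h1 h2 i) +
        inner ℝ ((σ i).grad i) (testL2 Ω h1.continuous h2)) = 0 := by
  refine forall_congr' fun φ => forall_congr' fun h1 => forall_congr' fun h2 => ?_
  rw [integral_finsetSum _ fun i _ =>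
    integrable_mul_restrict (Lp.memLp _) (memLp_test_pderiv h1 h2 i)]
  simp only [div, Finset.sum_mul]
  rw [integral_finsetSum _ fun i _ =>
    integrable_mul_restrict (Lp.memLp _) (memLp_test h1.continuous h2)]
  simp only [integral_mul_toLp _ (memLp_test h1.continuous h2),
    integral_mul_toLp _ (memLp_test_pderiv h1 h2 _), Finset.sum_add_distrib]
  rfl

/-- The space `H¹(Ω) × 𝐇¹_σ(Ω)` as a subspace of a product of `L²` spaces. -/
def energySpace (Ω : Set (E n)) : Submodule ℝ (Components Ω) where
  carrier := {p |
    (∀ c i, ∀ (φ : E n → ℝ) (h1 : ContDiff ℝ ∞ φ) (h2 : HasCompactSupport φ), tsupport φ ⊆ Ω →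
      inner ℝ (p (c, none)) (testGradL2 Ω h1 h2 i) +
        inner ℝ (p (c, some i)) (testL2 Ω h1.continuous h2) = 0) ∧
    ∀ (φ : E n → ℝ) (h1 : ContDiff ℝ ∞ φ) (h2 : HasCompactSupport φ),
      ∑ i, (inner ℝ (p (some i, none)) (testGradL2 Ω h1 h2 i) +
        inner ℝ (p (some i, some i)) (testL2 Ω h1.continuous h2)) = 0}
  add_mem' := by
    rintro p q ⟨hp1, hp2⟩ ⟨hq1, hq2⟩
    refine ⟨fun c i φ h1 h2 h3 => ?_, fun φ h1 h2 => ?_⟩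
    · simp only [PiLp.add_apply, inner_add_left]
      linarith [hp1 c i φ h1 h2 h3, hq1 c i φ h1 h2 h3]
    · have hp := hp2 φ h1 h2
      have hq := hq2 φ h1 h2
      simp only [PiLp.add_apply, inner_add_left, Finset.sum_add_distrib] at hp hq ⊢
      linarith
  zero_mem' := by
    refine ⟨fun c i φ h1 h2 h3 => ?_, fun φ h1 h2 => ?_⟩ <;> simp
  smul_mem' := by
    rintro a p ⟨hp1, hp2⟩
    refine ⟨fun c i φ h1 h2 h3 => ?_, fun φ h1 h2 => ?_⟩
    · simp only [PiLp.smul_apply, real_inner_smul_left]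
      rw [← mul_add, hp1 c i φ h1 h2 h3, mul_zero]
    · simp only [PiLp.smul_apply, real_inner_smul_left, ← mul_add, ← Finset.mul_sum]
      rw [hp2 φ h1 h2, mul_zero]

/-- Weak differentiability and the normal trace condition are equations between continuous
functionals of the components; closedness supplies the completeness that Lax–Milgram needs. -/
theorem isClosed_energySpace : IsClosed (energySpace Ω : Set (Components Ω)) := by
  have h : ∀ a, Continuous fun p : Components Ω => p a := fun a =>
    (PiLp.proj (𝕜 := ℝ) 2 (fun _ => L2 Ω) a).continuous
  have e : (energySpace Ω : Set (Components Ω)) = {p |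
    (∀ c i, ∀ (φ : E n → ℝ) (h1 : ContDiff ℝ ∞ φ) (h2 : HasCompactSupport φ), tsupport φ ⊆ Ω →
      inner ℝ (p (c, none)) (testGradL2 Ω h1 h2 i) +
        inner ℝ (p (c, some i)) (testL2 Ω h1.continuous h2) = 0) ∧
    ∀ (φ : E n → ℝ) (h1 : ContDiff ℝ ∞ φ) (h2 : HasCompactSupport φ),
      ∑ i, (inner ℝ (p (some i, none)) (testGradL2 Ω h1 h2 i) +
        inner ℝ (p (some i, some i)) (testL2 Ω h1.continuous h2)) = 0} := rfl
  rw [e, Set.ofPred_and]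
  refine IsClosed.inter ?_ ?_
  · simp only [Set.ofPred_forall]
    refine isClosed_iInter fun c => isClosed_iInter fun i => isClosed_iInter fun φ =>
      isClosed_iInter fun h1 => isClosed_iInter fun h2 => isClosed_iInter fun h3 =>
      isClosed_eq ?_ continuous_const
    exact ((h _).inner continuous_const).add ((h _).inner continuous_const)
  · simp only [Set.ofPred_forall]
    refine isClosed_iInter fun φ => isClosed_iInter fun h1 => isClosed_iInter fun h2 =>
      isClosed_eq ?_ continuous_const
    exact continuous_finsetSum _ fun i _ =>
      ((h _).inner continuous_const).add ((h _).inner continuous_const)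

instance : CompleteSpace (energySpace Ω) :=
  isClosed_energySpace.isComplete.completeSpace_coe

/-- A component of an element of the energy space. -/
def componentH1 (p : energySpace Ω) (c : Option (Fin n)) : H1 Ω where
  val := p.1 (c, none)
  grad i := p.1 (c, some i)
  isWeakPartial i := isWeakPartial_iff.2 (p.2.1 c i)

/-- The vector field which is a part of an element of the energy space. -/
def fieldH1 (p : energySpace Ω) : H1Sigma Ω where
  comp j := componentH1 p (some j)
  normal_eq_zero := hasZeroNormalTrace_iff.2 p.2.2

/-- The element of the energy space with given components. -/
def energyPair (u : H1 Ω) (σ : H1Sigma Ω) : energySpace Ω :=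
  ⟨WithLp.toLp 2 fun a => match a with
    | (none, none) => u.val
    | (none, some i) => u.grad i
    | (some j, none) => (σ.comp j).val
    | (some j, some i) => (σ.comp j).grad i, by
    refine ⟨fun c i => ?_, hasZeroNormalTrace_iff.1 σ.normal_eq_zero⟩
    cases c with
    | none => exact isWeakPartial_iff.1 (u.isWeakPartial i)
    | some j => exact isWeakPartial_iff.1 ((σ.comp j).isWeakPartial i)⟩

theorem componentH1_energyPair (u : H1 Ω) (σ : H1Sigma Ω) :
    componentH1 (energyPair u σ) none = u := rfl

theorem fieldH1_energyPair (u : H1 Ω) (σ : H1Sigma Ω) : fieldH1 (energyPair u σ) = σ := rfl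

theorem norm_sq_energySpace (p : energySpace Ω) : ‖p‖ ^ 2 =
    (‖(componentH1 p none).val‖ ^ 2 + ∑ i, ‖(componentH1 p none).grad i‖ ^ 2) +
    ((∑ j, ‖((fieldH1 p).comp j).val‖ ^ 2) + ∑ j, ∑ i, ‖((fieldH1 p).comp j).grad i‖ ^ 2) := by
  rw [Submodule.coe_norm, PiLp.norm_sq_eq_of_L2, Fintype.sum_prod_type]
  simp only [Fintype.sum_option, Finset.sum_add_distrib]
  rw [add_add_add_comm]
  rfl

/-! ### The bilinear form of one time step and its coercivity -/

theorem holderTriple_four_four_two : ENNReal.HolderTriple 4 4 2 := by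
  refine ⟨?_⟩
  have h : (4 : ℝ≥0∞)⁻¹ = 2⁻¹ * 2⁻¹ := by
    rw [← ENNReal.mul_inv (by simp) (by simp)]
    norm_num
  rw [h, ← mul_add, ENNReal.inv_two_add_inv_two, mul_one]

/-- The evaluation of a component on the energy space. -/
def evalComponent (Ω : Set (E n)) (a : Option (Fin n) × Option (Fin n)) :
    energySpace Ω →L[ℝ] L2 Ω :=
  (PiLp.proj 2 (fun _ => L2 Ω) a).comp (energySpace Ω).subtypeL

/-- Multiplication of a component by a function in `H¹(Ω)` is a bounded map into `L²(Ω)`. -/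
theorem exists_mulComponent (hn2 : 2 ≤ n) (hn4 : n ≤ 4) (hΩ : IsOpen Ω)
    (hb : Bornology.IsBounded Ω) (hB : HasC11Boundary Ω) (u' : H1 Ω) (c : Option (Fin n)) :
    ∃ T : energySpace Ω →L[ℝ] L2 Ω, ∀ p, T p =ᵐ[volume.restrict Ω]
      fun x => u'.val x * (componentH1 p c).val x := by
  obtain ⟨K, hK, hS⟩ := exists_sobolev hn2 hn4 hΩ hb hB
  have := holderTriple_four_four_two
  have hfin : ∀ u : H1 Ω, K * (‖u.val‖ₑ + ∑ i, ‖u.grad i‖ₑ) ≠ ⊤ := fun u =>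
    ENNReal.mul_ne_top hK (ENNReal.add_ne_top.2 ⟨enorm_ne_top, ENNReal.sum_ne_top.2 fun i _ =>
      enorm_ne_top⟩)
  have h4 : ∀ u : H1 Ω, MemLp u.val 4 (volume.restrict Ω) := fun u =>
    ⟨(Lp.memLp u.val).1, (hS u).trans_lt (hfin u).lt_top⟩
  have hmem : ∀ p : energySpace Ω, MemLp (fun x => u'.val x * (componentH1 p c).val x) 2
      (volume.restrict Ω) := fun p => (h4 _).mul (h4 u')
  let T₀ : energySpace Ω →ₗ[ℝ] L2 Ω :=
    { toFun := fun p => (hmem p).toLp _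
      map_add' := fun p q => by
        refine Lp.ext ?_
        filter_upwards [(hmem (p + q)).coeFn_toLp, (hmem p).coeFn_toLp, (hmem q).coeFn_toLp,
          Lp.coeFn_add ((hmem p).toLp _) ((hmem q).toLp _),
          Lp.coeFn_add (componentH1 p c).val (componentH1 q c).val] with x h1 h2 h3 h5 h6
        have e : (componentH1 (p + q) c).val = (componentH1 p c).val + (componentH1 q c).val := rfl
        rw [h1, h5, Pi.add_apply, h2, h3, e, h6, Pi.add_apply, mul_add]
      map_smul' := fun a p => by
        refine Lp.ext ?_
        filter_upwards [(hmem (a • p)).coeFn_toLp, (hmem p).coeFn_toLp,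
          Lp.coeFn_smul a ((hmem p).toLp _),
          Lp.coeFn_smul a (componentH1 p c).val] with x h1 h2 h5 h6
        have e : (componentH1 (a • p) c).val = a • (componentH1 p c).val := rfl
        rw [h1, RingHom.id_apply, h5, Pi.smul_apply, h2, e, h6, Pi.smul_apply, smul_eq_mul,
          smul_eq_mul]
        ring }
  have hbound : ∀ p, ‖T₀ p‖ ≤ ((eLpNorm u'.val 4 (volume.restrict Ω)) *
      (K * (1 + n))).toReal * ‖p‖ := fun p => by
    have hN : ∀ d, ‖p.1 (c, d)‖ₑ ≤ ‖p‖ₑ := fun d => by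
      rw [enorm_le_iff_norm_le]
      exact PiLp.norm_apply_le p.1 (c, d)
    have h1 : eLpNorm (fun x => u'.val x * (componentH1 p c).val x) 2 (volume.restrict Ω) ≤
        eLpNorm u'.val 4 (volume.restrict Ω) * (K * (1 + n)) * ‖p‖ₑ := by
      -- Hölder's inequality `L⁴ · L⁴ ⊂ L²`, followed by the Sobolev inequality for the varying
      -- factor.
      refine (eLpNorm_smul_le_mul_eLpNorm (p := 4) (q := 4) (h4 (componentH1 p c)).1 (h4 u').1).trans ?_
      rw [mul_assoc, mul_assoc K]
      gcongr
      refine (hS _).trans ?_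
      gcongr
      rw [add_mul, one_mul]
      refine add_le_add (hN none) ((Finset.sum_le_sum fun i _ => hN (some i)).trans (le_of_eq ?_))
      simp
    have h2 : T₀ p = (hmem p).toLp _ := rfl
    rw [h2, Lp.norm_toLp, ← toReal_enorm p, ← ENNReal.toReal_mul]
    refine ENNReal.toReal_mono (ENNReal.mul_ne_top (ENNReal.mul_ne_top (h4 u').2.ne
      (ENNReal.mul_ne_top hK ?_)) enorm_ne_top) h1
    exact ENNReal.add_ne_top.2 ⟨by simp, by simp⟩
  exact ⟨T₀.mkContinuous _ hbound, fun p => (hmem p).coeFn_toLp⟩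

/-- The bilinear form `(p, q) ↦ (S p, T q)`. -/
def innerComp (S T : energySpace Ω →L[ℝ] L2 Ω) : energySpace Ω →L[ℝ] energySpace Ω →L[ℝ] ℝ :=
  (innerSL ℝ : L2 Ω →L[ℝ] L2 Ω →L[ℝ] ℝ).bilinearComp S T

theorem innerComp_apply (S T : energySpace Ω →L[ℝ] L2 Ω) (p q : energySpace Ω) :
    innerComp S T p q = inner ℝ (S p) (T q) := by
  simp [innerComp]

/-- The divergence on the energy space. -/
def divComponent (Ω : Set (E n)) : energySpace Ω →L[ℝ] L2 Ω :=
  ∑ i, evalComponent Ω (some i, some i)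

/-- The rotation on the energy space. -/
def rotComponent (Ω : Set (E n)) (i j : Fin n) : energySpace Ω →L[ℝ] L2 Ω :=
  evalComponent Ω (some j, some i) - evalComponent Ω (some i, some j)

theorem divComponent_apply (p : energySpace Ω) : divComponent Ω p = divL2 (fieldH1 p) := by
  simp only [divComponent, sum_apply]
  rfl

theorem rotComponent_apply (p : energySpace Ω) (i j : Fin n) :
    rotComponent Ω i j p = rotL2 (fieldH1 p) i j := rfl

/-- The bilinear form `B` on the energy space. -/
def formB (Ω : Set (E n)) : energySpace Ω →L[ℝ] energySpace Ω →L[ℝ] ℝ :=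
  (∑ j, innerComp (evalComponent Ω (some j, none)) (evalComponent Ω (some j, none))) +
  innerComp (divComponent Ω) (divComponent Ω) +
  ∑ i, ∑ j ∈ Finset.Ioi i, innerComp (rotComponent Ω i j) (rotComponent Ω i j)

theorem formB_apply (p q : energySpace Ω) : formB Ω p q = B (fieldH1 p) (fieldH1 q) := by
  simp only [formB, B_eq, add_apply, sum_apply,
    innerComp_apply, divComponent_apply, rotComponent_apply]
  rfl

/-- The bilinear form `(T p, ∇u)`. -/
def couplingForm (T : Fin n → energySpace Ω →L[ℝ] L2 Ω) :
    energySpace Ω →L[ℝ] energySpace Ω →L[ℝ] ℝ :=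
  ∑ i, innerComp (T i) (evalComponent Ω (none, some i))

theorem couplingForm_apply (T : Fin n → energySpace Ω →L[ℝ] L2 Ω) (p q : energySpace Ω) :
    couplingForm T p q = ∑ i, inner ℝ (T i p) ((componentH1 q none).grad i) := by
  simp only [couplingForm, sum_apply, innerComp_apply]
  rfl

/-- The bilinear form of one time step: twice the equation for `u` plus the equation for `σ`. -/
def stepForm (k : ℝ) (T : Fin n → energySpace Ω →L[ℝ] L2 Ω) :
    energySpace Ω →L[ℝ] energySpace Ω →L[ℝ] ℝ :=
  (2 / k) • innerComp (evalComponent Ω (none, none)) (evalComponent Ω (none, none)) +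
  (2 : ℝ) • (∑ i, innerComp (evalComponent Ω (none, some i)) (evalComponent Ω (none, some i))) +
  (2 : ℝ) • couplingForm T +
  (1 / k) • (∑ j, innerComp (evalComponent Ω (some j, none)) (evalComponent Ω (some j, none))) +
  formB Ω - (2 : ℝ) • (couplingForm T).flip

theorem stepForm_apply (k : ℝ) (T : Fin n → energySpace Ω →L[ℝ] L2 Ω) (p q : energySpace Ω) :
    stepForm k T p q =
      2 / k * inner ℝ (componentH1 p none).val (componentH1 q none).val +
      2 * (∑ i, inner ℝ ((componentH1 p none).grad i) ((componentH1 q none).grad i)) +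
      2 * couplingForm T p q +
      1 / k * (∑ j, inner ℝ ((fieldH1 p).comp j).val ((fieldH1 q).comp j).val) +
      B (fieldH1 p) (fieldH1 q) - 2 * couplingForm T q p := by
  simp only [stepForm, add_apply, sub_apply,
    smul_apply, sum_apply, innerComp_apply,
    formB_apply, ContinuousLinearMap.flip_apply, smul_eq_mul]
  rfl

/-- The letters stand for `a = ‖u‖²`, `b = ‖∇u‖²`, `s = ‖σ‖²`, `g = ‖∇σ‖²`, `β = ⟨Bσ, σ⟩`, and the
coupling `c` cancels. Multiplication by `k` recovers `a` from `(2/k) a`, and multiplication by `1 +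
K` makes `β` dominate both `s` and `g`. -/
theorem coercivity_estimate {k K a b s g β : ℝ} (hk : 0 < k) (hK : 0 ≤ K) (ha : 0 ≤ a)
    (hb : 0 ≤ b) (hs : 0 ≤ s) (hβ : s ≤ β) (hg : g ≤ K * β) (c : ℝ) :
    a + b + (s + g) ≤
      (k + (1 + K)) * (2 / k * a + 2 * b + 2 * c + 1 / k * s + β - 2 * c) := by
  have e : (k + (1 + K)) * (2 / k * a + 2 * b + 2 * c + 1 / k * s + β - 2 * c) =
      (2 * a + 2 * b + β + K * β) + ((1 + K) * (2 / k * a) + k * (2 * b) + 2 * K * b + s +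
      (1 + K) * (1 / k * s) + k * β) := by
    field_simp
    ring
  have h0 : 0 ≤ (1 + K) * (2 / k * a) + k * (2 * b) + 2 * K * b + s +
      (1 + K) * (1 / k * s) + k * β := by
    have : 0 ≤ β := hs.trans hβ
    positivity
  rw [e]
  linarith

theorem isCoercive_stepForm (hΩ : IsOpen Ω) (hb : Bornology.IsBounded Ω)
    (hB : HasC11Boundary Ω) {k : ℝ} (hk : 0 < k) (T : Fin n → energySpace Ω →L[ℝ] L2 Ω) :
    IsCoercive (stepForm k T) := by
  obtain ⟨K, hK, hG⟩ := exists_gaffney_B hΩ hb hB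
  have hD : 0 < k + (1 + K) := by positivity
  refine ⟨1 / (k + (1 + K)), by positivity, fun p => ?_⟩
  rw [mul_assoc, ← sq, one_div, inv_mul_le_iff₀ hD, stepForm_apply, norm_sq_energySpace]
  have hGp := hG (fieldH1 p)
  have hBp : ∑ j, ‖((fieldH1 p).comp j).val‖ ^ 2 ≤ B (fieldH1 p) (fieldH1 p) := by
    rw [B_eq]
    simp only [real_inner_self_eq_norm_sq, add_assoc]
    exact le_add_of_nonneg_right (by positivity)
  simp only [real_inner_self_eq_norm_sq]
  exact coercivity_estimate hk hK (sq_nonneg _) (Finset.sum_nonneg fun i _ => sq_nonneg _)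
    (Finset.sum_nonneg fun i _ => sq_nonneg _) hBp hGp _

/-- The test functions of the two equations are independent, so their combination determines both:
the pairs `(w, 0)` and `(0, τ)` recover them, the first up to the factor `2`. -/
theorem isLCStep_iff {k : ℝ} {u' : H1 Ω} {σ' : H1Sigma Ω}
    {T : Fin n → energySpace Ω →L[ℝ] L2 Ω}
    (hT : ∀ i p, T i p =ᵐ[volume.restrict Ω] fun x => u'.val x * ((fieldH1 p).comp i).val x)
    {p : energySpace Ω} : IsLCStep k u' σ' (componentH1 p none) (fieldH1 p) ↔
      ∀ q : energySpace Ω, stepForm k T p q =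
        2 / k * inner ℝ u'.val (componentH1 q none).val +
        1 / k * ∑ j, inner ℝ (σ'.comp j).val ((fieldH1 q).comp j).val := by
  have hsub : ∀ u v w : L2 Ω, ∫ x in Ω, (u x - v x) / k * w x =
      1 / k * (inner ℝ u w - inner ℝ v w) := fun u v w => by
    rw [← integral_mul_eq_inner, ← integral_mul_eq_inner, ← integral_sub
      (integrable_mul_restrict (Lp.memLp _) (Lp.memLp _))
      (integrable_mul_restrict (Lp.memLp _) (Lp.memLp _)), ← integral_const_mul]
    congr 1
    funext x
    ring
  have hisub : ∀ u v w : L2 Ω, Integrable (fun x => (u x - v x) / k * w x) (volume.restrict Ω) :=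
    fun u v w => integrable_mul_restrict
      (by
        simp only [div_eq_inv_mul]
        exact ((Lp.memLp u).sub (Lp.memLp v)).const_mul k⁻¹)
      (Lp.memLp w)
  have hmul : ∀ (q : energySpace Ω) (i : Fin n) (w : L2 Ω),
      (fun x => u'.val x * ((fieldH1 q).comp i).val x * w x) =ᵐ[volume.restrict Ω]
        fun x => T i q x * w x := fun q i w => by
    filter_upwards [hT i q] with x hx
    rw [hx]
  have hcoup : ∀ (q : energySpace Ω) (w : Fin n → L2 Ω),
      ∫ x in Ω, ∑ i, u'.val x * ((fieldH1 q).comp i).val x * w i x = ∑ i, inner ℝ (T i q) (w i) :=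
    fun q w => by
      rw [integral_finsetSum _ fun i _ => (integrable_mul_restrict (Lp.memLp (T i q))
        (Lp.memLp (w i))).congr (hmul q i (w i)).symm]
      refine Finset.sum_congr rfl fun i _ => ?_
      rw [integral_congr_ae (hmul q i (w i)), integral_mul_eq_inner]
  have hgrad : ∀ f g : Fin n → L2 Ω, ∫ x in Ω, ∑ i, f i x * g i x = ∑ i, inner ℝ (f i) (g i) :=
    fun f g => by
      rw [integral_finsetSum _ fun i _ => integrable_mul_restrict (Lp.memLp _) (Lp.memLp _)]
      simp only [integral_mul_eq_inner]
  have hu : ∀ q : energySpace Ω, ((∫ x in Ω, ((componentH1 p none).val x - u'.val x) / k *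
      (componentH1 q none).val x) + (∫ x in Ω, ∑ i, (componentH1 p none).grad i x *
      (componentH1 q none).grad i x) = - ∫ x in Ω, ∑ i, u'.val x * ((fieldH1 p).comp i).val x *
      (componentH1 q none).grad i x) ↔
      1 / k * (inner ℝ (componentH1 p none).val (componentH1 q none).val -
        inner ℝ u'.val (componentH1 q none).val) +
      (∑ i, inner ℝ ((componentH1 p none).grad i) ((componentH1 q none).grad i)) =
      - couplingForm T p q := fun q => by
    rw [hsub, hgrad, hcoup, couplingForm_apply]
  have hσ : ∀ q : energySpace Ω, ((∫ x in Ω, ∑ i, (((fieldH1 p).comp i).val x -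
      (σ'.comp i).val x) / k * ((fieldH1 q).comp i).val x) + B (fieldH1 p) (fieldH1 q) =
      2 * ∫ x in Ω, ∑ i, u'.val x * (componentH1 p none).grad i x * ((fieldH1 q).comp i).val x) ↔
      1 / k * ((∑ i, inner ℝ ((fieldH1 p).comp i).val ((fieldH1 q).comp i).val) -
        ∑ i, inner ℝ (σ'.comp i).val ((fieldH1 q).comp i).val) + B (fieldH1 p) (fieldH1 q) =
      2 * couplingForm T q p := fun q => by
    rw [couplingForm_apply, ← hcoup, integral_finsetSum _ fun i _ => hisub _ _ _]
    simp only [hsub, ← Finset.mul_sum, Finset.sum_sub_distrib, mul_right_comm (u'.val _)]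
  constructor
  · rintro ⟨h1, h2⟩ q
    have h3 := (hu q).1 (h1 _)
    have h4 := (hσ q).1 (h2 _)
    rw [stepForm_apply]
    linear_combination 2 * h3 + h4
  · intro h
    refine ⟨fun w => (hu (energyPair w (fieldH1 0))).2 ?_,
      fun τ => (hσ (energyPair (componentH1 0 none) τ)).2 ?_⟩
    · have h1 := h (energyPair w (fieldH1 0))
      have e1 : ∀ i, ((fieldH1 (0 : energySpace Ω)).comp i).val = 0 := fun i => rfl
      have e2 : couplingForm T (energyPair w (fieldH1 0)) p = 0 := by
        have : ∀ i, T i (energyPair w (fieldH1 0)) = 0 := fun i => by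
          refine Lp.ext ?_
          filter_upwards [hT i (energyPair w (fieldH1 0)), Lp.coeFn_zero ℝ 2 (volume.restrict Ω)]
            with x hx h0
          rw [hx, h0, fieldH1_energyPair, e1, h0, Pi.zero_apply, mul_zero]
        simp [couplingForm_apply, this]
      have e3 : B (fieldH1 p) (fieldH1 (0 : energySpace Ω)) = 0 := by
        rw [← formB_apply, map_zero]
      rw [stepForm_apply, e2, fieldH1_energyPair, e3] at h1
      simp only [e1, inner_zero_right, Finset.sum_const_zero] at h1
      linear_combination 1 / 2 * h1
    · have h1 := h (energyPair (componentH1 0 none) τ)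
      have e1 : (componentH1 (0 : energySpace Ω) none).val = 0 := rfl
      have e2 : ∀ i, (componentH1 (0 : energySpace Ω) none).grad i = 0 := fun i => rfl
      have e3 : couplingForm T p (energyPair (componentH1 0 none) τ) = 0 := by
        simp [couplingForm_apply, componentH1_energyPair, e2]
      rw [stepForm_apply, e3] at h1
      simp only [componentH1_energyPair, e1, e2, inner_zero_right, Finset.sum_const_zero] at h1
      linear_combination h1

end ChemoLC

end

/-! ### Conclusion by Lax–Milgram -/

theorem mainTheorem9 {n : ℕ} (hn : n = 2 ∨ n = 3) (Ω : Set (ChemoLC.E n))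
    (hΩ_open : IsOpen Ω) (hΩ_conn : IsConnected Ω) (hΩ_bdd : Bornology.IsBounded Ω)
    (hΩ_bdry : ChemoLC.HasC11Boundary Ω) (k : ℝ) (hk : 0 < k)
    (u' : ChemoLC.H1 Ω) (σ' : ChemoLC.H1Sigma Ω) :
    ∃! p : ChemoLC.H1 Ω × ChemoLC.H1Sigma Ω, ChemoLC.IsLCStep k u' σ' p.1 p.2 := by
  have hn2 : 2 ≤ n := by omega
  have hn4 : n ≤ 4 := by omega
  choose T hT using fun i : Fin n => ChemoLC.exists_mulComponent hn2 hn4 hΩ_open hΩ_bdd hΩ_bdry u'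
    (some i)
  have hstep : ∀ p : ChemoLC.energySpace Ω, ChemoLC.IsLCStep k u' σ' (ChemoLC.componentH1 p none)
      (ChemoLC.fieldH1 p) ↔ _ := fun p => ChemoLC.isLCStep_iff hT
  have hc := ChemoLC.isCoercive_stepForm hΩ_open hΩ_bdd hΩ_bdry hk T
  let ℓ : ChemoLC.energySpace Ω →L[ℝ] ℝ :=
    (2 / k) • (innerSL ℝ u'.val).comp (ChemoLC.evalComponent Ω (none, none)) +
    (1 / k) • ∑ j, (innerSL ℝ (σ'.comp j).val).comp (ChemoLC.evalComponent Ω (some j, none))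
  have hℓ : ∀ q, ℓ q = 2 / k * inner ℝ u'.val (ChemoLC.componentH1 q none).val +
      1 / k * ∑ j, inner ℝ (σ'.comp j).val ((ChemoLC.fieldH1 q).comp j).val := fun q => by
    simp only [ℓ, add_apply, smul_apply, sum_apply, smul_eq_mul]
    rfl
  -- Riesz representation turns the data into a vector, to which the inverse of the Lax–Milgram
  -- isomorphism is applied.
  obtain ⟨f, hf⟩ : ∃ f : ChemoLC.energySpace Ω, ∀ q, inner ℝ f q = ℓ q :=
    ⟨(InnerProductSpace.toDual ℝ _).symm ℓ, fun q => InnerProductSpace.toDual_symm_apply⟩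
  let p := hc.continuousLinearEquivOfBilin.symm f
  refine ⟨(ChemoLC.componentH1 p none, ChemoLC.fieldH1 p), (hstep p).2 fun q => ?_, ?_⟩
  · rw [← hℓ, ← hf, ← hc.continuousLinearEquivOfBilin_apply]
    simp only [p, ContinuousLinearEquiv.apply_symm_apply]
  · rintro ⟨u, σ⟩ h
    -- Any solution pair is an element of the energy space that the isomorphism sends to `f`, hence
    -- it equals `p`.
    have h1 := (hstep (ChemoLC.energyPair u σ)).1 h
    have h2 : f = hc.continuousLinearEquivOfBilin (ChemoLC.energyPair u σ) :=
      hc.unique_continuousLinearEquivOfBilin fun q => by rw [hf, hℓ, h1]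
    have h3 : p = ChemoLC.energyPair u σ := by
      simp only [p, h2, ContinuousLinearEquiv.symm_apply_apply]
    rw [h3]
    rfl
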